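/- A state on $\mathbb C^3\otimes\mathbb C^3$ is a positive semidefinite $9\times 9$ matrix of trace $1$. It is PPT if its partial transpose is positive semidefinite, and absolutely PPT if $U\rho U^\dagger$ is PPT for every unitary $U\in U(9)$. Let $\mathcal{AP}_{3,3}$ be the convex set of absolutely PPT states. For $a>b>c>0$ write $$\nu_{\mu,k,m}=\mathrm{diag}(\underbrace{a,\dots,a}_{\mu},\underbrace{b,\dots,b}_{k},\underbrace{c,\dots,c}_{m}),\qquad m=9-\mu-k .$$ For $x=(x_1\ge\dots\ge x_9)$ put $$L_1(x)=\begin{bmatrix}2x_9&x_8-x_1&x_6-x_2\\x_8-x_1&2x_7&x_5-x_3\\x_6-x_2&x_5-x_3&2x_4\end{bmatrix},\qquad L_2(x)=\begin{bmatrix}2x_9&x_8-x_1&x_7-x_2\\x_8-x_1&2x_6&x_5-x_3\\x_7-x_2&x_5-x_3&2x_4\end{bmatrix},$$ $l_i=\det L_i$. The "$j$-th root" of a real cubic is its $j$-th real root in increasing order. Let $y=0.056991\cdots$ be the second root of $481y^3-37y^2-17y+1$, $x$ the third (largest) root of $x^3-x^2-5x+1$, $c_4=\frac{10-\sqrt{17}}{83}$,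 $c_7=\frac{23-14\sqrt2}{137}$, and (exponents denote multiplicities) $$\zeta_3=\tfrac1{12}\mathrm{diag}(2^3,1^6),\quad \zeta_4=\tfrac1{10+\sqrt{17}}\mathrm{diag}\big((\tfrac{5+\sqrt{17}}4)^4,1^5\big),\quad \zeta_5=\tfrac1{5x+4}\mathrm{diag}(x^5,1^4),$$ $$\zeta_6=\tfrac1{21}\mathrm{diag}(3^6,1^3),\quad \zeta_7=\tfrac1{23+14\sqrt2}\mathrm{diag}\big((3+2\sqrt2)^7,1^2\big),\quad \zeta_8=\tfrac18\mathrm{diag}(1^8,0).$$ **Classification.** Let $3\le\mu\le7$, $k\ge1$, $m=9-\mu-k\ge1$, $(\mu,k,m)\ne(6,2,1)$, and $a>b>c>0$. Then $\nu_{\mu,k,m}$ is an extreme point of $\mathcal{AP}_{3,3}$ if and only if $c$ lies in the open interval listed below and $a,b$ are the listed functions of $c$. Conversely, every $c$ in the interval occurs, i.e. the listed functions satisfy $a>b>c>0$ there. As $c$ tends from inside the interval to its left (right) endpoint, $\nu_{\mu,k,m}$ tends to the first (second) listed state. Where only $b$ is listed, $a=\frac{1-kb-mc}{\mu}$. * $\nu_{3,1,5}$: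 $a=\frac{1+2c-\sqrt{1-20c+132c^2}}4$, $b=\frac{1-26c+3\sqrt{1-20c+132c^2}}4$; $c_4<c<\frac1{12}$; $\zeta_4,\zeta_3$. * $\nu_{3,2,4}$: $b$ is the first root of $8b^3+(-12-15c)b^2+(6-30c+114c^2)b-1+12c-39c^2+c^3$; $y<c<\frac1{12}$; $\zeta_5,\zeta_3$. * $\nu_{3,3,3}$: $a=\frac{3-18c+\sqrt{3(-1+24c-36c^2)}}{18}$, $b=\frac{3-\sqrt{3(-1+24c-36c^2)}}{18}$; $\frac1{21}<c<\frac1{12}$; $\zeta_6,\zeta_3$. * $\nu_{3,4,2}$: $b$ is the first root of $b^3+(-39+114c)b^2+(12-30c-15c^2)b-1+6c-12c^2+8c^3$; $c_7<c<\frac1{12}$; $\zeta_7,\zeta_3$. * $\nu_{3,5,1}$: $a=\frac{8-43c+5\sqrt{16c+33c^2}}{64}$, $b=\frac{8+13c-3\sqrt{16c+33c^2}}{64}$; $0<c<\frac1{12}$; $\zeta_8,\zeta_3$. * $\nu_{4,1,4}$: $b$ is the first root of $3b^3-7b^2+(5-48c+112c^2)b-1+16c-48c^2-32c^3$; $y<c<c_4$;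 $\zeta_5,\zeta_4$. * $\nu_{4,2,3}$: $a=\frac{3-6c+\sqrt{-1+24c-54c^2}}{20}$, $b=\frac{2-9c-\sqrt{-1+24c-54c^2}}{10}$; $\frac1{21}<c<c_4$; $\zeta_6,\zeta_4$. * $\nu_{4,3,2}$: $b$ is the second root of $11b^3+(31-2c)b^2+(-11+36c-52c^2)b+1-10c+36c^2-40c^3$; $c_7<c<c_4$; $\zeta_7,\zeta_4$. * $\nu_{4,4,1}$: $b$ is the first root of $256b^3+(-128-128c)b^2+(20+24c-44c^2)b-1+c+c^2-c^3$; $0<c<c_4$; $\zeta_8,\zeta_4$. * $\nu_{5,1,3}$: $b$ is the first root of $b^3+(-3-161c)b^2+(3+22c-168c^2)b-1+14c+18c^2-153c^3$; $\frac1{21}<c<y$; $\zeta_6,\zeta_5$. * $\nu_{5,2,2}$: $b$ is the second root of $237b^3+(-58+276c)b^2+(-1-56c+66c^2)b+1-16c+77c^2-98c^3$; $c_7<c<y$; $\zeta_7,\zeta_5$. * $\nu_{5,3,1}$: $b$ is the second root of $128b^3+(32+268c)b^2+(-14-72c+86c^2)b+1-3c+3c^2-c^3$; $0<c<y$; $\zeta_8,\zeta_5$.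 * $\nu_{6,1,2}$: $a=-11c+2\sqrt{c+28c^2}$, $b=1+64c-12\sqrt{c+28c^2}$; $c_7<c<\frac1{21}$; $\zeta_7,\zeta_6$. * $\nu_{7,1,1}$: $a=\frac{4-3c+\sqrt{8c-7c^2}}{32}$, $b=\frac{4-11c-7\sqrt{8c-7c^2}}{32}$; $0<c<c_7$; $\zeta_8,\zeta_7$. **Branches.** Let $\lambda$ be the spectrum of $\nu_{\mu,k,m}$, with $a>b>c>0$ and trace $1$. For $\nu_{3,3,3},\nu_{4,2,3},\nu_{5,1,3},\nu_{6,1,2}$ the conditions $l_1(\lambda)=0$, $L_2(\lambda)\ge O$ hold exactly for the family listed above, and the conditions $l_2(\lambda)=0$, $L_1(\lambda)\ge O$ have no solution. **The case $\nu_{6,2,1}$.** For $a>b>c>0$, $\nu_{6,2,1}$ is an extreme point if and only if it lies on one of the two branches 1. $a=\frac{1-4c+\sqrt{2c+7c^2}}8$, $b=\frac{1+8c-3\sqrt{2c+7c^2}}8$, $\frac1{57}\le c<\frac1{21}$; 2. $a=\frac{2-c+\sqrt{4c-3c^2}}{16}$, $b=\frac{2-5c-3\sqrt{4c-3c^2}}{16}$,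 $0<c\le\frac1{57}$. Here $a>b>c>0$ holds for every such $c$. Among spectra $a>b>c>0$ of trace $1$, branch 1 is the solution set of $l_1(\lambda)=0$, $L_2(\lambda)\ge O$; branch 2 is that of $l_2(\lambda)=0$, $L_1(\lambda)\ge O$; and $l_1(\lambda)=l_2(\lambda)=0$ holds only for $(a,b,c)=(\frac8{57},\frac4{57},\frac1{57})$. Branch 1 tends to $\zeta_6$ as $c\to\frac1{21}$, branch 2 tends to $\zeta_8$ as $c\to0$, and at $c=\frac1{57}$ both equal the extreme point $\frac1{57}\mathrm{diag}(8,8,8,8,8,8,4,4,1)$. -/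

import Mathlib

open Filter Topology Set
open scoped ComplexOrder

noncomputable section

namespace AbsPPT

/-- Square complex matrices acting on `ℂ^m ⊗ ℂ^n`, indexed by the product basis. -/
abbrev BipartiteMatrix (m n : ℕ) : Type := Matrix (Fin m × Fin n) (Fin m × Fin n) ℂ

/-- Partial transposition on the second tensor factor. -/
def partialTranspose {m n : ℕ} (M : BipartiteMatrix m n) : BipartiteMatrix m n :=
  Matrix.of fun p q => M (p.1, q.2) (q.1, p.2)

/-- A state is a positive semidefinite matrix of trace one. -/
def IsState {m n : ℕ} (ρ : BipartiteMatrix m n) : Prop :=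
  ρ.PosSemidef ∧ ρ.trace = 1

/-- A PPT state is a state whose partial transpose is positive semidefinite. -/
def IsPPTState {m n : ℕ} (ρ : BipartiteMatrix m n) : Prop :=
  IsState ρ ∧ (partialTranspose ρ).PosSemidef

/-- The set of `m × n` absolutely PPT states: those that are PPT states after conjugation by
an arbitrary global unitary matrix. -/
def AP (m n : ℕ) : Set (BipartiteMatrix m n) :=
  {ρ | IsPPTState ρ ∧
    ∀ U ∈ Matrix.unitaryGroup (Fin m × Fin n) ℂ, IsPPTState (U * ρ * U.conjTranspose)}

/-- The extreme points of the convex set of two-qutrit absolutely PPT states. -/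
def extremeAP : Set (BipartiteMatrix 3 3) := (AP 3 3).extremePoints ℝ

/-- The diagonal two-qutrit matrix `diag(v 0, …, v 8)`, the product basis being ordered
lexicographically. -/
def diag9 (v : Fin 9 → ℝ) : BipartiteMatrix 3 3 :=
  Matrix.diagonal fun p => ((v (finProdFinEquiv p) : ℝ) : ℂ)

/-- The vector `(a, …, a, b, …, b, c, …, c)` with `μ` entries `a`, then `k` entries `b`, then
`9 - μ - k` entries `c`. -/
def nuVec (μ k : ℕ) (a b c : ℝ) : Fin 9 → ℝ := fun i =>
  if (i : ℕ) < μ then a else if (i : ℕ) < μ + k then b else c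

/-- The matrix `ν_{μ,k,9-μ-k} = diag(a, …, a, b, …, b, c, …, c)`. -/
def nu (μ k : ℕ) (a b c : ℝ) : BipartiteMatrix 3 3 := diag9 (nuVec μ k a b c)

/-- The matrix `L₁`; the entry `x_i` of the mathematical notation is `x (i - 1)` here. -/
def L1 (x : Fin 9 → ℝ) : Matrix (Fin 3) (Fin 3) ℝ :=
  !![2 * x 8, x 7 - x 0, x 5 - x 1;
     x 7 - x 0, 2 * x 6, x 4 - x 2;
     x 5 - x 1, x 4 - x 2, 2 * x 3]

/-- The matrix `L₂`, with the same indexing convention as `L1`. -/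
def L2 (x : Fin 9 → ℝ) : Matrix (Fin 3) (Fin 3) ℝ :=
  !![2 * x 8, x 7 - x 0, x 6 - x 1;
     x 7 - x 0, 2 * x 5, x 4 - x 2;
     x 6 - x 1, x 4 - x 2, 2 * x 3]

/-- `l₁ = det L₁`. -/
def l1 (x : Fin 9 → ℝ) : ℝ := (L1 x).det

/-- `l₂ = det L₂`. -/
def l2 (x : Fin 9 → ℝ) : ℝ := (L2 x).det

/-- The polynomial `p₃ X³ + p₂ X² + p₁ X + p₀`. -/
def cubic (p₃ p₂ p₁ p₀ : ℝ) : Polynomial ℝ :=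
  Polynomial.C p₃ * Polynomial.X ^ 3 + Polynomial.C p₂ * Polynomial.X ^ 2 +
    Polynomial.C p₁ * Polynomial.X + Polynomial.C p₀

/-- The `j`-th real root (`j = 1, 2, …`) of a polynomial, the real roots being listed in
nondecreasing order and with multiplicity; it is `0` if there are fewer than `j` real roots. -/
def realRoot (j : ℕ) (p : Polynomial ℝ) : ℝ := (p.roots.sort (· ≤ ·)).getD (j - 1) 0

/-- The second real root of `481 y³ - 37 y² - 17 y + 1`. -/
def y₀ : ℝ := realRoot 2 (cubic 481 (-37) (-17) 1)

/-- The largest real root of `x³ - x² - 5 x + 1`. -/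
def x₀ : ℝ := realRoot 3 (cubic 1 (-1) (-5) 1)

/-- `(10 - √17) / 83` -/
def c₄ : ℝ := (10 - √17) / 83

/-- `(23 - 14 √2) / 137` -/
def c₇ : ℝ := (23 - 14 * √2) / 137

def ζ₃ : BipartiteMatrix 3 3 := diag9 ((1 / 12 : ℝ) • ![2, 2, 2, 1, 1, 1, 1, 1, 1])

def ζ₄ : BipartiteMatrix 3 3 :=
  diag9 ((1 / (10 + √17) : ℝ) •
    ![(5 + √17) / 4, (5 + √17) / 4, (5 + √17) / 4, (5 + √17) / 4, 1, 1, 1, 1, 1])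

def ζ₅ : BipartiteMatrix 3 3 :=
  diag9 ((1 / (5 * x₀ + 4) : ℝ) • ![x₀, x₀, x₀, x₀, x₀, 1, 1, 1, 1])

def ζ₆ : BipartiteMatrix 3 3 := diag9 ((1 / 21 : ℝ) • ![3, 3, 3, 3, 3, 3, 1, 1, 1])

def ζ₇ : BipartiteMatrix 3 3 :=
  diag9 ((1 / (23 + 14 * √2) : ℝ) •
    ![3 + 2 * √2, 3 + 2 * √2, 3 + 2 * √2, 3 + 2 * √2, 3 + 2 * √2, 3 + 2 * √2, 3 + 2 * √2, 1, 1])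

def ζ₈ : BipartiteMatrix 3 3 := diag9 ((1 / 8 : ℝ) • ![1, 1, 1, 1, 1, 1, 1, 1, 0])

/-- `(a, b, c)` is the point with parameter `c` of the curve `c ↦ (A c, B c, c)` over `I`. -/
def OnCurve (I : Set ℝ) (A B : ℝ → ℝ) (a b c : ℝ) : Prop := c ∈ I ∧ a = A c ∧ b = B c

/-- Every parameter in `I` gives three distinct positive eigenvalues `A c > B c > c > 0`. -/
def Admissible (I : Set ℝ) (A B : ℝ → ℝ) : Prop := ∀ c ∈ I, B c < A c ∧ c < B c ∧ 0 < c

/-- The classification of the extreme points `ν_{μ,k,9-μ-k}` with three distinct positive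
eigenvalues `a > b > c > 0`: they are exactly the states with `lo < c < hi`, `a = A c`, `b = B c`,
each such `c` occurs, and the family tends to `ζlo` as `c → lo` and to `ζhi` as `c → hi`. -/
def TableRow (μ k : ℕ) (lo hi : ℝ) (A B : ℝ → ℝ) (ζlo ζhi : BipartiteMatrix 3 3) : Prop :=
  Admissible (Ioo lo hi) A B ∧
  (∀ a b c : ℝ, b < a → c < b → 0 < c →
    (nu μ k a b c ∈ extremeAP ↔ OnCurve (Ioo lo hi) A B a b c)) ∧
  Tendsto (fun c => nu μ k (A c) (B c) c) (𝓝[>] lo) (𝓝 ζlo) ∧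
  Tendsto (fun c => nu μ k (A c) (B c) c) (𝓝[<] hi) (𝓝 ζhi)

/-- The condition `l₁(λ) = 0` and `L₂(λ) ≥ O` on the spectrum of `ν_{μ,k,9-μ-k}`. -/
def FirstBranch (μ k : ℕ) (a b c : ℝ) : Prop :=
  l1 (nuVec μ k a b c) = 0 ∧ (L2 (nuVec μ k a b c)).PosSemidef

/-- The condition `l₂(λ) = 0` and `L₁(λ) ≥ O` on the spectrum of `ν_{μ,k,9-μ-k}`. -/
def SecondBranch (μ k : ℕ) (a b c : ℝ) : Prop :=
  l2 (nuVec μ k a b c) = 0 ∧ (L1 (nuVec μ k a b c)).PosSemidef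

/-- Among the spectra `a > b > c > 0` of trace one, the first branch is exactly the curve
`c ↦ (A c, B c, c)` over `(lo, hi)`, and the second branch is empty. -/
def OnlyFirstBranch (μ k : ℕ) (lo hi : ℝ) (A B : ℝ → ℝ) : Prop :=
  ∀ a b c : ℝ, b < a → c < b → 0 < c → ∑ i, nuVec μ k a b c i = 1 →
    (FirstBranch μ k a b c ↔ OnCurve (Ioo lo hi) A B a b c) ∧ ¬ SecondBranch μ k a b c

/-- The curves `c ↦ (a, b)` of the two branches of `ν_{6,2,1}`. -/
def A621₁ (c : ℝ) : ℝ := (1 - 4 * c + √(2 * c + 7 * c ^ 2)) / 8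
def B621₁ (c : ℝ) : ℝ := (1 + 8 * c - 3 * √(2 * c + 7 * c ^ 2)) / 8
def A621₂ (c : ℝ) : ℝ := (2 - c + √(4 * c - 3 * c ^ 2)) / 16
def B621₂ (c : ℝ) : ℝ := (2 - 5 * c - 3 * √(4 * c - 3 * c ^ 2)) / 16

/-- The value of `a` forced by trace one. -/
def aOf (μ k : ℕ) (B : ℝ → ℝ) (c : ℝ) : ℝ := (1 - k * B c - (9 - μ - k) * c) / μ

/-- The curves `c ↦ b` that are given by roots of cubics. -/
def B324 (c : ℝ) : ℝ :=
  realRoot 1 (cubic 8 (-12 - 15 * c) (6 - 30 * c + 114 * c ^ 2)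
    (-1 + 12 * c - 39 * c ^ 2 + c ^ 3))
def B342 (c : ℝ) : ℝ :=
  realRoot 1 (cubic 1 (-39 + 114 * c) (12 - 30 * c - 15 * c ^ 2)
    (-1 + 6 * c - 12 * c ^ 2 + 8 * c ^ 3))
def B414 (c : ℝ) : ℝ :=
  realRoot 1 (cubic 3 (-7) (5 - 48 * c + 112 * c ^ 2) (-1 + 16 * c - 48 * c ^ 2 - 32 * c ^ 3))
def B432 (c : ℝ) : ℝ :=
  realRoot 2 (cubic 11 (31 - 2 * c) (-11 + 36 * c - 52 * c ^ 2)
    (1 - 10 * c + 36 * c ^ 2 - 40 * c ^ 3))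
def B441 (c : ℝ) : ℝ :=
  realRoot 1 (cubic 256 (-128 - 128 * c) (20 + 24 * c - 44 * c ^ 2) (-1 + c + c ^ 2 - c ^ 3))
def B513 (c : ℝ) : ℝ :=
  realRoot 1 (cubic 1 (-3 - 161 * c) (3 + 22 * c - 168 * c ^ 2)
    (-1 + 14 * c + 18 * c ^ 2 - 153 * c ^ 3))
def B522 (c : ℝ) : ℝ :=
  realRoot 2 (cubic 237 (-58 + 276 * c) (-1 - 56 * c + 66 * c ^ 2)
    (1 - 16 * c + 77 * c ^ 2 - 98 * c ^ 3))
def B531 (c : ℝ) : ℝ :=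
  realRoot 2 (cubic 128 (32 + 268 * c) (-14 - 72 * c + 86 * c ^ 2)
    (1 - 3 * c + 3 * c ^ 2 - c ^ 3))

/-- The explicit curves of the rows `ν_{3,3,3}`, `ν_{4,2,3}`, `ν_{6,1,2}`. -/
def A333 (c : ℝ) : ℝ := (3 - 18 * c + √(3 * (-1 + 24 * c - 36 * c ^ 2))) / 18
def B333 (c : ℝ) : ℝ := (3 - √(3 * (-1 + 24 * c - 36 * c ^ 2))) / 18
def A423 (c : ℝ) : ℝ := (3 - 6 * c + √(-1 + 24 * c - 54 * c ^ 2)) / 20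
def B423 (c : ℝ) : ℝ := (2 - 9 * c - √(-1 + 24 * c - 54 * c ^ 2)) / 10
def A612 (c : ℝ) : ℝ := -11 * c + 2 * √(c + 28 * c ^ 2)
def B612 (c : ℝ) : ℝ := 1 + 64 * c - 12 * √(c + 28 * c ^ 2)

end AbsPPT

end

open AbsPPT

namespace AbsPPT
open Matrix

/-! Partial transposition is self-adjoint for the trace pairing, so `U ρ U†` is PPT exactly when it
pairs nonnegatively with the partial transpose of every `ξ ξ†`. By the Schmidt decomposition that
matrix is unitarily equivalent to a diagonal one with entries `sᵢ²` and `±sᵢsⱼ`. For diagonal `ρ`,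
the diagonal of `U ρ U†` is a doubly stochastic image of the spectrum, and Birkhoff's theorem
reduces all unitaries to permutations (`diag9_mem_AP_iff`). For a nonincreasing spectrum the
rearrangement inequality leaves two orders of the weights, according to whether `s₀s₂` or `s₁²` is
larger; these are `L₁ ≥ O` and `L₂ ≥ O` (`PSD.mem_spectralAP`).

A diagonal state is extreme iff its spectrum is extreme in `spectralAP` (`diag9_mem_extremeAP_iff`):
an end point of a segment through it has the same diagonal and, by a convex hull argument, the same
Frobenius norm, so it has no off-diagonal part. For three distinct values, extremality means that
`L₁` or `L₂` is singular (`nu_mem_extremeAP_iff`). If neither is, the spectrum can be moved both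
ways at constant trace. If one is, its kernel vector is inherited by the end points of any segment,
also after swapping equal eigenvalues; this forces the same block structure, and the kernel equation
together with the trace then fixes the three values.

For a fixed shape, trace one leaves a convex region in the `(b, c)` plane, with `(1/9, 1/9)` in its
interior. The interval for `c` is cut out by two boundary points, both two-valued spectra: `a = b`
at `c = lo`, and `b = c` at `c = hi`. On each horizontal line in between, convexity gives exactly
one boundary point, with positive definite forms to its right (`exists_sing_slice`,
`pd_of_psd_left`). Hence the determinant, a cubic in `b`, vanishes there and is positive just to the
right. The sign of the derivative, with a convexity condition where needed, tells which root it is;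
quadratic cases are solved by hand. The limits follow by squeezing (`tableRow_of`).

`L₁` and `L₂` differ only when a block ends after six entries. For `(3,3,3)`, `(4,2,3)`, `(5,1,3)`,
`(6,1,2)` the inequality `L₁ ≥ O` forces `l₂ > 0`, so only `l₁ = 0` contributes. For `(6,2,1)` the
forms reduce to `(a-b)² ≤ 4bc` and `(a-b)² ≤ 2ac`, which trade places at `a = 2b`. -/

/-! ### Schmidt decomposition and partially transposed rank one matrices -/

/-- The spectrum of the partial transpose of the projection on `∑ sᵢ eᵢ ⊗ eᵢ`. -/
def wt (s : Fin 3 → ℝ) (p : Fin 3 × Fin 3) : ℝ :=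
  if p.1 = p.2 then s p.1 ^ 2 else if p.1 < p.2 then s p.1 * s p.2 else -(s p.1 * s p.2)

/-- The vector `∑ sᵢ eᵢ ⊗ eᵢ`. -/
def schmidtVec (s : Fin 3 → ℝ) (p : Fin 3 × Fin 3) : ℂ := if p.1 = p.2 then (s p.1 : ℂ) else 0

/-- The partial transpose of the rank one matrix `ξ ξ†`. -/
def ptProj (ξ : Fin 3 × Fin 3 → ℂ) : BipartiteMatrix 3 3 :=
  partialTranspose (vecMulVec ξ (star ξ))

/-- A unitary diagonalising `ptProj (schmidtVec s)`. -/
noncomputable def pairBasis : BipartiteMatrix 3 3 :=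
  Matrix.of fun p q =>
    if q.1 = q.2 then (if p = q then 1 else 0)
    else if q.1 < q.2 then (if p = q then ((√2)⁻¹ : ℝ) else if p = q.swap then ((√2)⁻¹ : ℝ) else 0)
    else (if p = q then ((√2)⁻¹ : ℝ) else if p = q.swap then (-(√2)⁻¹ : ℝ) else 0)

lemma sqrt_two_inv_mul_self : (((√2)⁻¹ : ℝ) : ℂ) * (((√2)⁻¹ : ℝ) : ℂ) = 1 / 2 := by
  rw [← Complex.ofReal_mul, ← mul_inv, Real.mul_self_sqrt (by norm_num)]
  norm_num

lemma pairBasis_mul_conjTranspose : pairBasis * pairBasisᴴ = 1 := by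
  have h := sqrt_two_inv_mul_self
  generalize hr : (((√2)⁻¹ : ℝ) : ℂ) = r at h
  have hs : star r = r := by rw [← hr]; exact Complex.conj_ofReal _
  ext ⟨i, j⟩ ⟨k, l⟩
  rw [Matrix.mul_apply, Fintype.sum_prod_type]
  simp only [conjTranspose_apply, pairBasis, of_apply, Complex.ofReal_neg, hr, Fin.sum_univ_three]
  fin_cases i <;> fin_cases j <;> fin_cases k <;> fin_cases l <;>
    simp [hs, h, Prod.ext_iff, Prod.swap] <;> norm_num

lemma pairBasis_mem : pairBasis ∈ Matrix.unitaryGroup (Fin 3 × Fin 3) ℂ :=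
  Matrix.mem_unitaryGroup_iff.2 pairBasis_mul_conjTranspose

/-- The partial transpose sends `e_k ⊗ e_l` to `s_k s_l e_l ⊗ e_k`, so `e_i ⊗ e_i` and the symmetric
and antisymmetric combinations of `e_i ⊗ e_j`, `e_j ⊗ e_i` are eigenvectors. The basis puts the
symmetric one at `i < j` and the antisymmetric one at `i > j`, which is the sign rule of `wt`. -/
lemma ptProj_schmidtVec_mul (s : Fin 3 → ℝ) :
    ptProj (schmidtVec s) * pairBasis = pairBasis * diagonal fun p => ((wt s p : ℝ) : ℂ) := by
  generalize hr : (((√2)⁻¹ : ℝ) : ℂ) = r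
  ext ⟨i, j⟩ ⟨k, l⟩
  rw [Matrix.mul_apply, Fintype.sum_prod_type, Matrix.mul_diagonal]
  simp only [ptProj, partialTranspose, pairBasis, of_apply, Complex.ofReal_neg, hr, vecMulVec_apply,
    Fin.sum_univ_three, wt, schmidtVec, Pi.star_apply]
  fin_cases i <;> fin_cases j <;> fin_cases k <;> fin_cases l <;>
    simp [Prod.ext_iff, Prod.swap] <;> ring

lemma conj_ptProj_schmidtVec (s : Fin 3 → ℝ) :
    ptProj (schmidtVec s) =
      pairBasis * (diagonal fun p => ((wt s p : ℝ) : ℂ)) * pairBasisᴴ := by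
  rw [← ptProj_schmidtVec_mul, Matrix.mul_assoc, pairBasis_mul_conjTranspose, Matrix.mul_one]

/-- Self-adjointness of partial transposition for the trace pairing: the transposition moves from
`M` to the test matrix `ξ ξ†`. -/
lemma dotProduct_partialTranspose (M : BipartiteMatrix 3 3) (ξ : Fin 3 × Fin 3 → ℂ) :
    star ξ ⬝ᵥ (partialTranspose M *ᵥ ξ) = (M * ptProj ξ).trace := by
  simp only [dotProduct, mulVec, Matrix.trace, Matrix.diag, Matrix.mul_apply, ptProj,
    partialTranspose, of_apply, vecMulVec_apply, Pi.star_apply, Fintype.sum_prod_type,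
      Fin.sum_univ_three]
  ring

/-- Singular value decomposition, with ordered singular values. -/
theorem exists_svd (X : Matrix (Fin 3) (Fin 3) ℂ) :
    ∃ A ∈ Matrix.unitaryGroup (Fin 3) ℂ, ∃ B ∈ Matrix.unitaryGroup (Fin 3) ℂ, ∃ s : Fin 3 → ℝ,
      Antitone s ∧ (∀ i, 0 ≤ s i) ∧ X = A * (diagonal fun i => ((s i : ℝ) : ℂ)) * Bᵀ := by
  have hH : (Xᴴ * X).IsHermitian := isHermitian_conjTranspose_mul_self X
  have hpos : ∀ i, 0 ≤ hH.eigenvalues i := eigenvalues_conjTranspose_mul_self_nonneg X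
  set τ := Tuple.sort (fun i => -hH.eigenvalues i) with hτ
  have hmono : Monotone ((fun i => -hH.eigenvalues i) ∘ τ) := Tuple.monotone_sort _
  set v : Fin 3 → EuclideanSpace ℂ (Fin 3) := fun i => hH.eigenvectorBasis (τ i) with hv
  set s : Fin 3 → ℝ := fun i => √(hH.eigenvalues (τ i)) with hs
  have hXv : ∀ i j, inner ℂ (WithLp.toLp 2 (X *ᵥ (v i)) : EuclideanSpace ℂ (Fin 3))
      (WithLp.toLp 2 (X *ᵥ (v j))) = if i = j then ((s i) ^ 2 : ℂ) else 0 := by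
    intro i j
    have h1 : inner ℂ (WithLp.toLp 2 (X *ᵥ (v i)) : EuclideanSpace ℂ (Fin 3))
      (WithLp.toLp 2 (X *ᵥ (v j))) = inner ℂ (v i) (WithLp.toLp 2 ((Xᴴ * X) *ᵥ (v j))) := by
      simp only [EuclideanSpace.inner_eq_star_dotProduct]
      rw [star_mulVec, ← mulVec_mulVec, dotProduct_comm, ← dotProduct_mulVec, dotProduct_comm
        (Xᴴ *ᵥ _)]
    rw [h1, hH.mulVec_eigenvectorBasis]
    have h2 : (WithLp.toLp 2 (hH.eigenvalues (τ j) • (v j).ofLp) : EuclideanSpace ℂ (Fin 3)) =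
      ((hH.eigenvalues (τ j) : ℝ) : ℂ) • v j := by
      ext k; simp
    have h3 : inner ℂ (v i) (v j) = if i = j then (1 : ℂ) else 0 := by
      have := (orthonormal_iff_ite.1 hH.eigenvectorBasis.orthonormal) (τ i) (τ j)
      simpa [hv, τ.injective.eq_iff] using this
    rw [h2, inner_smul_right, h3]
    split_ifs with h
    · subst h
      rw [mul_one, hs, ← Complex.ofReal_pow, Real.sq_sqrt (hpos _)]
    · simp
  -- Left singular vectors; where `s i = 0` the inverse is the junk value `0`, and only indices with
  -- `s i ≠ 0` are used.
  set u : Fin 3 → EuclideanSpace ℂ (Fin 3) :=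
    fun i => ((s i)⁻¹ : ℂ) • WithLp.toLp 2 (X *ᵥ (v i)) with hu
  have hort : Orthonormal ℂ ({i | s i ≠ 0}.domRestrict u) := by
    rw [orthonormal_iff_ite]
    rintro ⟨i, hi⟩ ⟨j, hj⟩
    simp only [Set.domRestrict_apply, hu, inner_smul_left, inner_smul_right, hXv, Subtype.mk.injEq]
    have hi' : (s i : ℂ) ≠ 0 := by exact_mod_cast hi
    split_ifs with h
    · subst h
      simp; field_simp
    · simp
  -- The zero singular values leave gaps, filled by any completion to an orthonormal basis.
  obtain ⟨b, hb⟩ := hort.exists_orthonormalBasis_extension_of_card_eq (by simp)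
  have hXs : ∀ i, X *ᵥ (v i) = (s i : ℂ) • (b i).ofLp := by
    intro i
    by_cases hi : s i = 0
    · have := hXv i i
      rw [if_pos rfl, hi] at this
      simp only [Complex.ofReal_zero, ne_eq, OfNat.ofNat_ne_zero, not_false_eq_true, zero_pow,
        inner_self_eq_zero] at this
      rw [hi]
      have h0 := congrArg WithLp.ofLp this
      simpa using h0
    · rw [hb i hi]
      have hi' : (s i : ℂ) ≠ 0 := by exact_mod_cast hi
      simp [hu, smul_smul, hi']
  let V := hH.eigenvectorBasis.reindex τ.symm
  have hVv : ∀ i, V i = v i := fun i => by simp [V, hv]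
  let A : Matrix (Fin 3) (Fin 3) ℂ := Matrix.of fun i j => (b j).ofLp i
  let C : Matrix (Fin 3) (Fin 3) ℂ := Matrix.of fun i j => (V j).ofLp i
  have hmem : ∀ w : OrthonormalBasis (Fin 3) ℂ (EuclideanSpace ℂ (Fin 3)),
      (Matrix.of fun i j => (w j).ofLp i) ∈ Matrix.unitaryGroup (Fin 3) ℂ := by
    intro w
    have := (EuclideanSpace.basisFun (Fin 3) ℂ).toMatrix_orthonormalBasis_mem_unitary w
    exact this
  have hXC : X * C = A * diagonal fun i => ((s i : ℝ) : ℂ) := by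
    ext i j
    rw [Matrix.mul_diagonal]
    have := congrFun (hXs j) i
    rw [← hVv] at this
    simp only [mulVec, dotProduct, Pi.smul_apply, smul_eq_mul] at this
    rw [Matrix.mul_apply]
    simp only [A, C, of_apply]
    rw [this, mul_comm]
  have hCC : C * star C = 1 := Matrix.mem_unitaryGroup_iff.1 (hmem V)
  have hCC' : star C * C = 1 := Matrix.mem_unitaryGroup_iff'.1 (hmem V)
  -- The factor on the right is a transpose, not an adjoint, since `ξ` is a tensor in `ℂ³ ⊗ ℂ³`;
  -- hence the second unitary is the entrywise conjugate of `C`.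
  refine ⟨A, hmem b, (star C)ᵀ, ?_, s, ?_, fun i => Real.sqrt_nonneg _, ?_⟩
  · rw [Matrix.mem_unitaryGroup_iff]
    have : star ((star C)ᵀ) = Cᵀ := by
      ext i j; simp [Matrix.star_eq_conjTranspose]
    rw [this, ← Matrix.transpose_mul, hCC, Matrix.transpose_one]
  · intro i j hij
    apply Real.sqrt_le_sqrt
    have := hmono hij
    simp only [Function.comp] at this
    linarith
  · rw [Matrix.transpose_transpose, ← hXC, Matrix.mul_assoc, hCC, Matrix.mul_one]

/-- A local unitary `A ⊗ B` passes through the partial transpose as `A ⊗ B̄`, so the Schmidt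
decomposition reduces `ξ` to `schmidtVec s`, diagonalised by `pairBasis`. -/
lemma ptProj_eq_conj (ξ : Fin 3 × Fin 3 → ℂ) :
    ∃ U ∈ Matrix.unitaryGroup (Fin 3 × Fin 3) ℂ, ∃ s : Fin 3 → ℝ, Antitone s ∧ (∀ i, 0 ≤ s i) ∧
      ptProj ξ = U * (diagonal fun p => ((wt s p : ℝ) : ℂ)) * Uᴴ := by
  obtain ⟨A, hA, B, hB, s, hs, hs0, hX⟩ := exists_svd (Matrix.of fun i j => ξ (i, j))
  have hB' : B.map star ∈ Matrix.unitaryGroup (Fin 3) ℂ := by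
    rw [Matrix.mem_unitaryGroup_iff']
    have h := Matrix.mem_unitaryGroup_iff'.1 hB
    have h2 := congrArg (fun M : Matrix (Fin 3) (Fin 3) ℂ => M.map star) h
    ext i j
    have h3 := congrFun (congrFun h2 i) j
    simp only [Matrix.map_apply, Matrix.mul_apply, star_sum, star_mul', Matrix.star_apply,
      star_star] at h3 ⊢
    rw [h3]
    by_cases hij : i = j
    · subst hij; simp
    · simp [Matrix.one_apply_ne hij]
  have hU := Matrix.kronecker_mem_unitary hA hB'
  refine ⟨Matrix.kronecker A (B.map star) * pairBasis, mul_mem hU pairBasis_mem, s, hs, hs0, ?_⟩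
  rw [conjTranspose_mul]
  have h := conj_ptProj_schmidtVec s
  calc ptProj ξ = Matrix.kronecker A (B.map star) * ptProj (schmidtVec s) *
        (Matrix.kronecker A (B.map star))ᴴ := by
        have hξ : ∀ i j, ξ (i, j) = ∑ m, A i m * (s m : ℂ) * B j m := by
          intro i j
          have := congrFun (congrFun hX i) j
          simp only [of_apply] at this
          rw [this, Matrix.mul_apply]
          simp [Matrix.mul_diagonal]
        ext ⟨i, j⟩ ⟨k, l⟩
        simp only [ptProj, partialTranspose, of_apply, vecMulVec_apply, Pi.star_apply, hξ,
          Matrix.mul_apply, Fintype.sum_prod_type, schmidtVec, conjTranspose_apply,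
          Matrix.kronecker, Matrix.kroneckerMap_apply, Matrix.map_apply, Fin.sum_univ_three]
        simp
        ring
    _ = _ := by rw [h]; simp only [Matrix.mul_assoc]

/-! ### Absolute PPT as a family of linear inequalities on diagonals -/

lemma IsState.conj {ρ : BipartiteMatrix 3 3} (h : IsState ρ) {U : BipartiteMatrix 3 3}
    (hU : U ∈ Matrix.unitaryGroup (Fin 3 × Fin 3) ℂ) : IsState (U * ρ * Uᴴ) := by
  refine ⟨h.1.mul_mul_conjTranspose_same U, ?_⟩
  rw [Matrix.mul_assoc, Matrix.trace_mul_comm, Matrix.mul_assoc]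
  have : Uᴴ * U = 1 := Matrix.mem_unitaryGroup_iff'.1 hU
  rw [this, Matrix.mul_one, h.2]

lemma isHermitian_partialTranspose {M : BipartiteMatrix 3 3} (h : M.IsHermitian) :
    (partialTranspose M).IsHermitian := by
  ext p q
  simp only [conjTranspose_apply, partialTranspose, of_apply]
  exact h.apply _ _

lemma trace_mul_diagonal_of_isHermitian {M : BipartiteMatrix 3 3} (h : M.IsHermitian)
    (w : Fin 3 × Fin 3 → ℝ) :
    (M * diagonal fun p => ((w p : ℝ) : ℂ)).trace = ((∑ p, (M p p).re * w p : ℝ) : ℂ) := by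
  rw [Matrix.trace, Complex.ofReal_sum]
  refine Finset.sum_congr rfl fun p _ => ?_
  have h1 : star (M p p) = M p p := h.apply p p
  rw [Matrix.diag_apply, Matrix.mul_diagonal, Complex.ofReal_mul]
  congr 1
  exact (Complex.conj_eq_iff_re.1 h1).symm

lemma trace_conj_mul_conj (U V M D : BipartiteMatrix 3 3) :
    (U * M * Uᴴ * (V * D * Vᴴ)).trace = ((Vᴴ * U) * M * (Vᴴ * U)ᴴ * D).trace := by
  rw [conjTranspose_mul, conjTranspose_conjTranspose]
  calc (U * M * Uᴴ * (V * D * Vᴴ)).trace = ((U * M * Uᴴ * V * D) * Vᴴ).trace := by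
        simp only [Matrix.mul_assoc]
    _ = (Vᴴ * (U * M * Uᴴ * V * D)).trace := Matrix.trace_mul_comm _ _
    _ = _ := by simp only [Matrix.mul_assoc]

lemma conjTranspose_mem_unitaryGroup {n : Type*} [Fintype n] [DecidableEq n] {U : Matrix n n ℂ}
    (hU : U ∈ Matrix.unitaryGroup n ℂ) : Uᴴ ∈ Matrix.unitaryGroup n ℂ :=
  Unitary.star_mem hU

/-- Every unitary conjugate of an absolutely PPT state pairs nonnegatively with the spectra
`wt s`. -/
lemma sum_wt_nonneg_of_mem_AP {ρ : BipartiteMatrix 3 3} (h : ρ ∈ AP 3 3)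
    {U : BipartiteMatrix 3 3} (hU : U ∈ Matrix.unitaryGroup (Fin 3 × Fin 3) ℂ) (s : Fin 3 → ℝ) :
    0 ≤ ∑ p, ((U * ρ * Uᴴ) p p).re * wt s p := by
  -- The extra factor `pairBasis` cancels the unitary diagonalising the test matrix, so the plain
  -- diagonal of `U ρ U†` remains.
  have h1 := (h.2 (pairBasis * U) (mul_mem pairBasis_mem hU)).2.dotProduct_mulVec_nonneg
    (schmidtVec s)
  rw [dotProduct_partialTranspose, conj_ptProj_schmidtVec, trace_conj_mul_conj, ← Matrix.mul_assoc,
    show pairBasisᴴ * pairBasis = 1 from Matrix.mem_unitaryGroup_iff'.1 pairBasis_mem,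
    Matrix.one_mul, trace_mul_diagonal_of_isHermitian
      (h.1.1.1.mul_mul_conjTranspose_same U).isHermitian] at h1
  exact_mod_cast h1

/-- The unitary diagonalising `ptProj ξ` is absorbed into `U`; singular values can be taken ordered
and nonnegative, so only such `s` need testing. -/
lemma mem_AP_of_sum_wt_nonneg {ρ : BipartiteMatrix 3 3} (hρ : IsState ρ)
    (h : ∀ U ∈ Matrix.unitaryGroup (Fin 3 × Fin 3) ℂ, ∀ s : Fin 3 → ℝ, Antitone s →
      (∀ i, 0 ≤ s i) → 0 ≤ ∑ p, ((U * ρ * Uᴴ) p p).re * wt s p) : ρ ∈ AP 3 3 := by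
  have key : ∀ U ∈ Matrix.unitaryGroup (Fin 3 × Fin 3) ℂ, IsPPTState (U * ρ * Uᴴ) := by
    intro U hU
    refine ⟨hρ.conj hU, ?_⟩
    refine PosSemidef.of_dotProduct_mulVec_nonneg
      (isHermitian_partialTranspose (hρ.conj hU).1.isHermitian) fun ξ => ?_
    obtain ⟨V, hV, s, hs, hs0, hξ⟩ := ptProj_eq_conj ξ
    have hVU := mul_mem (conjTranspose_mem_unitaryGroup hV) hU
    rw [dotProduct_partialTranspose, hξ, trace_conj_mul_conj,
      trace_mul_diagonal_of_isHermitian (hρ.conj hVU).1.isHermitian]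
    exact_mod_cast h _ hVU s hs hs0
  refine ⟨?_, key⟩
  have := key 1 (one_mem _)
  simpa using this

/-! ### Doubly stochastic matrices and the reduction to spectra -/

lemma normSq_mem_doublyStochastic {n : Type*} [Fintype n] [DecidableEq n] {U : Matrix n n ℂ}
    (hU : U ∈ Matrix.unitaryGroup n ℂ) :
    (Matrix.of fun i j => Complex.normSq (U i j)) ∈ doublyStochastic ℝ n := by
  rw [mem_doublyStochastic_iff_sum]
  refine ⟨fun i j => Complex.normSq_nonneg _, fun i => ?_, fun j => ?_⟩
  · have := congrFun (congrFun (Matrix.mem_unitaryGroup_iff.1 hU) i) i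
    rw [Matrix.mul_apply, Matrix.one_apply_eq] at this
    simp only [Matrix.star_apply, RCLike.star_def, Complex.mul_conj] at this
    exact_mod_cast this
  · have := congrFun (congrFun (Matrix.mem_unitaryGroup_iff'.1 hU) j) j
    rw [Matrix.mul_apply, Matrix.one_apply_eq] at this
    simp only [Matrix.star_apply, RCLike.star_def, ← Complex.normSq_eq_conj_mul_self] at this
    exact_mod_cast this

/-- The diagonal of a unitary conjugate of a real diagonal matrix. -/
lemma conj_diagonal_apply_self_re {n : Type*} [Fintype n] [DecidableEq n] (U : Matrix n n ℂ)
    (x : n → ℝ) (p : n) :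
    ((U * (diagonal fun q => ((x q : ℝ) : ℂ)) * Uᴴ) p p).re =
      ((Matrix.of fun i j => Complex.normSq (U i j)) *ᵥ x) p := by
  rw [Matrix.mul_apply, Complex.re_sum, Matrix.mulVec, dotProduct]
  refine Finset.sum_congr rfl fun q _ => ?_
  rw [Matrix.mul_diagonal, conjTranspose_apply, of_apply]
  have : U p q * (x q : ℂ) * star (U p q) = ((Complex.normSq (U p q) * x q : ℝ) : ℂ) := by
    rw [Complex.ofReal_mul, ← Complex.mul_conj]
    simp only [RCLike.star_def]; ring
  rw [this, Complex.ofReal_re]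

/-- A doubly stochastic image lies in the convex hull of the rearrangements. -/
lemma mulVec_mem_convexHull_of_doublyStochastic {n : Type*} [Fintype n] [DecidableEq n]
    {M : Matrix n n ℝ} (hM : M ∈ doublyStochastic ℝ n) (x : n → ℝ) :
    M *ᵥ x ∈ convexHull ℝ (Set.range fun σ : Equiv.Perm n => x ∘ σ) := by
  have h : M ∈ (doublyStochastic ℝ n : Set (Matrix n n ℝ)) := hM
  rw [doublyStochastic_eq_convexHull_permMatrix] at h
  let f : Matrix n n ℝ →ₗ[ℝ] (n → ℝ) :=
    { toFun := fun M => M *ᵥ x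
      map_add' := fun A B => Matrix.add_mulVec A B x
      map_smul' := fun c A => Matrix.smul_mulVec c A x }
  have h1 : f M ∈ f '' convexHull ℝ {σ.permMatrix ℝ | σ : Equiv.Perm n} := ⟨M, h, rfl⟩
  rw [f.isLinear.image_convexHull] at h1
  refine convexHull_mono ?_ h1
  rintro _ ⟨_, ⟨σ, rfl⟩, rfl⟩
  exact ⟨σ, (permMatrix_mulVec σ).symm⟩

/-- Half of the quadratic form of `L₁`. -/
def q1 (x : Fin 9 → ℝ) (s : Fin 3 → ℝ) : ℝ :=
  x 8 * s 0 ^ 2 + x 6 * s 1 ^ 2 + x 3 * s 2 ^ 2 + (x 7 - x 0) * (s 0 * s 1) +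
    (x 5 - x 1) * (s 0 * s 2) + (x 4 - x 2) * (s 1 * s 2)

/-- The spectra of the two-qutrit absolutely PPT states, in arbitrary order. -/
def spectralAP : Set (Fin 9 → ℝ) :=
  {x | (∀ i, 0 ≤ x i) ∧ ∑ i, x i = 1 ∧ ∀ (σ : Equiv.Perm (Fin 9)) (s : Fin 3 → ℝ), 0 ≤ q1 (x ∘ σ) s}

/-- The order in which `wt s` enters `q1`. -/
def wtPos : Fin 9 → Fin 3 × Fin 3 :=
  ![(1, 0), (2, 0), (2, 1), (2, 2), (1, 2), (0, 2), (1, 1), (0, 1), (0, 0)]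

lemma wtPos_bijective : Function.Bijective wtPos := by
  decide

/-- The lexicographic enumeration of the product basis. -/
def lex9 : Fin 3 × Fin 3 ≃ Fin 9 := finProdFinEquiv

/-- `wtPos` followed by the lexicographic enumeration of the product basis. -/
noncomputable def wtPerm : Equiv.Perm (Fin 9) :=
  (Equiv.ofBijective wtPos wtPos_bijective).trans lex9

lemma sum_fin_nine (f : Fin 9 → ℝ) :
    ∑ i, f i = f 0 + f 1 + f 2 + f 3 + f 4 + f 5 + f 6 + f 7 + f 8 := by
  rw [Fin.sum_univ_castSucc, Fin.sum_univ_eight]; rfl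

lemma sum_mul_wt_wtPos (x : Fin 9 → ℝ) (s : Fin 3 → ℝ) :
    ∑ j, x j * wt s (wtPos j) = q1 x s := by
  have h0 : wt s (wtPos 0) = -(s 1 * s 0) := rfl
  have h1 : wt s (wtPos 1) = -(s 2 * s 0) := rfl
  have h2 : wt s (wtPos 2) = -(s 2 * s 1) := rfl
  have h3 : wt s (wtPos 3) = s 2 ^ 2 := rfl
  have h4 : wt s (wtPos 4) = s 1 * s 2 := rfl
  have h5 : wt s (wtPos 5) = s 0 * s 2 := rfl
  have h6 : wt s (wtPos 6) = s 1 ^ 2 := rfl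
  have h7 : wt s (wtPos 7) = s 0 * s 1 := rfl
  have h8 : wt s (wtPos 8) = s 0 ^ 2 := rfl
  rw [sum_fin_nine, h0, h1, h2, h3, h4, h5, h6, h7, h8, q1]
  ring

lemma sum_mul_wt (x : Fin 9 → ℝ) (s : Fin 3 → ℝ) :
    ∑ p : Fin 3 × Fin 3, x (lex9 p) * wt s p = q1 (x ∘ wtPerm) s := by
  rw [← sum_mul_wt_wtPos, ← (Equiv.ofBijective wtPos wtPos_bijective).sum_comp]
  rfl

lemma diag9_eq (x : Fin 9 → ℝ) :
    diag9 x = Matrix.diagonal fun p => (((x ∘ lex9) p : ℝ) : ℂ) := rfl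

lemma diag9_apply_self (x : Fin 9 → ℝ) (p : Fin 3 × Fin 3) :
    diag9 x p p = ((x (lex9 p) : ℝ) : ℂ) := Matrix.diagonal_apply_eq _ _

lemma permMatrix_mem_unitaryGroup {n : Type*} [Fintype n] [DecidableEq n] (σ : Equiv.Perm n) :
    σ.permMatrix ℂ ∈ Matrix.unitaryGroup n ℂ := by
  rw [Matrix.mem_unitaryGroup_iff, Matrix.star_eq_conjTranspose, conjTranspose_permMatrix,
    ← permMatrix_mul, inv_mul_cancel, permMatrix_one]

lemma permMatrix_conj_apply_self {n : Type*} [Fintype n] [DecidableEq n] (σ : Equiv.Perm n)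
    (M : Matrix n n ℂ) (p : n) :
    (σ.permMatrix ℂ * M * (σ.permMatrix ℂ)ᴴ) p p = M (σ p) (σ p) := by
  rw [conjTranspose_permMatrix, PEquiv.toMatrix_toPEquiv_mul, PEquiv.mul_toMatrix_toPEquiv]
  simp [Equiv.Perm.inv_def]

/-- The diagonals of the unitary conjugates of an absolutely PPT state. -/
lemma diag_conj_mem_spectralAP {ρ : BipartiteMatrix 3 3} (h : ρ ∈ AP 3 3)
    {U : BipartiteMatrix 3 3} (hU : U ∈ Matrix.unitaryGroup (Fin 3 × Fin 3) ℂ) :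
    (fun i => ((U * ρ * Uᴴ) (lex9.symm i) (lex9.symm i)).re) ∈
      spectralAP := by
  have hst := (h.1.1).conj hU
  refine ⟨fun i => ?_, ?_, fun σ s => ?_⟩
  · exact (Complex.le_def.1 hst.1.diag_nonneg).1
  · have h1 := congrArg Complex.re hst.2
    rw [Matrix.trace, Complex.re_sum, Complex.one_re] at h1
    rw [← h1, ← lex9.sum_comp]
    simp
  -- The inverse of `wtPerm` cancels the reordering built into `sum_mul_wt`, so the weights meet the
  -- diagonal in the order `σ`.
  · let τ : Equiv.Perm (Fin 3 × Fin 3) :=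
      (lex9.trans (wtPerm.symm.trans σ)).trans lex9.symm
    have h1 := sum_wt_nonneg_of_mem_AP h (mul_mem (permMatrix_mem_unitaryGroup τ) hU) s
    have h2 : ∀ p, (τ.permMatrix ℂ * U * ρ * (τ.permMatrix ℂ * U)ᴴ) p p =
        (U * ρ * Uᴴ) (τ p) (τ p) := by
      intro p
      have h := permMatrix_conj_apply_self τ (U * ρ * Uᴴ) p
      rw [← h, conjTranspose_mul]
      simp only [Matrix.mul_assoc]
    simp only [h2] at h1
    have h3 := sum_mul_wt ((fun i => ((U * ρ * Uᴴ) (lex9.symm i)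
      (lex9.symm i)).re) ∘ σ ∘ wtPerm.symm) s
    have h4 : ((fun i => ((U * ρ * Uᴴ) (lex9.symm i)
      (lex9.symm i)).re) ∘ σ ∘ wtPerm.symm) ∘ wtPerm = (fun i => ((U * ρ * Uᴴ) (lex9.symm i)
      (lex9.symm i)).re) ∘ σ := by
      ext i; simp
    rw [h4] at h3
    rw [← h3]
    exact h1

/-- The pairing with `wt s` is linear and the diagonal of a conjugate lies in the convex hull of the
rearrangements of `x`, so it is enough to test the rearrangements. -/
lemma diag9_mem_AP {x : Fin 9 → ℝ} (h0 : ∀ i, 0 ≤ x i) (h1 : ∑ i, x i = 1)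
    (h : ∀ (σ : Equiv.Perm (Fin 9)) (s : Fin 3 → ℝ), Antitone s → (∀ i, 0 ≤ s i) →
      0 ≤ q1 (x ∘ σ) s) : diag9 x ∈ AP 3 3 := by
  refine mem_AP_of_sum_wt_nonneg ⟨?_, ?_⟩ ?_
  · rw [diag9, posSemidef_diagonal_iff]
    exact fun p => by exact_mod_cast h0 _
  · rw [diag9_eq, Matrix.trace_diagonal, ← Complex.ofReal_sum]
    simp only [Function.comp]
    rw [lex9.sum_comp (fun i => x i), h1, Complex.ofReal_one]
  · intro U hU s hs hs0
    rw [diag9_eq]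
    simp only [conj_diagonal_apply_self_re]
    have hmem := mulVec_mem_convexHull_of_doublyStochastic (normSq_mem_doublyStochastic hU)
      (x ∘ lex9)
    have hconv : Convex ℝ {y : Fin 3 × Fin 3 → ℝ | 0 ≤ ∑ p, y p * wt s p} := by
      intro y hy z hz a b ha hb _
      simp only [mem_ofPred_eq] at hy hz ⊢
      have : ∑ p, (a • y + b • z) p * wt s p =
          a * ∑ p, y p * wt s p + b * ∑ p, z p * wt s p := by
        rw [Finset.mul_sum, Finset.mul_sum, ← Finset.sum_add_distrib]
        refine Finset.sum_congr rfl fun p _ => ?_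
        simp only [Pi.add_apply, Pi.smul_apply, smul_eq_mul]; ring
      rw [this]; positivity
    refine convexHull_min ?_ hconv hmem
    rintro _ ⟨σ, rfl⟩
    let τ : Equiv.Perm (Fin 9) := (lex9.symm.trans σ).trans lex9
    have h2 := sum_mul_wt (x ∘ τ) s
    have h3 : ∀ p, (x ∘ τ) (lex9 p) = ((x ∘ lex9) ∘ σ) p := by
      intro p; simp only [τ, Function.comp, Equiv.trans_apply, Equiv.symm_apply_apply]
    simp only [h3] at h2
    simp only [mem_ofPred_eq]
    rw [h2]
    exact h (wtPerm.trans τ) s hs hs0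

lemma diag9_mem_AP_iff {x : Fin 9 → ℝ} : diag9 x ∈ AP 3 3 ↔ x ∈ spectralAP := by
  constructor
  · intro h
    have h1 := diag_conj_mem_spectralAP h (one_mem _)
    have h2 : (fun i => ((1 * diag9 x * (1 : BipartiteMatrix 3 3)ᴴ) (lex9.symm i)
        (lex9.symm i)).re) = x := by
      ext i
      rw [conjTranspose_one, Matrix.one_mul, Matrix.mul_one, diag9_apply_self, Complex.ofReal_re]
      exact congrArg x (lex9.apply_symm_apply i)
    rwa [h2] at h1
  · intro h
    exact diag9_mem_AP h.1 h.2.1 fun σ s _ _ => h.2.2 σ s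

lemma q1_add_smul (a b : ℝ) (x y : Fin 9 → ℝ) (s : Fin 3 → ℝ) :
    q1 (a • x + b • y) s = a * q1 x s + b * q1 y s := by
  simp only [q1, Pi.add_apply, Pi.smul_apply, smul_eq_mul]; ring

lemma comp_mem_spectralAP {x : Fin 9 → ℝ} (h : x ∈ spectralAP) (σ : Equiv.Perm (Fin 9)) :
    x ∘ σ ∈ spectralAP :=
  ⟨fun i => h.1 _, by rw [← h.2.1]; exact Equiv.sum_comp σ x, fun τ s => h.2.2 (τ.trans σ) s⟩

lemma convex_spectralAP : Convex ℝ spectralAP := by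
  intro x hx y hy a b ha hb hab
  refine ⟨fun i => ?_, ?_, fun σ s => ?_⟩
  · have := hx.1 i; have := hy.1 i
    simp only [Pi.add_apply, Pi.smul_apply, smul_eq_mul]; positivity
  · simp only [Pi.add_apply, Pi.smul_apply, smul_eq_mul, Finset.sum_add_distrib, ← Finset.mul_sum,
      hx.2.1, hy.2.1]
    linarith
  · have h1 := hx.2.2 σ s
    have h2 := hy.2.2 σ s
    have h3 := q1_add_smul a b (x ∘ σ) (y ∘ σ) s
    have h4 : (a • x + b • y) ∘ σ = a • (x ∘ σ) + b • (y ∘ σ) := rfl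
    rw [h4, h3]; positivity

/-! ### Extreme diagonal states and extreme spectra -/

lemma eq_conj_diagonal_eigenvalues {n : Type*} [Fintype n] [DecidableEq n] {M : Matrix n n ℂ}
    (h : M.IsHermitian) : ∃ V ∈ Matrix.unitaryGroup n ℂ, ∃ y : n → ℝ,
      M = V * (diagonal fun i => ((y i : ℝ) : ℂ)) * Vᴴ := by
  refine ⟨h.eigenvectorUnitary, h.eigenvectorUnitary.2, h.eigenvalues, ?_⟩
  have := h.spectral_theorem
  rw [Unitary.conjStarAlgAut_apply] at this
  exact this

/-- Both sides are `tr M M†`. It is used to see that a matrix whose diagonal already accounts for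
its Frobenius norm is diagonal. -/
lemma sum_normSq_eq {n : Type*} [Fintype n] [DecidableEq n] {V : Matrix n n ℂ}
    (hV : V ∈ Matrix.unitaryGroup n ℂ) (y : n → ℝ) :
    ∑ p, ∑ q, Complex.normSq ((V * (diagonal fun i => ((y i : ℝ) : ℂ)) * Vᴴ) p q) =
      ∑ i, y i ^ 2 := by
  set D : Matrix n n ℂ := diagonal fun i => ((y i : ℝ) : ℂ)
  set M := V * D * Vᴴ with hM
  have hVV : Vᴴ * V = 1 := Matrix.mem_unitaryGroup_iff'.1 hV
  have hD : Dᴴ = D := by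
    rw [diagonal_conjTranspose]; congr 1; ext i; simp
  have h1 : (M * Mᴴ).trace = ((∑ p, ∑ q, Complex.normSq (M p q) : ℝ) : ℂ) := by
    rw [Matrix.trace, Complex.ofReal_sum]
    refine Finset.sum_congr rfl fun p _ => ?_
    rw [Matrix.diag_apply, Matrix.mul_apply, Complex.ofReal_sum]
    refine Finset.sum_congr rfl fun q _ => ?_
    rw [conjTranspose_apply, RCLike.star_def, Complex.mul_conj]
  have h2 : (M * Mᴴ).trace = ((∑ i, y i ^ 2 : ℝ) : ℂ) := by
    have : M * Mᴴ = V * (D * D * Vᴴ) := by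
      rw [hM, conjTranspose_mul, conjTranspose_mul, conjTranspose_conjTranspose, hD]
      calc V * D * Vᴴ * (V * (D * Vᴴ)) = V * D * (Vᴴ * V) * (D * Vᴴ) := by
            simp only [Matrix.mul_assoc]
        _ = _ := by rw [hVV, Matrix.mul_one]; simp only [Matrix.mul_assoc]
    rw [this, Matrix.trace_mul_comm, Matrix.mul_assoc, hVV, Matrix.mul_one, diagonal_mul_diagonal,
      Matrix.trace_diagonal, Complex.ofReal_sum]
    refine Finset.sum_congr rfl fun i _ => ?_
    rw [← Complex.ofReal_mul, sq]
  exact_mod_cast h1.symm.trans h2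

/-- A diagonal state is an extreme point as soon as its spectrum is an extreme point. -/
theorem diag9_mem_extremeAP_iff {x : Fin 9 → ℝ} :
    diag9 x ∈ extremeAP ↔ x ∈ spectralAP.extremePoints ℝ := by
  constructor
  · intro h
    rw [extremeAP, mem_extremePoints_iff_left] at h
    rw [mem_extremePoints_iff_left]
    refine ⟨diag9_mem_AP_iff.1 h.1, fun y hy z hz hyz => ?_⟩
    have h1 : diag9 x ∈ openSegment ℝ (diag9 y) (diag9 z) := by
      obtain ⟨a, b, ha, hb, hab, rfl⟩ := hyz
      refine ⟨a, b, ha, hb, hab, ?_⟩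
      ext p q
      by_cases hpq : p = q
      · subst hpq; simp [diag9]
      · simp [diag9, hpq]
    have h2 := h.2 _ (diag9_mem_AP_iff.2 hy) _ (diag9_mem_AP_iff.2 hz) h1
    ext i
    have h3 := congrFun (congrFun h2 (lex9.symm i)) (lex9.symm i)
    simp only [diag9_apply_self, Complex.ofReal_inj] at h3
    rwa [lex9.apply_symm_apply i] at h3
  · intro h
    -- Extremality in the form "removing `x` leaves a convex set", suited to convex hulls of
    -- rearrangements.
    have hT := convex_spectralAP.mem_extremePoints_iff_convex_sdiff.1 h
    rw [mem_extremePoints_iff_left] at h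
    rw [extremeAP, mem_extremePoints_iff_left]
    refine ⟨diag9_mem_AP_iff.2 h.1, fun ρ hρ η hη hseg => ?_⟩
    have hd : ∀ ρ ∈ AP 3 3, (fun i => (ρ (lex9.symm i) (lex9.symm i)).re) ∈
        spectralAP := by
      intro ρ hρ
      have := diag_conj_mem_spectralAP hρ (one_mem _)
      simpa only [conjTranspose_one, Matrix.one_mul, Matrix.mul_one] using this
    have hdiag : (fun i => (ρ (lex9.symm i) (lex9.symm i)).re) = x := by
      refine h.2 _ (hd ρ hρ) _ (hd η hη) ?_
      obtain ⟨a, b, ha, hb, hab, hx⟩ := hseg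
      refine ⟨a, b, ha, hb, hab, ?_⟩
      ext i
      have h3 := congrArg Complex.re
        (congrFun (congrFun hx (lex9.symm i)) (lex9.symm i))
      simp only [diag9_apply_self, Complex.ofReal_re, Matrix.add_apply,
        Matrix.smul_apply, Complex.add_re, Complex.smul_re] at h3
      rw [lex9.apply_symm_apply i] at h3
      simpa using h3
    have hH : ρ.IsHermitian := hρ.1.1.1.isHermitian
    obtain ⟨V, hV, y, hy⟩ := eq_conj_diagonal_eigenvalues hH
    have hVV : Vᴴ * V = 1 := Matrix.mem_unitaryGroup_iff'.1 hV
    have hyT : y ∘ lex9.symm ∈ spectralAP := by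
      have h1 := diag_conj_mem_spectralAP hρ (conjTranspose_mem_unitaryGroup hV)
      have h2 : Vᴴ * ρ * Vᴴᴴ = diagonal fun i => ((y i : ℝ) : ℂ) := by
        rw [hy, conjTranspose_conjTranspose]
        calc Vᴴ * (V * (diagonal fun i => ((y i : ℝ) : ℂ)) * Vᴴ) * V
            = (Vᴴ * V) * (diagonal fun i => ((y i : ℝ) : ℂ)) * (Vᴴ * V) := by
              simp only [Matrix.mul_assoc]
          _ = _ := by rw [hVV, Matrix.one_mul, Matrix.mul_one]
      rw [h2] at h1
      simp only [Matrix.diagonal_apply_eq, Complex.ofReal_re] at h1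
      exact h1
    have hxp : ∀ p, (ρ p p).re = x (lex9 p) := by
      intro p
      rw [← hdiag]
      exact congrArg (fun p => (ρ p p).re) (lex9.symm_apply_apply p).symm
    have hhull : x ∘ lex9 ∈
        convexHull ℝ (Set.range fun σ : Equiv.Perm (Fin 3 × Fin 3) => y ∘ σ) := by
      have := mulVec_mem_convexHull_of_doublyStochastic (normSq_mem_doublyStochastic hV) y
      convert this using 1
      ext p
      rw [← conj_diagonal_apply_self_re, ← hy, hxp]; rfl
    -- Otherwise no rearrangement of the eigenvalues `y` of `ρ` equals `x`, so their hull stays in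
    -- the convex set `spectralAP \ {x}`; but by Schur the diagonal `x` of `ρ` lies in that hull.
    have hsq : ∑ p, y p ^ 2 = ∑ i, x i ^ 2 := by
      by_contra hne
      have hsub : (Set.range fun σ : Equiv.Perm (Fin 3 × Fin 3) => y ∘ σ) ⊆
          (fun z : Fin 3 × Fin 3 → ℝ => z ∘ lex9.symm) ⁻¹' (spectralAP \ {x}) := by
        rintro _ ⟨σ, rfl⟩
        have h2 := comp_mem_spectralAP hyT
          ((lex9.symm.trans σ).trans lex9)
        have h3 : (y ∘ lex9.symm) ∘
            ((lex9.symm.trans σ).trans lex9) =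
            (y ∘ σ) ∘ lex9.symm := by
          ext i; simp
        rw [h3] at h2
        refine ⟨h2, fun h4 => hne ?_⟩
        have h6 : (y ∘ σ) ∘ lex9.symm = x := h4
        rw [← h6, ← lex9.sum_comp, ← Equiv.sum_comp σ (fun p => y p ^ 2)]
        simp
      have hcv : Convex ℝ
          ((fun z : Fin 3 × Fin 3 → ℝ => z ∘ lex9.symm) ⁻¹' (spectralAP \ {x})) :=
        hT.2.is_linear_preimage
          (f := fun z : Fin 3 × Fin 3 → ℝ => (z ∘ lex9.symm : Fin 9 → ℝ))
          ⟨fun _ _ => rfl, fun _ _ => rfl⟩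
      have h5 := convexHull_min hsub hcv hhull
      apply h5.2
      ext i
      exact congrArg x (lex9.apply_symm_apply i)
    -- The squared norm of `ρ` is now that of its diagonal, row by row, so nothing is left off the
    -- diagonal.
    have hsum := sum_normSq_eq hV y
    rw [← hy, hsq, ← lex9.sum_comp (fun i => x i ^ 2)] at hsum
    have hre : ∀ p, ρ p p = ((x (lex9 p) : ℝ) : ℂ) := by
      intro p
      rw [← hxp]
      exact (Complex.conj_eq_iff_re.1 (hH.apply p p)).symm
    have hle : ∀ p ∈ Finset.univ, x (lex9 p) ^ 2 ≤ ∑ q, Complex.normSq (ρ p q) := by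
      intro p _
      have h6 := Finset.single_le_sum (f := fun q => Complex.normSq (ρ p q))
        (fun q _ => Complex.normSq_nonneg _) (Finset.mem_univ p)
      rw [show Complex.normSq (ρ p p) = x (lex9 p) ^ 2 by
        rw [hre, Complex.normSq_ofReal, sq]] at h6
      exact h6
    have heq := (Finset.sum_eq_sum_iff_of_le hle).1 hsum.symm
    ext p q
    by_cases hpq : p = q
    · subst hpq
      rw [hre, diag9_apply_self]
    · rw [diag9, Matrix.diagonal_apply_ne _ hpq]
      have h7 := heq p (Finset.mem_univ p)
      rw [← Finset.add_sum_erase _ _ (Finset.mem_univ p)] at h7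
      rw [show Complex.normSq (ρ p p) = x (lex9 p) ^ 2 by
        rw [hre, Complex.normSq_ofReal, sq]] at h7
      have h8 : ∑ q ∈ Finset.univ.erase p, Complex.normSq (ρ p q) = 0 := by linarith
      rw [Finset.sum_eq_zero_iff_of_nonneg fun q _ => Complex.normSq_nonneg _] at h8
      exact Complex.normSq_eq_zero.1 (h8 q (Finset.mem_erase.2 ⟨Ne.symm hpq, Finset.mem_univ q⟩))

/-! ### The two quadratic forms for ordered spectra -/

/-- Half of the quadratic form of `L₂`. -/
def q2 (x : Fin 9 → ℝ) (s : Fin 3 → ℝ) : ℝ :=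
  x 8 * s 0 ^ 2 + x 5 * s 1 ^ 2 + x 3 * s 2 ^ 2 + (x 7 - x 0) * (s 0 * s 1) +
    (x 6 - x 1) * (s 0 * s 2) + (x 4 - x 2) * (s 1 * s 2)

/-- Both `L₁` and `L₂` are positive semidefinite. -/
def PSD (x : Fin 9 → ℝ) : Prop := ∀ s, 0 ≤ q1 x s ∧ 0 ≤ q2 x s

/-- Both `L₁` and `L₂` are positive definite. -/
def PD (x : Fin 9 → ℝ) : Prop := ∀ s ≠ 0, 0 < q1 x s ∧ 0 < q2 x s

/-- Both `L₁` and `L₂` are positive semidefinite and one of them is singular. -/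
def Sing (x : Fin 9 → ℝ) : Prop := PSD x ∧ (l1 x = 0 ∨ l2 x = 0)

lemma dotProduct_L1 (x : Fin 9 → ℝ) (s : Fin 3 → ℝ) : s ⬝ᵥ (L1 x *ᵥ s) = 2 * q1 x s := by
  simp [L1, q1, dotProduct, mulVec, Fin.sum_univ_three]
  ring

lemma L1_isHermitian (x : Fin 9 → ℝ) : (L1 x).IsHermitian := by
  ext i j
  fin_cases i <;> fin_cases j <;> simp [L1]

lemma L1_posSemidef_iff (x : Fin 9 → ℝ) : (L1 x).PosSemidef ↔ ∀ s, 0 ≤ q1 x s := by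
  rw [posSemidef_iff_dotProduct_mulVec]
  refine ⟨fun h s => ?_, fun h => ⟨L1_isHermitian x, fun s => ?_⟩⟩
  · have := h.2 s
    rw [star_trivial, dotProduct_L1] at this
    linarith
  · rw [star_trivial, dotProduct_L1]
    linarith [h s]

/-- `L₂` is definitionally `L₁` of the vector with entries 5 and 6 exchanged; facts about `L₂` are
obtained from `L₁` in this way. -/
lemma L2_posSemidef_iff (x : Fin 9 → ℝ) : (L2 x).PosSemidef ↔ ∀ s, 0 ≤ q2 x s :=
  L1_posSemidef_iff (x ∘ Equiv.swap 5 6)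

lemma L1_mulVec_eq_zero {x : Fin 9 → ℝ} (h : ∀ s, 0 ≤ q1 x s) {s : Fin 3 → ℝ}
    (hs : q1 x s = 0) : L1 x *ᵥ s = 0 := by
  rw [← ((L1_posSemidef_iff x).2 h).dotProduct_mulVec_zero_iff, star_trivial, dotProduct_L1, hs,
    mul_zero]

lemma L1_mulVec_eq_zero_iff (x : Fin 9 → ℝ) (s : Fin 3 → ℝ) : L1 x *ᵥ s = 0 ↔
    2 * x 8 * s 0 + (x 7 - x 0) * s 1 + (x 5 - x 1) * s 2 = 0 ∧
    (x 7 - x 0) * s 0 + 2 * x 6 * s 1 + (x 4 - x 2) * s 2 = 0 ∧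
    (x 5 - x 1) * s 0 + (x 4 - x 2) * s 1 + 2 * x 3 * s 2 = 0 := by
  rw [funext_iff, Fin.forall_fin_succ, Fin.forall_fin_succ, Fin.forall_fin_succ]
  simp [L1, mulVec, dotProduct, Fin.sum_univ_three]

lemma l1_eq_zero_iff {x : Fin 9 → ℝ} (h : ∀ s, 0 ≤ q1 x s) :
    l1 x = 0 ↔ ∃ s ≠ 0, q1 x s = 0 := by
  rw [l1, ← exists_mulVec_eq_zero_iff]
  refine ⟨fun ⟨s, h0, hs⟩ => ⟨s, h0, ?_⟩, fun ⟨s, h0, hs⟩ => ⟨s, h0, L1_mulVec_eq_zero h hs⟩⟩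
  have := dotProduct_L1 x s
  rw [hs, dotProduct_zero] at this
  linarith

lemma l2_eq_zero_iff {x : Fin 9 → ℝ} (h : ∀ s, 0 ≤ q2 x s) :
    l2 x = 0 ↔ ∃ s ≠ 0, q2 x s = 0 := l1_eq_zero_iff (x := x ∘ Equiv.swap 5 6) h

lemma PD.psd {x : Fin 9 → ℝ} (h : PD x) : PSD x := by
  intro s
  by_cases hs : s = 0
  · subst hs; simp [q1, q2]
  · exact ⟨(h s hs).1.le, (h s hs).2.le⟩

lemma PSD.pd {x : Fin 9 → ℝ} (h : PSD x) (h1 : l1 x ≠ 0) (h2 : l2 x ≠ 0) : PD x := by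
  intro s hs
  refine ⟨lt_of_le_of_ne (h s).1 fun h0 => h1 ?_, lt_of_le_of_ne (h s).2 fun h0 => h2 ?_⟩
  · exact (l1_eq_zero_iff fun s => (h s).1).2 ⟨s, hs, h0.symm⟩
  · exact (l2_eq_zero_iff fun s => (h s).2).2 ⟨s, hs, h0.symm⟩

lemma Sing.not_pd {x : Fin 9 → ℝ} (h : Sing x) : ¬ PD x := by
  intro hp
  rcases h.2 with h0 | h0
  · obtain ⟨s, hs, h1⟩ := (l1_eq_zero_iff fun s => (h.1 s).1).1 h0
    exact (hp s hs).1.ne' h1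
  · obtain ⟨s, hs, h1⟩ := (l2_eq_zero_iff fun s => (h.1 s).2).1 h0
    exact (hp s hs).2.ne' h1

lemma q1_smul (x : Fin 9 → ℝ) (r : ℝ) (s : Fin 3 → ℝ) : q1 x (r • s) = r ^ 2 * q1 x s := by
  simp only [q1, Pi.smul_apply, smul_eq_mul]; ring

lemma q1_add_smul_right (t : ℝ) (x d : Fin 9 → ℝ) (s : Fin 3 → ℝ) :
    q1 (x + t • d) s = q1 x s + t * q1 d s := by
  simp only [q1, Pi.add_apply, Pi.smul_apply, smul_eq_mul]; ring

/-- On the compact unit sphere `q1 x` has a positive minimum and `q1 d` is bounded; homogeneity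
extends the estimate to all nonzero vectors. -/
lemma exists_q1_pos_of_perturb {x : Fin 9 → ℝ} (h : ∀ s ≠ 0, 0 < q1 x s) (d : Fin 9 → ℝ) :
    ∃ ε > 0, ∀ t : ℝ, |t| ≤ ε → ∀ s ≠ 0, 0 < q1 (x + t • d) s := by
  have hcont : ∀ y : Fin 9 → ℝ, Continuous (q1 y) := by
    intro y; unfold q1; fun_prop
  have hK : IsCompact (Metric.sphere (0 : Fin 3 → ℝ) 1) := isCompact_sphere _ _
  have hne : (Metric.sphere (0 : Fin 3 → ℝ) 1).Nonempty := NormedSpace.sphere_nonempty.2 zero_le_one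
  obtain ⟨s₀, hs₀, hmin⟩ := hK.exists_isMinOn hne (hcont x).continuousOn
  obtain ⟨C, hC⟩ := hK.exists_bound_of_continuousOn (hcont d).continuousOn
  have hs₀' : s₀ ≠ 0 := by
    rintro rfl
    simp at hs₀
  have hδ := h s₀ hs₀'
  refine ⟨q1 x s₀ / (2 * (|C| + 1)), by positivity, fun t ht s hs => ?_⟩
  have hn : 0 < ‖s‖ := norm_pos_iff.2 hs
  have hs1 : ‖s‖⁻¹ • s ∈ Metric.sphere (0 : Fin 3 → ℝ) 1 := by
    simp [norm_smul, hn.ne']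
  have h1 := hmin hs1
  have h2 := hC _ hs1
  simp only [mem_ofPred_eq] at h1
  rw [Real.norm_eq_abs] at h2
  have h3 : |t * q1 d (‖s‖⁻¹ • s)| ≤ q1 x s₀ / (2 * (|C| + 1)) * (|C| + 1) := by
    rw [abs_mul]
    refine mul_le_mul ht (h2.trans ?_) (abs_nonneg _) (by positivity)
    linarith [le_abs_self C]
  have h4 : q1 x s₀ / (2 * (|C| + 1)) * (|C| + 1) = q1 x s₀ / 2 := by
    have : |C| + 1 ≠ 0 := by positivity
    field_simp
  have h5 : 0 < q1 (x + t • d) (‖s‖⁻¹ • s) := by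
    rw [q1_add_smul_right]
    have := abs_le.1 (h3.trans h4.le)
    linarith [this.1]
  rw [q1_smul] at h5
  exact (mul_pos_iff_of_pos_left (by positivity)).1 h5

lemma PD.exists_perturb {x : Fin 9 → ℝ} (h : PD x) (d : Fin 9 → ℝ) :
    ∃ ε > 0, ∀ t : ℝ, |t| ≤ ε → PD (x + t • d) := by
  obtain ⟨ε₁, h₁, H₁⟩ := exists_q1_pos_of_perturb (fun s hs => (h s hs).1) d
  obtain ⟨ε₂, h₂, H₂⟩ := exists_q1_pos_of_perturb (x := x ∘ Equiv.swap 5 6)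
    (fun s hs => (h s hs).2) (d ∘ Equiv.swap 5 6)
  exact ⟨min ε₁ ε₂, lt_min h₁ h₂, fun t ht s hs =>
    ⟨H₁ t (ht.trans (min_le_left _ _)) s hs, H₂ t (ht.trans (min_le_right _ _)) s hs⟩⟩

lemma PSD.of_mem {x : Fin 9 → ℝ} (h : x ∈ spectralAP) : PSD x :=
  fun s => ⟨h.2.2 1 s, h.2.2 (Equiv.swap 5 6) s⟩

/-- For a nonincreasing spectrum the two inequalities `L₁ ≥ O`, `L₂ ≥ O` suffice. -/
lemma PSD.mem_spectralAP {x : Fin 9 → ℝ} (h : PSD x) (hx : Antitone x) (h0 : ∀ i, 0 ≤ x i)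
    (h1 : ∑ i, x i = 1) : x ∈ spectralAP := by
  refine diag9_mem_AP_iff.1 (diag9_mem_AP h0 h1 fun σ s hs hs0 => ?_)
  have a0 := hs0 0
  have a1 := hs0 1
  have a2 := hs0 2
  have b1 : s 1 ≤ s 0 := hs (by decide)
  have b2 : s 2 ≤ s 1 := hs (by decide)
  have e0 : wt s (wtPos 0) = -(s 1 * s 0) := rfl
  have e1 : wt s (wtPos 1) = -(s 2 * s 0) := rfl
  have e2 : wt s (wtPos 2) = -(s 2 * s 1) := rfl
  have e3 : wt s (wtPos 3) = s 2 ^ 2 := rfl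
  have e4 : wt s (wtPos 4) = s 1 * s 2 := rfl
  have e5 : wt s (wtPos 5) = s 0 * s 2 := rfl
  have e6 : wt s (wtPos 6) = s 1 ^ 2 := rfl
  have e7 : wt s (wtPos 7) = s 0 * s 1 := rfl
  have e8 : wt s (wtPos 8) = s 0 ^ 2 := rfl
  have f01 : -(s 1 * s 0) ≤ -(s 2 * s 0) := by nlinarith
  have f12 : -(s 2 * s 0) ≤ -(s 2 * s 1) := by nlinarith
  have f23 : -(s 2 * s 1) ≤ s 2 ^ 2 := by nlinarith
  have f34 : s 2 ^ 2 ≤ s 1 * s 2 := by nlinarith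
  have f45 : s 1 * s 2 ≤ s 0 * s 2 := by nlinarith
  have f46 : s 1 * s 2 ≤ s 1 ^ 2 := by nlinarith
  have f57 : s 0 * s 2 ≤ s 0 * s 1 := by nlinarith
  have f67 : s 1 ^ 2 ≤ s 0 * s 1 := by nlinarith
  have f78 : s 0 * s 1 ≤ s 0 ^ 2 := by nlinarith
  rw [← sum_mul_wt_wtPos]
  -- The only pair of weights whose order is undetermined. In each case the rearrangement inequality
  -- selects the worst permutation, giving `q1` or `q2`.
  rcases le_total (s 0 * s 2) (s 1 ^ 2) with h56 | h65
  · have hmono : Monotone fun j => wt s (wtPos j) := by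
      rw [Fin.monotone_iff_le_succ]
      intro i
      fin_cases i
      exacts [f01, f12, f23, f34, f45, h56, f67, f78]
    refine le_trans ?_ ((hx.antivary hmono).sum_mul_le_sum_comp_perm_mul (σ := σ))
    rw [sum_mul_wt_wtPos]
    exact (h s).1
  · have hmono : Monotone fun j => wt s (wtPos (Equiv.swap 5 6 j)) := by
      rw [Fin.monotone_iff_le_succ]
      intro i
      fin_cases i
      exacts [f01, f12, f23, f34, f46, h65, f57, f78]
    have h3 := (hx.antivary hmono).sum_mul_le_sum_comp_perm_mul (σ := (Equiv.swap 5 6).trans σ)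
    have h4 : ∑ j, x (((Equiv.swap 5 6).trans σ) j) * wt s (wtPos (Equiv.swap 5 6 j)) =
        ∑ j, (x ∘ σ) j * wt s (wtPos j) :=
      Equiv.sum_comp (Equiv.swap 5 6) (fun j => (x ∘ σ) j * wt s (wtPos j))
    have h5 : ∑ j, x j * wt s (wtPos (Equiv.swap 5 6 j)) =
        ∑ j, (x ∘ Equiv.swap 5 6) j * wt s (wtPos j) := by
      rw [← Equiv.sum_comp (Equiv.swap 5 6)]
      simp
    rw [h4, h5, sum_mul_wt_wtPos] at h3
    exact ((h s).2).trans h3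

/-! ### Extremality for three distinct eigenvalues -/

lemma nuVec_antitone (μ k : ℕ) {a b c : ℝ} (hab : b ≤ a) (hbc : c ≤ b) :
    Antitone (nuVec μ k a b c) := by
  intro i j hij
  have : (i : ℕ) ≤ j := hij
  simp only [nuVec]
  split_ifs <;> first | omega | linarith

lemma sum_nuVec {μ k : ℕ} (h : μ + k ≤ 9) (a b c : ℝ) :
    ∑ i, nuVec μ k a b c i = μ * a + k * b + (9 - μ - k) * c := by
  rw [sum_fin_nine]
  have hμ : μ ≤ 9 := by omega
  have hk : k ≤ 9 := by omega
  interval_cases μ <;> interval_cases k <;> first | omega | (simp [nuVec]; try ring)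

lemma nuVec_add_smul (μ k : ℕ) (a b c a' b' c' t : ℝ) :
    nuVec μ k a b c + t • nuVec μ k a' b' c' =
      nuVec μ k (a + t * a') (b + t * b') (c + t * c') := by
  ext i
  simp only [nuVec, Pi.add_apply, Pi.smul_apply, smul_eq_mul]
  split_ifs <;> rfl

lemma nuVec_nonneg (μ k : ℕ) {a b c : ℝ} (ha : 0 ≤ a) (hb : 0 ≤ b) (hc : 0 ≤ c) (i : Fin 9) :
    0 ≤ nuVec μ k a b c i := by
  simp only [nuVec]; split_ifs <;> assumption

/-- In the interior of the region `L₁ ≥ O`, `L₂ ≥ O` there are no extreme points. -/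
lemma sing_of_mem_extremePoints {μ k : ℕ} (hμ : 3 ≤ μ) (hk : 1 ≤ k) (hs : μ + k ≤ 8) {a b c : ℝ}
    (hab : b < a) (hbc : c < b) (hc : 0 < c)
    (h : nuVec μ k a b c ∈ spectralAP.extremePoints ℝ) : Sing (nuVec μ k a b c) := by
  rw [mem_extremePoints_iff_left] at h
  refine ⟨PSD.of_mem h.1, ?_⟩
  by_contra! hne
  have hpd := (PSD.of_mem h.1).pd hne.1 hne.2
  have hm : (0 : ℝ) < 9 - μ - k := by
    have : ((μ + k : ℕ) : ℝ) ≤ 8 := by exact_mod_cast hs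
    push_cast at this; linarith
  have hμ' : (0 : ℝ) < μ := by exact_mod_cast (by omega : 0 < μ)
  -- The direction exchanges weight between the first and last blocks: `μ·m + m·(-μ) = 0` with `m =
  -- 9 - μ - k`, so the trace is kept.
  obtain ⟨ε, hε, H⟩ := hpd.exists_perturb (nuVec μ k (9 - μ - k) 0 (-μ))
  have h9 : (μ : ℝ) + k ≤ 8 := by exact_mod_cast hs
  have hk' : (0 : ℝ) < k := by exact_mod_cast (by omega : 0 < k)
  set t := min ε (min ((a - b) / 9) (min ((b - c) / 9) (c / 9))) with ht
  have t0 : 0 < t := by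
    simp only [ht, lt_min_iff]
    exact ⟨hε, by linarith, by linarith, by linarith⟩
  have t1 : t ≤ ε := min_le_left _ _
  have t2 : t ≤ (a - b) / 9 := (min_le_right _ _).trans (min_le_left _ _)
  have t3 : t ≤ (b - c) / 9 :=
    (min_le_right _ _).trans ((min_le_right _ _).trans (min_le_left _ _))
  have t4 : t ≤ c / 9 :=
    (min_le_right _ _).trans ((min_le_right _ _).trans (min_le_right _ _))
  have hsum := h.1.2.1
  rw [sum_nuVec (by omega)] at hsum
  have key : ∀ r : ℝ, |r| ≤ t →
      nuVec μ k a b c + r • nuVec μ k (9 - μ - k) 0 (-μ) ∈ spectralAP := by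
    intro r hr
    have hp := H r (hr.trans t1)
    rw [nuVec_add_smul] at hp ⊢
    have hr' := abs_le.1 hr
    have r1 : |r * (9 - μ - k)| ≤ t * 9 := by
      rw [abs_mul, abs_of_pos hm]
      exact mul_le_mul hr (by linarith) hm.le t0.le
    have r2 : |r * (-(μ : ℝ))| ≤ t * 9 := by
      rw [abs_mul, abs_neg, abs_of_pos hμ']
      exact mul_le_mul hr (by linarith) hμ'.le t0.le
    have r1' := abs_le.1 r1
    have r2' := abs_le.1 r2
    refine hp.psd.mem_spectralAP (nuVec_antitone _ _ (by linarith) (by linarith))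
      (nuVec_nonneg _ _ (by linarith) (by linarith) (by linarith)) ?_
    rw [sum_nuVec (by omega)]
    linear_combination hsum
  have h1 := h.2 _ (key t (abs_of_pos t0).le) _ (key (-t) (by rw [abs_neg, abs_of_pos t0]))
    ⟨1 / 2, 1 / 2, by norm_num, by norm_num, by norm_num, by
      ext i; simp only [Pi.add_apply, Pi.smul_apply, smul_eq_mul]; ring⟩
  have h2 := congrFun h1 0
  have h3 : nuVec μ k (9 - μ - k) 0 (-μ) 0 = 9 - μ - k := by
    simp [nuVec, show 0 < μ by omega]
  simp only [Pi.add_apply, Pi.smul_apply, smul_eq_mul, h3] at h2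
  have : t * (9 - μ - k) > 0 := mul_pos t0 hm
  linarith

/-- The coefficient of the `j`-th eigenvalue in `L₁ s`. -/
def L1coeff (s : Fin 3 → ℝ) : Fin 9 → Fin 3 → ℝ :=
  ![![-s 1, -s 0, 0], ![-s 2, 0, -s 0], ![0, -s 2, -s 1], ![0, 0, 2 * s 2], ![0, s 2, s 1],
    ![s 2, 0, s 0], ![0, 2 * s 1, 0], ![s 1, s 0, 0], ![2 * s 0, 0, 0]]

lemma L1_mulVec_eq_sum (x : Fin 9 → ℝ) (s : Fin 3 → ℝ) :
    L1 x *ᵥ s = ∑ j, x j • L1coeff s j := by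
  ext i
  rw [Finset.sum_apply, sum_fin_nine]
  fin_cases i <;> simp [L1, L1coeff, mulVec, dotProduct, Fin.sum_univ_three] <;> ring

/-- Subtracting the two kernel equations leaves `(x q - x p)` times the difference of the two
coefficient vectors. -/
lemma eq_of_swap {x : Fin 9 → ℝ} {s : Fin 3 → ℝ} {p q : Fin 9} (h : L1 x *ᵥ s = 0)
    (h' : L1 (x ∘ Equiv.swap p q) *ᵥ s = 0) (hC : L1coeff s p ≠ L1coeff s q) : x p = x q := by
  have hpq : p ≠ q := fun h => hC (by rw [h])
  have h1 : ∑ j, (x (Equiv.swap p q j) - x j) • L1coeff s j = 0 := by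
    rw [L1_mulVec_eq_sum] at h h'
    simp only [sub_smul, Finset.sum_sub_distrib]
    rw [h, sub_zero]
    exact h'
  rw [← Finset.add_sum_erase _ _ (Finset.mem_univ p),
    ← Finset.add_sum_erase _ _ (Finset.mem_erase.2 ⟨hpq.symm, Finset.mem_univ q⟩),
    Finset.sum_eq_zero (s := (Finset.univ.erase p).erase q)] at h1
  · rw [Equiv.swap_apply_left, Equiv.swap_apply_right, add_zero] at h1
    have h2 : (x q - x p) • (L1coeff s p - L1coeff s q) = 0 := by
      rw [← h1]; module
    rcases smul_eq_zero.1 h2 with h3 | h3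
    · linarith
    · exact absurd (sub_eq_zero.1 h3) hC
  · intro j hj
    simp only [Finset.mem_erase] at hj
    rw [Equiv.swap_apply_of_ne_of_ne hj.2.1 hj.1, sub_self, zero_smul]

lemma L1coeff_injective {s : Fin 3 → ℝ} (h0 : 0 < s 0) (h1 : 0 < s 1) (h2 : 0 < s 2) {p q : Fin 9}
    (hpq : p ≠ q) : L1coeff s p ≠ L1coeff s q := by
  intro h
  have e0 := congrFun h 0
  have e1 := congrFun h 1
  have e2 := congrFun h 2
  fin_cases p <;> fin_cases q <;> first | exact hpq rfl | skip
  all_goals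
    simp [L1coeff] at e0 e1 e2
    try linarith

/-- For `s 2 = 0` the coefficient vectors need not be distinct (1 and 2 agree when `s 0 = s 1`). For
`μ ≥ 6` it suffices to separate index 0, index 8 and the pair 6, 7. -/
lemma L1coeff_zero_ne {s : Fin 3 → ℝ} (h0 : 0 < s 0) (h1 : 0 < s 1) (h2 : 0 ≤ s 2) {q : Fin 9}
    (hq : 0 ≠ q) : L1coeff s 0 ≠ L1coeff s q := by
  intro h
  have e0 := congrFun h 0
  have e1 := congrFun h 1
  have e2 := congrFun h 2
  fin_cases q <;> first | exact hq rfl | skip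
  all_goals
    simp [L1coeff] at e0 e1 e2
    try linarith

lemma L1coeff_eight_ne {s : Fin 3 → ℝ} (h0 : 0 < s 0) (h1 : 0 < s 1) (h2 : 0 ≤ s 2) {q : Fin 9}
    (hq : 8 ≠ q) : L1coeff s 8 ≠ L1coeff s q := by
  intro h
  have e0 := congrFun h 0
  have e1 := congrFun h 1
  have e2 := congrFun h 2
  fin_cases q <;> first | exact hq rfl | skip
  all_goals
    simp [L1coeff] at e0 e1 e2
    try linarith

lemma L1coeff_six_ne_seven {s : Fin 3 → ℝ} (h1 : 0 < s 1) : L1coeff s 6 ≠ L1coeff s 7 := by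
  intro h
  have e0 := congrFun h 0
  simp [L1coeff] at e0
  linarith

/-- A singular positive semidefinite `L₁` with nonpositive off-diagonal entries has a kernel
vector with nonnegative entries. -/
lemma exists_nonneg_kernel {x : Fin 9 → ℝ} (h : ∀ s, 0 ≤ q1 x s) (h1 : l1 x = 0)
    (h70 : x 7 ≤ x 0) (h51 : x 5 ≤ x 1) (h42 : x 4 ≤ x 2) :
    ∃ s ≠ 0, (∀ i, 0 ≤ s i) ∧ q1 x s = 0 := by
  obtain ⟨s, hs, hq⟩ := (l1_eq_zero_iff h).1 h1
  refine ⟨fun i => |s i|, ?_, fun i => abs_nonneg _, le_antisymm ?_ (h _)⟩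
  · intro h0
    apply hs
    ext i
    exact abs_eq_zero.1 (congrFun h0 i)
  · rw [← hq]
    simp only [q1, sq_abs, ← abs_mul]
    have a1 := mul_le_mul_of_nonpos_left (le_abs_self (s 0 * s 1)) (sub_nonpos.2 h70)
    have a2 := mul_le_mul_of_nonpos_left (le_abs_self (s 0 * s 2)) (sub_nonpos.2 h51)
    have a3 := mul_le_mul_of_nonpos_left (le_abs_self (s 1 * s 2)) (sub_nonpos.2 h42)
    linarith

/-- In each kernel equation a nonnegative diagonal term balances nonpositive off-diagonal ones. A
vanishing entry of `s` therefore forces every entry coupled to it by a strictly negative coefficient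
to vanish; `x 7 < x 0` couples `s 0` and `s 1`, and `x 5 < x 1` couples `s 2` to `s 0`. -/
lemma kernel_pos {x : Fin 9 → ℝ} {s : Fin 3 → ℝ} (hs : s ≠ 0) (h0 : ∀ i, 0 ≤ s i)
    (h : L1 x *ᵥ s = 0) (h3 : 0 < x 3) (h70 : x 7 < x 0)
    (h51 : x 5 ≤ x 1) (h42 : x 4 ≤ x 2) :
    0 < s 0 ∧ 0 < s 1 ∧ (x 5 < x 1 → 0 < s 2) := by
  rw [L1_mulVec_eq_zero_iff] at h
  obtain ⟨r0, r1, r2⟩ := h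
  have p0 := h0 0
  have p1 := h0 1
  have p2 := h0 2
  have hs0 : 0 < s 0 := by
    refine lt_of_le_of_ne p0 fun hz => hs ?_
    rw [← hz] at r0 r1 r2
    have z1 : s 1 = 0 := by nlinarith [mul_nonneg (sub_nonneg.2 h51) p2]
    rw [z1] at r2
    have z2 : s 2 = 0 := by nlinarith
    ext i; fin_cases i
    exacts [hz.symm, z1, z2]
  have hs1 : 0 < s 1 := by
    refine lt_of_le_of_ne p1 fun hz => ?_
    rw [← hz] at r1
    nlinarith [mul_pos (sub_pos.2 h70) hs0, mul_nonneg (sub_nonneg.2 h42) p2]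
  refine ⟨hs0, hs1, fun h51' => lt_of_le_of_ne p2 fun hz => ?_⟩
  rw [← hz] at r2
  nlinarith [mul_pos (sub_pos.2 h51') hs0, mul_nonneg (sub_nonneg.2 h42) p1]

/-- The three eigenvalues are determined up to a factor by the kernel of `L₁`. -/
lemma eq_zero_of_two_columns {p q : Fin 3 → ℝ} {β γ : ℝ} (h : ∀ i, p i * β + q i * γ = 0)
    (i j : Fin 3) (hij : p i * q j ≠ q i * p j) : β = 0 ∧ γ = 0 := by
  have h1 : (p i * q j - q i * p j) * β = 0 := by linear_combination q j * h i - q i * h j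
  have h2 : (p i * q j - q i * p j) * γ = 0 := by linear_combination p i * h j - p j * h i
  have h3 := sub_ne_zero.2 hij
  exact ⟨(mul_eq_zero.1 h1).resolve_left h3, (mul_eq_zero.1 h2).resolve_left h3⟩

/-- This makes the kernel equation determine the ratios `a : b : c`. Rows 0 and 2 suffice for `μ ≤
5`; for `μ ≥ 6` row 2 only involves the first block, and row 1 replaces it. -/
lemma L1_columns_independent {μ k : ℕ} (hμ : 3 ≤ μ) (hk : 1 ≤ k) (hs : μ + k ≤ 8)
    {s : Fin 3 → ℝ} (h0 : 0 < s 0) (h1 : 0 < s 1) (h2 : μ ≤ 5 → 0 < s 2) :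
    ∃ j, (L1 (nuVec μ k 0 1 0) *ᵥ s) 0 * (L1 (nuVec μ k 0 0 1) *ᵥ s) j ≠
      (L1 (nuVec μ k 0 0 1) *ᵥ s) 0 * (L1 (nuVec μ k 0 1 0) *ᵥ s) j := by
  by_cases h : μ ≤ 5
  · have h2 := h2 h
    have hk' : k ≤ 5 := by omega
    refine ⟨2, ne_of_lt ?_⟩
    interval_cases μ <;> interval_cases k <;> first
      | omega
      | (simp [L1, nuVec, mulVec, dotProduct, Fin.sum_univ_three]; positivity)
  · have hk' : k ≤ 2 := by omega
    have hμ' : μ ≤ 7 := by omega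
    have hμ6 : 6 ≤ μ := by omega
    refine ⟨1, ne_of_lt ?_⟩
    clear h2 h hμ
    interval_cases μ <;> interval_cases k <;> first
      | omega
      | (simp [L1, nuVec, mulVec, dotProduct, Fin.sum_univ_three]; positivity)

lemma L2_columns_independent {μ k : ℕ} (hμ : 3 ≤ μ) (hk : 1 ≤ k) (hs : μ + k ≤ 8)
    {s : Fin 3 → ℝ} (h0 : 0 < s 0) (h1 : 0 < s 1) (h2 : μ ≤ 6 → 0 < s 2) :
    ∃ j, (L2 (nuVec μ k 0 1 0) *ᵥ s) 0 * (L2 (nuVec μ k 0 0 1) *ᵥ s) j ≠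
      (L2 (nuVec μ k 0 0 1) *ᵥ s) 0 * (L2 (nuVec μ k 0 1 0) *ᵥ s) j := by
  by_cases h : μ ≤ 6
  · have h2 := h2 h
    -- Here `b` sits only at index 5, which enters `L₂` only in the middle diagonal entry, so row 1
    -- must be used.
    by_cases h51 : μ = 5 ∧ k = 1
    · obtain ⟨rfl, rfl⟩ := h51
      refine ⟨1, ne_of_lt ?_⟩
      simp [L2, nuVec, mulVec, dotProduct, Fin.sum_univ_three]; positivity
    · have hk' : k ≤ 5 := by omega
      refine ⟨2, ne_of_lt ?_⟩
      interval_cases μ <;> interval_cases k <;> first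
        | omega
        | (simp [L2, nuVec, mulVec, dotProduct, Fin.sum_univ_three]; positivity)
  · obtain rfl : μ = 7 := by omega
    obtain rfl : k = 1 := by omega
    refine ⟨1, ne_of_lt ?_⟩
    simp [L2, nuVec, mulVec, dotProduct, Fin.sum_univ_three]; positivity

lemma L1_nuVec_mulVec (μ k : ℕ) (a b c : ℝ) (π : Equiv.Perm (Fin 9)) (s : Fin 3 → ℝ) :
    L1 (nuVec μ k a b c ∘ π) *ᵥ s = a • (L1 (nuVec μ k 1 0 0 ∘ π) *ᵥ s) +
      b • (L1 (nuVec μ k 0 1 0 ∘ π) *ᵥ s) + c • (L1 (nuVec μ k 0 0 1 ∘ π) *ᵥ s) := by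
  simp only [L1_mulVec_eq_sum, Finset.smul_sum, ← Finset.sum_add_distrib]
  refine Finset.sum_congr rfl fun j _ => ?_
  simp only [nuVec, Function.comp]
  split_ifs <;> module

/-- Two spectra of the same shape and trace with a common kernel vector coincide. -/
lemma nuVec_eq_of_kernel {μ k : ℕ} (hs : μ + k ≤ 8) {π : Equiv.Perm (Fin 9)} {s : Fin 3 → ℝ}
    (hind : ∃ j, (L1 (nuVec μ k 0 1 0 ∘ π) *ᵥ s) 0 * (L1 (nuVec μ k 0 0 1 ∘ π) *ᵥ s) j ≠
      (L1 (nuVec μ k 0 0 1 ∘ π) *ᵥ s) 0 * (L1 (nuVec μ k 0 1 0 ∘ π) *ᵥ s) j)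
    {a b c a' b' c' : ℝ} (ha : a ≠ 0)
    (h : L1 (nuVec μ k a b c ∘ π) *ᵥ s = 0) (h' : L1 (nuVec μ k a' b' c' ∘ π) *ᵥ s = 0)
    (ht : ∑ i, nuVec μ k a b c i = 1) (ht' : ∑ i, nuVec μ k a' b' c' i = 1) :
    nuVec μ k a' b' c' = nuVec μ k a b c := by
  obtain ⟨j, hj⟩ := hind
  rw [L1_nuVec_mulVec] at h h'
  have key : ∀ i, (L1 (nuVec μ k 0 1 0 ∘ π) *ᵥ s) i * (b' * a - a' * b) +
      (L1 (nuVec μ k 0 0 1 ∘ π) *ᵥ s) i * (c' * a - a' * c) = 0 := by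
    intro i
    have e := congrFun h i
    have e' := congrFun h' i
    simp only [Pi.add_apply, Pi.smul_apply, smul_eq_mul, Pi.zero_apply] at e e'
    linear_combination a * e' - a' * e
  obtain ⟨hβ, hγ⟩ := eq_zero_of_two_columns key 0 j hj
  rw [sum_nuVec (by omega)] at ht ht'
  have haa : a' = a := by
    have : a' * (μ * a + k * b + (9 - μ - k) * c) = a * (μ * a' + k * b' + (9 - μ - k) * c') := by
      linear_combination -k * hβ - (9 - μ - k) * hγ
    rw [ht, ht'] at this
    linarith
  subst haa
  have hb : b' = b := by
    have : a' * (b' - b) = 0 := by linear_combination hβ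
    linarith [(mul_eq_zero.1 this).resolve_left ha]
  have hc : c' = c := by
    have : a' * (c' - c) = 0 := by linear_combination hγ
    linarith [(mul_eq_zero.1 this).resolve_left ha]
  rw [hb, hc]

lemma nuVec_of_lt {μ k : ℕ} {a b c : ℝ} {i : Fin 9} (h : (i : ℕ) < μ) : nuVec μ k a b c i = a :=
  if_pos h

lemma nuVec_of_mid {μ k : ℕ} {a b c : ℝ} {i : Fin 9} (h : ¬ (i : ℕ) < μ) (h' : (i : ℕ) < μ + k) :
    nuVec μ k a b c i = b := by
  rw [nuVec, if_neg h, if_pos h']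

lemma nuVec_of_ge {μ k : ℕ} {a b c : ℝ} {i : Fin 9} (h : ¬ (i : ℕ) < μ + k) :
    nuVec μ k a b c i = c := by
  rw [nuVec, if_neg (by omega), if_neg h]

/-- A vector which is constant on the blocks of `nuVec`. -/
lemma eq_nuVec {μ k : ℕ} (hμ : 3 ≤ μ) (hk : 1 ≤ k) (hs : μ + k ≤ 8) {u : Fin 9 → ℝ}
    (h : ∀ i j : Fin 9, (i = 0 ∨ (i : ℕ) = μ ∨ i = 8) → i ≠ j →
      ((i : ℕ) < μ ↔ (j : ℕ) < μ) → ((i : ℕ) < μ + k ↔ (j : ℕ) < μ + k) → u i = u j) :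
    u = nuVec μ k (u 0) (u ⟨μ, by omega⟩) (u 8) := by
  have h' : ∀ i j : Fin 9, (i = 0 ∨ (i : ℕ) = μ ∨ i = 8) →
      ((i : ℕ) < μ ↔ (j : ℕ) < μ) → ((i : ℕ) < μ + k ↔ (j : ℕ) < μ + k) → u i = u j := by
    intro i j h1 h2 h3
    by_cases hij : i = j
    · rw [hij]
    · exact h i j h1 hij h2 h3
  ext j
  by_cases h1 : (j : ℕ) < μ
  · rw [nuVec_of_lt h1]
    refine (h' 0 j (Or.inl rfl) ?_ ?_).symm <;> simp <;> omega
  · by_cases h2 : (j : ℕ) < μ + k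
    · rw [nuVec_of_mid h1 h2]
      refine (h' _ j (Or.inr (Or.inl rfl)) ?_ ?_).symm <;> simp <;> omega
    · rw [nuVec_of_ge h2]
      refine (h' 8 j (Or.inr (Or.inr rfl)) ?_ ?_).symm <;> simp <;> omega

/-- A nonnegative linear functional that vanishes inside a segment vanishes at its ends, and a null
vector of a positive semidefinite form is a kernel vector. -/
lemma q1_comp_eq_zero_of_openSegment {x u v : Fin 9 → ℝ} (hu : u ∈ spectralAP)
    (hv : v ∈ spectralAP) (h : x ∈ openSegment ℝ u v) {σ : Equiv.Perm (Fin 9)} {s : Fin 3 → ℝ}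
    (hx : q1 (x ∘ σ) s = 0) : L1 (u ∘ σ) *ᵥ s = 0 := by
  refine L1_mulVec_eq_zero (hu.2.2 σ) ?_
  obtain ⟨t, r, ht, hr, -, rfl⟩ := h
  have h1 := hu.2.2 σ s
  have h2 := hv.2.2 σ s
  have h3 : q1 ((t • u + r • v) ∘ σ) s = t * q1 (u ∘ σ) s + r * q1 (v ∘ σ) s :=
    q1_add_smul t r (u ∘ σ) (v ∘ σ) s
  rw [hx] at h3
  have h4 := mul_nonneg ht.le h1
  have h5 := mul_nonneg hr.le h2
  have h6 : t * q1 (u ∘ σ) s = 0 := by linarith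
  exact (mul_eq_zero.1 h6).resolve_left ht.ne'

lemma nuVec_comp_swap {μ k : ℕ} {a b c : ℝ} {i j : Fin 9} (h1 : (i : ℕ) < μ ↔ (j : ℕ) < μ)
    (h2 : (i : ℕ) < μ + k ↔ (j : ℕ) < μ + k) :
    nuVec μ k a b c ∘ Equiv.swap i j = nuVec μ k a b c := by
  ext l
  have hij : nuVec μ k a b c i = nuVec μ k a b c j := by
    simp only [nuVec, h1, h2]
  simp only [Function.comp, Equiv.swap_apply_def]
  split_ifs with h3 h4
  · rw [h3, hij]
  · rw [h4, hij]
  · rfl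

/-- The common part of the extremality proofs for `L₁` (`π = 1`) and `L₂` (`π = (5 6)`). -/
lemma mem_extremePoints_of_kernel {μ k : ℕ} (hμ : 3 ≤ μ) (hk : 1 ≤ k) (hs : μ + k ≤ 8)
    {a b c : ℝ} (ha : 0 < a) (hx : nuVec μ k a b c ∈ spectralAP) {π : Equiv.Perm (Fin 9)}
    {s : Fin 3 → ℝ} (hq : q1 (nuVec μ k a b c ∘ π) s = 0)
    (hind : ∃ j, (L1 (nuVec μ k 0 1 0 ∘ π) *ᵥ s) 0 * (L1 (nuVec μ k 0 0 1 ∘ π) *ᵥ s) j ≠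
      (L1 (nuVec μ k 0 0 1 ∘ π) *ᵥ s) 0 * (L1 (nuVec μ k 0 1 0 ∘ π) *ᵥ s) j)
    (hC : ∀ i j : Fin 9, (i = 0 ∨ (i : ℕ) = μ ∨ i = 8) → i ≠ j →
      ((i : ℕ) < μ ↔ (j : ℕ) < μ) → ((i : ℕ) < μ + k ↔ (j : ℕ) < μ + k) →
      L1coeff s (π.symm i) ≠ L1coeff s (π.symm j)) :
    nuVec μ k a b c ∈ spectralAP.extremePoints ℝ := by
  rw [mem_extremePoints_iff_left]
  refine ⟨hx, fun u hu v hv huv => ?_⟩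
  have hu0 : L1 (u ∘ π) *ᵥ s = 0 := q1_comp_eq_zero_of_openSegment hu hv huv hq
  have hblock := eq_nuVec (u := u) hμ hk hs (fun i j hi hij h1 h2 => by
    -- Swapping two positions of one block does not change the three-valued spectrum, so `s` is also
    -- a kernel vector for the swapped `u`.
    have h3 : L1 (u ∘ (π.trans (Equiv.swap i j))) *ᵥ s = 0 := by
      refine q1_comp_eq_zero_of_openSegment hu hv huv ?_
      have : nuVec μ k a b c ∘ (π.trans (Equiv.swap i j)) = nuVec μ k a b c ∘ π := by
        rw [Equiv.coe_trans, ← Function.comp_assoc, nuVec_comp_swap h1 h2]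
      rw [this, hq]
    have h4 : u ∘ (π.trans (Equiv.swap i j)) =
        (u ∘ π) ∘ Equiv.swap (π.symm i) (π.symm j) := by
      ext l
      simp only [Function.comp, Equiv.trans_apply, Equiv.swap_apply_def, Equiv.eq_symm_apply]
      split_ifs <;> simp
    rw [h4] at h3
    have h5 := eq_of_swap hu0 h3 (hC i j hi hij h1 h2)
    simpa using h5)
  have hsum := hu.2.1
  rw [hblock] at hu0 hsum ⊢
  exact nuVec_eq_of_kernel hs hind ha.ne' (L1_mulVec_eq_zero (hx.2.2 π) hq) hu0 hx.2.1 hsum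

lemma nuVec_mem_extremePoints_of_sing {μ k : ℕ} (hμ : 3 ≤ μ) (hk : 1 ≤ k) (hs : μ + k ≤ 8)
    {a b c : ℝ} (hab : b < a) (hbc : c < b) (hc : 0 < c) (ht : ∑ i, nuVec μ k a b c i = 1)
    (h : Sing (nuVec μ k a b c)) : nuVec μ k a b c ∈ spectralAP.extremePoints ℝ := by
  have hanti := nuVec_antitone μ k hab.le hbc.le
  have hpos : ∀ i, 0 < nuVec μ k a b c i := by
    intro i; simp only [nuVec]; split_ifs <;> linarith
  have hx := h.1.mem_spectralAP hanti (fun i => (hpos i).le) ht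
  have h70 : nuVec μ k a b c 7 < nuVec μ k a b c 0 := by
    rw [nuVec_of_lt (i := 0) (by simp; omega)]
    simp only [nuVec]
    rw [if_neg (by simp; omega)]
    split_ifs <;> linarith
  have e1 : nuVec μ k a b c 1 = a := nuVec_of_lt (by simp; omega)
  by_cases h1 : l1 (nuVec μ k a b c) = 0
  · have hnn : ∀ s, 0 ≤ q1 (nuVec μ k a b c) s := fun s => (h.1 s).1
    obtain ⟨s, hs0, hsn, hq⟩ := exists_nonneg_kernel hnn h1 h70.le (hanti (by decide))
      (hanti (by decide))
    obtain ⟨p0, p1, p2⟩ := kernel_pos hs0 hsn (L1_mulVec_eq_zero hnn hq) (hpos 3) h70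
      (hanti (by decide)) (hanti (by decide))
    have p2' : μ ≤ 5 → 0 < s 2 := fun h5 => p2 (by
      rw [e1]; simp only [nuVec]; rw [if_neg (by simp; omega)]; split_ifs <;> linarith)
    refine mem_extremePoints_of_kernel (π := 1) hμ hk hs (by linarith) hx hq
      (L1_columns_independent hμ hk hs p0 p1 p2') ?_
    intro i j hi hij h3 h4
    change L1coeff s i ≠ L1coeff s j
    by_cases hμ5 : μ ≤ 5
    · exact L1coeff_injective p0 p1 (p2' hμ5) hij
    -- Now `s 2` may vanish. A middle block with two positions occurs only for `μ = 6`, `k = 2`, at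
    -- indices 6 and 7.
    · rcases hi with rfl | hi | rfl
      · exact L1coeff_zero_ne p0 p1 (hsn 2) hij
      · have hi6 : i = 6 := Fin.ext (by simp; omega)
        have hj7 : j = 7 := Fin.ext (by
          have : (j : ℕ) ≠ i := fun h => hij (Fin.ext h.symm)
          simp; omega)
        rw [hi6, hj7]
        exact L1coeff_six_ne_seven p1
      · exact L1coeff_eight_ne p0 p1 (hsn 2) hij
  · have h2 := h.2.resolve_left h1
    -- For `μ ≥ 7` both indices 5 and 6 carry `a` and the two determinants agree; with `μ ≤ 6` one
    -- gets `x 6 < x 1`, which makes `s 2` positive for `L₂`.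
    have hμ6 : μ ≤ 6 := by
      by_contra hμ7
      refine h1 ?_
      rw [← h2, l1, l2, L1, L2]
      have : nuVec μ k a b c 5 = nuVec μ k a b c 6 := by
        rw [nuVec_of_lt (by simp; omega), nuVec_of_lt (by simp; omega)]
      rw [this]
    have hnn : ∀ s, 0 ≤ q1 (nuVec μ k a b c ∘ Equiv.swap 5 6) s := fun s => (h.1 s).2
    obtain ⟨s, hs0, hsn, hq⟩ := exists_nonneg_kernel hnn h2 h70.le (hanti (by decide))
      (hanti (by decide))
    have h61 : nuVec μ k a b c 6 < nuVec μ k a b c 1 := by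
      rw [e1]; simp only [nuVec]; rw [if_neg (by simp; omega)]; split_ifs <;> linarith
    obtain ⟨p0, p1, p2⟩ := kernel_pos hs0 hsn (L1_mulVec_eq_zero hnn hq) (hpos 3) h70
      (hanti (by decide)) (hanti (by decide))
    refine mem_extremePoints_of_kernel (π := Equiv.swap 5 6) hμ hk hs (by linarith) hx hq
      (L2_columns_independent hμ hk hs p0 p1 fun _ => p2 h61) ?_
    intro i j _ hij _ _
    exact L1coeff_injective p0 p1 (p2 h61) fun h => hij ((Equiv.swap 5 6).symm.injective h)

/-- The extreme points with three distinct eigenvalues are the boundary points of the region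
`L₁ ≥ O`, `L₂ ≥ O`. -/
theorem nu_mem_extremeAP_iff {μ k : ℕ} (hμ : 3 ≤ μ) (hk : 1 ≤ k) (hs : μ + k ≤ 8) {a b c : ℝ}
    (hab : b < a) (hbc : c < b) (hc : 0 < c) :
    nu μ k a b c ∈ extremeAP ↔ ∑ i, nuVec μ k a b c i = 1 ∧ Sing (nuVec μ k a b c) := by
  rw [nu, diag9_mem_extremeAP_iff]
  exact ⟨fun h => ⟨(extremePoints_subset h).2.1, sing_of_mem_extremePoints hμ hk hs hab hbc hc h⟩,
    fun h => nuVec_mem_extremePoints_of_sing hμ hk hs hab hbc hc h.1 h.2⟩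

/-! ### Convexity in the trace one slice and the general row theorem -/

/-- The trace one spectrum of shape `(μ, k, 9 - μ - k)` with given middle and last eigenvalues. -/
noncomputable def slice (μ k : ℕ) (b c : ℝ) : Fin 9 → ℝ :=
  nuVec μ k ((1 - k * b - (9 - μ - k) * c) / μ) b c

/-- The value of `b` for which `a = b`. -/
noncomputable def bMax (μ k : ℕ) (c : ℝ) : ℝ := (1 - (9 - μ - k) * c) / (μ + k)

lemma nuVec_lin (μ k : ℕ) (r t a b c a' b' c' : ℝ) :
    r • nuVec μ k a b c + t • nuVec μ k a' b' c' =
      nuVec μ k (r * a + t * a') (r * b + t * b') (r * c + t * c') := by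
  ext i
  simp only [nuVec, Pi.add_apply, Pi.smul_apply, smul_eq_mul]
  split_ifs <;> rfl

lemma slice_lin {μ k : ℕ} {r t b c b' c' : ℝ} (hrt : r + t = 1) :
    r • slice μ k b c + t • slice μ k b' c' = slice μ k (r * b + t * b') (r * c + t * c') := by
  rw [slice, slice, nuVec_lin, slice]
  congr 1
  have : r = 1 - t := by linarith
  subst this
  ring

lemma q1_lin (r t : ℝ) (x y : Fin 9 → ℝ) (s : Fin 3 → ℝ) :
    q1 (r • x + t • y) s = r * q1 x s + t * q1 y s := q1_add_smul r t x y s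

lemma q2_lin (r t : ℝ) (x y : Fin 9 → ℝ) (s : Fin 3 → ℝ) :
    q2 (r • x + t • y) s = r * q2 x s + t * q2 y s :=
  q1_add_smul r t (x ∘ Equiv.swap 5 6) (y ∘ Equiv.swap 5 6) s

lemma PSD.lin_pd {x y : Fin 9 → ℝ} (hx : PSD x) (hy : PD y) {r t : ℝ} (hr : 0 ≤ r) (ht : 0 < t) :
    PD (r • x + t • y) := by
  intro s hs
  rw [q1_lin, q2_lin]
  have := hx s
  have := hy s hs
  have h1 := mul_nonneg hr (hx s).1
  have h2 := mul_nonneg hr (hx s).2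
  have h3 := mul_pos ht (hy s hs).1
  have h4 := mul_pos ht (hy s hs).2
  exact ⟨by linarith, by linarith⟩

lemma PSD.lin {x y : Fin 9 → ℝ} (hx : PSD x) (hy : PSD y) {r t : ℝ} (hr : 0 ≤ r) (ht : 0 ≤ t) :
    PSD (r • x + t • y) := by
  intro s
  rw [q1_lin, q2_lin]
  have h1 := mul_nonneg hr (hx s).1
  have h2 := mul_nonneg hr (hx s).2
  have h3 := mul_nonneg ht (hy s).1
  have h4 := mul_nonneg ht (hy s).2
  exact ⟨by linarith, by linarith⟩

lemma PD.l1_pos {x : Fin 9 → ℝ} (h : PD x) : 0 < l1 x := by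
  refine lt_of_le_of_ne ((L1_posSemidef_iff x).2 fun s => (h.psd s).1).det_nonneg fun h0 => ?_
  exact Sing.not_pd ⟨h.psd, Or.inl h0.symm⟩ h

lemma slice_eq_of_sum {μ k : ℕ} (hμ : 0 < μ) (hs : μ + k ≤ 9) {a b c : ℝ}
    (h : ∑ i, nuVec μ k a b c i = 1) : a = (1 - k * b - (9 - μ - k) * c) / μ := by
  rw [sum_nuVec hs] at h
  have : (μ : ℝ) ≠ 0 := by exact_mod_cast hμ.ne'
  field_simp
  linarith

lemma sum_slice {μ k : ℕ} (hμ : 0 < μ) (hs : μ + k ≤ 9) (b c : ℝ) :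
    ∑ i, slice μ k b c i = 1 := by
  rw [slice, sum_nuVec hs]
  have : (μ : ℝ) ≠ 0 := by exact_mod_cast hμ.ne'
  field_simp
  ring

/-- The maximally mixed spectrum is the interior reference point of the convexity arguments below.
-/
lemma PD_ninth {μ k : ℕ} (hμ : 0 < μ) : PD (slice μ k (1 / 9) (1 / 9)) := by
  have hμ' : (μ : ℝ) ≠ 0 := by exact_mod_cast hμ.ne'
  have h : slice μ k (1 / 9) (1 / 9) = fun _ => 1 / 9 := by
    ext i
    simp only [slice, nuVec]
    split_ifs
    · field_simp; ring
    · rfl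
    · rfl
  rw [h]
  intro s hs
  have h2 : 0 < s 0 ^ 2 + s 1 ^ 2 + s 2 ^ 2 := by
    by_contra hcon
    apply hs
    have h0 : s 0 = 0 := by nlinarith [sq_nonneg (s 0), sq_nonneg (s 1), sq_nonneg (s 2)]
    have h1 : s 1 = 0 := by nlinarith [sq_nonneg (s 0), sq_nonneg (s 1), sq_nonneg (s 2)]
    have h2 : s 2 = 0 := by nlinarith [sq_nonneg (s 0), sq_nonneg (s 1), sq_nonneg (s 2)]
    ext i; fin_cases i <;> assumption
  simp only [q1, q2]
  constructor <;> linarith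

lemma PSD.slice_combo {μ k : ℕ} {b c b' c' b₁ c₁ t : ℝ} (h : PSD (slice μ k b c))
    (h' : PD (slice μ k b' c')) (ht : 0 < t) (ht' : t ≤ 1) (hb : b₁ = (1 - t) * b + t * b')
    (hc : c₁ = (1 - t) * c + t * c') : PD (slice μ k b₁ c₁) := by
  rw [hb, hc, ← slice_lin (by ring)]
  exact h.lin_pd h' (by linarith) ht

lemma continuous_nu (μ k : ℕ) :
    Continuous fun p : ℝ × ℝ × ℝ => nu μ k p.1 p.2.1 p.2.2 := by
  simp only [nu, diag9_eq]
  refine Continuous.matrix_diagonal (continuous_pi fun p => ?_)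
  refine Complex.continuous_ofReal.comp ?_
  simp only [Function.comp, nuVec]
  split_ifs <;> fun_prop

lemma tendsto_nu {μ k : ℕ} {A B : ℝ → ℝ} {l : Filter ℝ} {a b c : ℝ} (hA : Tendsto A l (𝓝 a))
    (hB : Tendsto B l (𝓝 b)) (hl : l ≤ 𝓝 c) :
    Tendsto (fun c => nu μ k (A c) (B c) c) l (𝓝 (nu μ k a b c)) :=
  Tendsto.comp (g := fun p : ℝ × ℝ × ℝ => nu μ k p.1 p.2.1 p.2.2) (f := fun c => (A c, B c, c))
    (y := 𝓝 (a, b, c)) ((continuous_nu μ k).tendsto (a, b, c))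
    (hA.prodMk_nhds (hB.prodMk_nhds hl))

lemma exists_interp {l c e : ℝ} (h1 : l < c) (h2 : c ≤ e) :
    ∃ t, 0 < t ∧ t ≤ 1 ∧ c = (1 - t) * l + t * e := by
  have hd : 0 < e - l := by linarith
  refine ⟨(c - l) / (e - l), div_pos (by linarith) hd, (div_le_one hd).2 (by linarith), ?_⟩
  field_simp
  ring

section Row

variable {μ k : ℕ} {lo hi : ℝ}

lemma isClosed_psd_slice (μ k : ℕ) (c : ℝ) : IsClosed {b | PSD (slice μ k b c)} := by
  have : {b | PSD (slice μ k b c)} =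
      ⋂ s, ({b | 0 ≤ q1 (slice μ k b c) s} ∩ {b | 0 ≤ q2 (slice μ k b c) s}) := by
    ext b; simp [PSD]
  rw [this]
  have hc : ∀ i, Continuous fun b => slice μ k b c i := by
    intro i
    simp only [slice, nuVec]
    split_ifs <;> fun_prop
  refine isClosed_iInter fun s => (isClosed_le continuous_const ?_).inter
    (isClosed_le continuous_const ?_)
  · simp only [q1]
    have := hc 0; have := hc 1; have := hc 2; have := hc 3; have := hc 4; have := hc 5
    have := hc 6; have := hc 7; have := hc 8
    fun_prop
  · simp only [q2]
    have := hc 0; have := hc 1; have := hc 2; have := hc 3; have := hc 4; have := hc 5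
    have := hc 6; have := hc 7; have := hc 8
    fun_prop

lemma bMax_pos_den (hμ : 3 ≤ μ) : (0 : ℝ) < μ + k := by
  have : (3 : ℝ) ≤ μ := by exact_mod_cast hμ
  positivity

/-- The point `(bMax c, c)` lies on the segment from `(bMax lo, lo)` to `(1/9, 1/9)`, away from its
first end. -/
lemma pd_slice_bMax (hμ : 3 ≤ μ) (hloP : PSD (slice μ k (bMax μ k lo) lo)) {c : ℝ} (h1 : lo < c)
    (h2 : c < 1 / 9) : PD (slice μ k (bMax μ k c) c) := by
  have hp := bMax_pos_den (k := k) hμ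
  obtain ⟨t, ht, ht1, hct⟩ := exists_interp h1 h2.le
  refine hloP.slice_combo (PD_ninth (by omega)) ht ht1 ?_ hct
  rw [hct]
  simp only [bMax]; field_simp; ring

/-- Otherwise `(hi, hi)` would lie on the segment from a region point `(c, c)` to the interior point
`(1/9, 1/9)`, and so be positive definite rather than singular. -/
lemma not_psd_slice_self (hμ : 3 ≤ μ) (hhiS : Sing (slice μ k hi hi)) (hhi : hi < 1 / 9) {c : ℝ}
    (h1 : c < hi) : ¬ PSD (slice μ k c c) := by
  intro h
  obtain ⟨t, ht, ht1, hct⟩ := exists_interp h1 hhi.le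
  exact hhiS.not_pd (h.slice_combo (PD_ninth (by omega)) ht ht1 hct hct)

/-- The right end `bMax c` of the horizontal line is positive definite, hence so is everything
strictly to the right of a region point. In particular the line has at most one singular point. -/
lemma pd_of_psd_left (hμ : 3 ≤ μ) (hloP : PSD (slice μ k (bMax μ k lo) lo)) {b c t : ℝ}
    (h : PSD (slice μ k b c)) (h1 : lo < c) (h2 : c < 1 / 9) (hbt : b < t)
    (ht : t ≤ bMax μ k c) : PD (slice μ k t c) := by
  obtain ⟨r, hr, hr1, hbr⟩ := exists_interp hbt ht
  exact h.slice_combo (pd_slice_bMax hμ hloP h1 h2) hr hr1 hbr (by ring)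

lemma lt_ninth_of_lt_bMax (hμ : 3 ≤ μ) {c : ℝ} (h : c < bMax μ k c) : c < 1 / 9 := by
  have hp := bMax_pos_den (k := k) hμ
  rw [bMax, lt_div_iff₀ hp] at h
  linarith

lemma lt_bMax_iff (hμ : 3 ≤ μ) (b c : ℝ) :
    b < (1 - k * b - (9 - μ - k) * c) / μ ↔ b < bMax μ k c := by
  have hp := bMax_pos_den (k := k) hμ
  have hμ' : (0 : ℝ) < μ := by exact_mod_cast (by omega : 0 < μ)
  rw [bMax, lt_div_iff₀ hp, lt_div_iff₀ hμ']
  constructor <;> intro h <;> linarith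

/-- For `c ≥ hi` the diagonal point `(c, c)` already lies in the region, and everything to its right
is positive definite. -/
lemma lt_hi_of_sing (hμ : 3 ≤ μ) (hloP : PSD (slice μ k (bMax μ k lo) lo))
    (hhiS : Sing (slice μ k hi hi)) (hlh : lo < hi) {b c : ℝ} (hcb : c < b) (hb : b < bMax μ k c)
    (h : Sing (slice μ k b c)) : c < hi := by
  by_contra! hc
  have h9 := lt_ninth_of_lt_bMax hμ (hcb.trans hb)
  have hpsd : PSD (slice μ k c c) := by
    rcases hc.eq_or_lt with rfl | hc
    · exact hhiS.1
    · obtain ⟨t, ht, ht1, hct⟩ := exists_interp hc h9.le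
      exact (hhiS.1.slice_combo (PD_ninth (by omega)) ht ht1 hct hct).psd
  exact h.not_pd (pd_of_psd_left hμ hloP hpsd (hlh.trans_le hc) h9 hcb hb.le)

/-- The boundary point is the infimum of the region on the line; were it positive definite, it could
be moved further left. -/
lemma exists_sing_slice (hμ : 3 ≤ μ) (hloP : PSD (slice μ k (bMax μ k lo) lo))
    (hhiS : Sing (slice μ k hi hi)) (hhi : hi < 1 / 9) {c : ℝ} (h1 : lo < c) (h2 : c < hi) :
    ∃ b, c < b ∧ b < bMax μ k c ∧ Sing (slice μ k b c) := by
  have hp := bMax_pos_den (k := k) hμ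
  have hcb : c < bMax μ k c := by
    rw [bMax, lt_div_iff₀ hp]; linarith
  have hpd := pd_slice_bMax hμ hloP h1 (h2.trans hhi)
  set S := Icc c (bMax μ k c) ∩ {b | PSD (slice μ k b c)} with hS
  have hclosed : IsClosed S := isClosed_Icc.inter (isClosed_psd_slice μ k c)
  have hne : S.Nonempty := ⟨bMax μ k c, ⟨hcb.le, le_rfl⟩, hpd.psd⟩
  have hbdd : BddBelow S := ⟨c, fun b hb => hb.1.1⟩
  have hmem := hclosed.csInf_mem hne hbdd
  set b := sInf S
  have hbc : c < b := by
    refine lt_of_le_of_ne hmem.1.1 fun h => not_psd_slice_self hμ hhiS hhi h2 ?_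
    have := hmem.2
    rw [← h] at this
    exact this
  have hsing : Sing (slice μ k b c) := by
    refine ⟨hmem.2, ?_⟩
    by_contra! hcon
    have hpd := PSD.pd hmem.2 hcon.1 hcon.2
    -- The direction of increasing `b` at fixed `c`, with `a` compensating the trace.
    obtain ⟨ε, hε, H⟩ := hpd.exists_perturb (nuVec μ k (-k / μ) 1 0)
    set r := min ε (b - c)
    have hr : 0 < r := lt_min hε (by linarith)
    have h3 := H (-r) (by rw [abs_neg, abs_of_pos hr]; exact min_le_left _ _)
    have h4 : slice μ k b c + (-r) • nuVec μ k (-k / μ) 1 0 = slice μ k (b - r) c := by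
      rw [slice, nuVec_add_smul, slice]
      congr 1 <;> ring
    rw [h4] at h3
    have h5 : b ≤ b - r := csInf_le hbdd
      ⟨⟨by linarith [min_le_right ε (b - c)], by linarith [hmem.1.2]⟩, h3.psd⟩
    linarith
  refine ⟨b, hbc, lt_of_le_of_ne hmem.1.2 fun h => ?_, hsing⟩
  rw [h] at hsing
  exact hsing.not_pd hpd

/-- The description of a whole row of the table from its two end points, a lower bound for the
region `L₁ ≥ O`, `L₂ ≥ O` and the solution of the boundary equation. -/
theorem tableRow_of {A B h : ℝ → ℝ} {ζlo ζhi : BipartiteMatrix 3 3} (hμ : 3 ≤ μ) (hk : 1 ≤ k)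
    (hs : μ + k ≤ 8) (hlo : 0 ≤ lo) (hlh : lo < hi) (hhi : hi < 1 / 9)
    (hloP : PSD (slice μ k (bMax μ k lo) lo)) (hhiS : Sing (slice μ k hi hi))
    (hlow : ∀ a b c, b < a → c < b → 0 < c → ∑ i, nuVec μ k a b c i = 1 →
      PSD (nuVec μ k a b c) → lo < c ∧ a - b ≤ h c)
    (hh : Tendsto h (𝓝[>] lo) (𝓝 0))
    (hsol : ∀ a b c, b < a → c < b → 0 < c → ∑ i, nuVec μ k a b c i = 1 →
      Sing (nuVec μ k a b c) → (∃ b₁ > b, ∀ t, b < t → t < b₁ → 0 < l1 (slice μ k t c)) →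
      a = A c ∧ b = B c)
    (hζlo : ζlo = nu μ k (bMax μ k lo) (bMax μ k lo) lo)
    (hζhi : ζhi = nu μ k ((1 - (9 - μ) * hi) / μ) hi hi) :
    TableRow μ k lo hi A B ζlo ζhi := by
  have hp := bMax_pos_den (k := k) hμ
  have hμ0 : (0 : ℝ) < μ := by exact_mod_cast (by omega : 0 < μ)
  have hk0 : (0 : ℝ) < k := by exact_mod_cast (by omega : 0 < k)
  have hforw : ∀ a b c, b < a → c < b → 0 < c → ∑ i, nuVec μ k a b c i = 1 →
      Sing (nuVec μ k a b c) → OnCurve (Ioo lo hi) A B a b c := by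
    intro a b c hab hbc hc ht hS
    have ha := slice_eq_of_sum (by omega) (by omega) ht
    have hS' := hS
    rw [ha] at hS'
    have hbm := (lt_bMax_iff hμ b c).1 (ha ▸ hab)
    have h1 := (hlow a b c hab hbc hc ht hS.1).1
    have h2 := lt_hi_of_sing hμ hloP hhiS hlh hbc hbm hS'
    exact ⟨⟨h1, h2⟩, hsol a b c hab hbc hc ht hS ⟨_, hbm, fun t ht1 ht2 =>
      (pd_of_psd_left hμ hloP hS'.1 h1 (h2.trans hhi) ht1 ht2.le).l1_pos⟩⟩
  have hex : ∀ c, lo < c → c < hi → c < B c ∧ B c < bMax μ k c ∧ B c < A c ∧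
      A c = (1 - k * B c - (9 - μ - k) * c) / μ ∧ Sing (nuVec μ k (A c) (B c) c) := by
    intro c h1 h2
    obtain ⟨b, hcb, hb, hS⟩ := exists_sing_slice hμ hloP hhiS hhi h1 h2
    have hab := (lt_bMax_iff hμ b c).2 hb
    have := hforw _ b c hab hcb (hlo.trans_lt h1) (sum_slice (by omega) (by omega) b c) hS
    rw [slice] at hS
    rw [← this.2.1, ← this.2.2]
    exact ⟨hcb, hb, hab, rfl, hS⟩
  refine ⟨fun c hc => ?_, fun a b c hab hbc hc => ?_, ?_, ?_⟩
  · have := hex c hc.1 hc.2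
    exact ⟨this.2.2.1, this.1, hlo.trans_lt hc.1⟩
  · rw [nu_mem_extremeAP_iff hμ hk hs hab hbc hc]
    constructor
    · rintro ⟨ht, hS⟩
      exact hforw a b c hab hbc hc ht hS
    · rintro ⟨hcI, rfl, rfl⟩
      obtain ⟨-, -, -, h4, h5⟩ := hex c hcI.1 hcI.2
      refine ⟨?_, h5⟩
      rw [h4]
      exact sum_slice (by omega) (by omega) _ _
  · rw [hζlo]
    have hev : ∀ᶠ c in 𝓝[>] lo, c ∈ Ioo lo hi := Ioo_mem_nhdsGT hlh
    have hbm : Tendsto (bMax μ k) (𝓝[>] lo) (𝓝 (bMax μ k lo)) := by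
      refine Tendsto.mono_left (Continuous.tendsto ?_ lo) nhdsWithin_le_nhds
      unfold bMax; fun_prop
    -- Squeeze `B` between `bMax - h` and `bMax`: the gap `bMax - B` is the fraction `μ/(μ+k)` of `A
    -- - B ≤ h`.
    have hB : Tendsto B (𝓝[>] lo) (𝓝 (bMax μ k lo)) := by
      have h0 : Tendsto (fun c => bMax μ k c - h c) (𝓝[>] lo) (𝓝 (bMax μ k lo)) := by
        simpa using hbm.sub hh
      refine tendsto_of_tendsto_of_tendsto_of_le_of_le' h0 hbm ?_ ?_
      · filter_upwards [hev] with c hc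
        obtain ⟨h1, h2, h3, h4, h5⟩ := hex c hc.1 hc.2
        have hl := (hlow _ _ c h3 h1 (hlo.trans_lt hc.1)
          (by rw [h4]; exact sum_slice (by omega) (by omega) _ _) h5.1).2
        have h6 : bMax μ k c - B c = μ / (μ + k) * (A c - B c) := by
          rw [h4, bMax]; field_simp; ring
        have h7 : (μ : ℝ) / (μ + k) ≤ 1 := (div_le_one hp).2 (by linarith)
        have h8 : (μ : ℝ) / (μ + k) * (A c - B c) ≤ 1 * (A c - B c) :=
          mul_le_mul_of_nonneg_right h7 (by linarith)
        linarith
      · filter_upwards [hev] with c hc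
        exact (hex c hc.1 hc.2).2.1.le
    refine tendsto_nu ?_ hB nhdsWithin_le_nhds
    have hA : Tendsto (fun c => (1 - k * B c - (9 - μ - k) * c) / μ) (𝓝[>] lo)
        (𝓝 ((1 - k * bMax μ k lo - (9 - μ - k) * lo) / μ)) :=
      (((tendsto_const_nhds.sub (hB.const_mul _)).sub
        ((tendsto_nhdsWithin_of_tendsto_nhds tendsto_id).const_mul _)).div_const _)
    have h9 : (1 - k * bMax μ k lo - (9 - μ - k) * lo) / μ = bMax μ k lo := by
      rw [bMax]; field_simp; ring
    rw [h9] at hA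
    refine hA.congr' ?_
    filter_upwards [hev] with c hc
    exact (hex c hc.1 hc.2).2.2.2.1.symm
  · rw [hζhi]
    have hev : ∀ᶠ c in 𝓝[<] hi, c ∈ Ioo lo hi := Ioo_mem_nhdsLT hlh
    have hd : 0 < hi - lo := by linarith
    -- Squeeze `B` between `c` and the chord from `(bMax lo, lo)` to `(hi, hi)`. The chord lies in
    -- the region, so a boundary point to its right would be positive definite.
    have hB : Tendsto B (𝓝[<] hi) (𝓝 hi) := by
      have h0 : Tendsto (fun c => (1 - (c - lo) / (hi - lo)) * bMax μ k lo +
          (c - lo) / (hi - lo) * hi) (𝓝[<] hi) (𝓝 hi) := by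
        have hc : Continuous fun c => (1 - (c - lo) / (hi - lo)) * bMax μ k lo +
          (c - lo) / (hi - lo) * hi := by fun_prop
        have := hc.tendsto hi
        rw [div_self hd.ne'] at this
        refine Tendsto.mono_left ?_ nhdsWithin_le_nhds
        simpa using this
      refine tendsto_of_tendsto_of_tendsto_of_le_of_le' (g := id)
        (tendsto_nhdsWithin_of_tendsto_nhds tendsto_id) h0 ?_ ?_
      · filter_upwards [hev] with c hc
        exact (hex c hc.1 hc.2).1.le
      · filter_upwards [hev] with c hc
        obtain ⟨h1, h2, h3, h4, h5⟩ := hex c hc.1 hc.2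
        by_contra! hcon
        rw [h4] at h5
        refine h5.not_pd (pd_of_psd_left hμ hloP ?_ hc.1 (hc.2.trans hhi) hcon h2.le)
        have hpsd := hloP.lin hhiS.1 (r := 1 - (c - lo) / (hi - lo)) (t := (c - lo) / (hi - lo))
          (sub_nonneg.2 ((div_le_one hd).2 (by linarith [hc.2])))
          (div_nonneg (by linarith [hc.1]) hd.le)
        rw [slice_lin (by ring)] at hpsd
        convert hpsd using 2
        field_simp; ring
    refine tendsto_nu ?_ hB nhdsWithin_le_nhds
    have hA : Tendsto (fun c => (1 - k * B c - (9 - μ - k) * c) / μ) (𝓝[<] hi)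
        (𝓝 ((1 - k * hi - (9 - μ - k) * hi) / μ)) :=
      (((tendsto_const_nhds.sub (hB.const_mul _)).sub
        ((tendsto_nhdsWithin_of_tendsto_nhds tendsto_id).const_mul _)).div_const _)
    have h9 : (1 - k * hi - (9 - μ - k) * hi) / μ = (1 - (9 - μ) * hi) / μ := by ring
    rw [h9] at hA
    refine hA.congr' ?_
    filter_upwards [hev] with c hc
    exact (hex c hc.1 hc.2).2.2.2.1.symm

end Row

/-! ### Identifying a root of a cubic by its position -/

lemma cubic_eval (p₃ p₂ p₁ p₀ t : ℝ) :
    (cubic p₃ p₂ p₁ p₀).eval t = p₃ * t ^ 3 + p₂ * t ^ 2 + p₁ * t + p₀ := by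
  simp [cubic]

lemma cubic_ne_zero {p₃ p₂ p₁ p₀ : ℝ} (h : p₃ ≠ 0) : cubic p₃ p₂ p₁ p₀ ≠ 0 := by
  intro h0
  have := congrArg (fun p => Polynomial.coeff p 3) h0
  simp [cubic] at this
  exact h this

/-- A root below which there are no further roots is the first root. -/
lemma realRoot_one {p : Polynomial ℝ} {b : ℝ} (hp : p ≠ 0) (hb : p.eval b = 0)
    (h : ∀ t < b, p.eval t ≠ 0) : realRoot 1 p = b := by
  have hmem : b ∈ p.roots.sort (· ≤ ·) := by
    rw [Multiset.mem_sort, Polynomial.mem_roots hp]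
    exact hb
  have hge : ∀ t ∈ p.roots.sort (· ≤ ·), b ≤ t := by
    intro t ht
    rw [Multiset.mem_sort, Polynomial.mem_roots hp] at ht
    by_contra! hlt
    exact h t hlt ht
  have hsort := p.roots.pairwise_sort (· ≤ ·)
  rw [realRoot]
  cases hl : p.roots.sort (· ≤ ·) with
  | nil => simp [hl] at hmem
  | cons x xs =>
    rw [hl] at hmem hge hsort
    simp only [Nat.sub_self, List.getD_cons_zero]
    refine le_antisymm ?_ (hge x (by simp))
    rcases List.mem_cons.1 hmem with h1 | h1
    · exact h1.ge
    · exact (List.pairwise_cons.1 hsort).1 b h1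

/-- The real roots of a cubic that is given in factored form. -/
lemma realRoot_of_factors {p₃ r₁ r₂ r₃ : ℝ} (h : p₃ ≠ 0) (h12 : r₁ ≤ r₂) (h23 : r₂ ≤ r₃)
    (j : ℕ) {p₂ p₁ p₀ : ℝ} (e₂ : p₂ = -p₃ * (r₁ + r₂ + r₃))
    (e₁ : p₁ = p₃ * (r₁ * r₂ + r₁ * r₃ + r₂ * r₃)) (e₀ : p₀ = -p₃ * (r₁ * r₂ * r₃)) :
    realRoot j (cubic p₃ p₂ p₁ p₀) = [r₁, r₂, r₃].getD (j - 1) 0 := by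
  have hfac : cubic p₃ p₂ p₁ p₀ = Polynomial.C p₃ *
      (({r₁, r₂, r₃} : Multiset ℝ).map fun a => Polynomial.X - Polynomial.C a).prod := by
    subst e₂ e₁ e₀
    simp [cubic]
    ring
  have hroots : (cubic p₃ p₂ p₁ p₀).roots = {r₁, r₂, r₃} := by
    rw [hfac, Polynomial.roots_C_mul _ h, Polynomial.roots_multiset_prod_X_sub_C]
  have hsort : (cubic p₃ p₂ p₁ p₀).roots.sort (· ≤ ·) = [r₁, r₂, r₃] := by
    rw [hroots]
    refine List.Perm.eq_of_pairwise' (Multiset.pairwise_sort _ _) ?_ ?_ (r := (· ≤ ·))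
    · simp [h12, h23, h12.trans h23]
    · rw [← Multiset.coe_eq_coe, Multiset.sort_eq]; rfl
  rw [realRoot, hsort]

/-- In the Taylor expansion at `b`, a nonnegative first and nonpositive second derivative make the
cubic negative everywhere to the left. -/
lemma realRoot_one_cubic {p₃ p₂ p₁ p₀ b : ℝ} (h3 : 0 < p₃)
    (hb : p₃ * b ^ 3 + p₂ * b ^ 2 + p₁ * b + p₀ = 0) (h1 : 0 ≤ 3 * p₃ * b ^ 2 + 2 * p₂ * b + p₁)
    (h2 : 3 * p₃ * b + p₂ ≤ 0) : realRoot 1 (cubic p₃ p₂ p₁ p₀) = b := by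
  refine realRoot_one (cubic_ne_zero h3.ne') (by rw [cubic_eval, hb]) fun t ht => ?_
  rw [cubic_eval]
  have hu : 0 < b - t := by linarith
  have e : p₃ * t ^ 3 + p₂ * t ^ 2 + p₁ * t + p₀ =
      (p₃ * b ^ 3 + p₂ * b ^ 2 + p₁ * b + p₀) - (3 * p₃ * b ^ 2 + 2 * p₂ * b + p₁) * (b - t) +
      (3 * p₃ * b + p₂) * (b - t) ^ 2 - p₃ * (b - t) ^ 3 := by ring
  rw [e, hb]
  have a1 := mul_nonneg h1 hu.le
  have a2 := mul_nonneg (neg_nonneg.2 h2) (sq_nonneg (b - t))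
  have a3 : 0 < p₃ * (b - t) ^ 3 := by positivity
  linarith

/-- The three roots of a cubic in terms of one of them. -/
lemma exists_factors {p₃ p₂ p₁ p₀ b : ℝ} (h3 : 0 < p₃)
    (hb : p₃ * b ^ 3 + p₂ * b ^ 2 + p₁ * b + p₀ = 0)
    (hd : 0 ≤ (p₃ * b + p₂) ^ 2 - 4 * p₃ * (p₃ * b ^ 2 + p₂ * b + p₁)) :
    ∃ r₁ r₂ : ℝ, r₁ ≤ r₂ ∧ p₃ * (b + r₁ + r₂) = -p₂ ∧ p₃ * (b * r₁ + b * r₂ + r₁ * r₂) = p₁ ∧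
      p₃ * (b * r₁ * r₂) = -p₀ ∧
      p₃ * ((b - r₁) * (b - r₂)) = 3 * p₃ * b ^ 2 + 2 * p₂ * b + p₁ := by
  set D := (p₃ * b + p₂) ^ 2 - 4 * p₃ * (p₃ * b ^ 2 + p₂ * b + p₁) with hD
  have hs := Real.sq_sqrt hd
  have hs0 := Real.sqrt_nonneg D
  set r := √D
  have hprod : p₃ * ((-(p₃ * b + p₂) - r) / (2 * p₃) * ((-(p₃ * b + p₂) + r) / (2 * p₃))) =
      p₃ * b ^ 2 + p₂ * b + p₁ := by
    field_simp
    linear_combination -hs + hD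
  have hsum : p₃ * ((-(p₃ * b + p₂) - r) / (2 * p₃) + (-(p₃ * b + p₂) + r) / (2 * p₃)) =
      -(p₃ * b + p₂) := by
    field_simp; ring
  refine ⟨(-(p₃ * b + p₂) - r) / (2 * p₃), (-(p₃ * b + p₂) + r) / (2 * p₃), ?_, ?_, ?_, ?_, ?_⟩
  · gcongr; linarith
  · linear_combination hsum
  · linear_combination hprod + b * hsum
  · linear_combination b * hprod + hb
  · linear_combination hprod - b * hsum

/-- The derivative at `b` is `p₃ (b - r₁)(b - r₂)`, so if it is nonpositive then `b` lies between
the other two roots. -/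
lemma realRoot_two_cubic {p₃ p₂ p₁ p₀ b : ℝ} (h3 : 0 < p₃)
    (hb : p₃ * b ^ 3 + p₂ * b ^ 2 + p₁ * b + p₀ = 0)
    (h1 : 3 * p₃ * b ^ 2 + 2 * p₂ * b + p₁ ≤ 0) : realRoot 2 (cubic p₃ p₂ p₁ p₀) = b := by
  -- The discriminant of the quadratic cofactor equals `(3p₃b + p₂)²` minus `4p₃` times the
  -- derivative at `b`.
  obtain ⟨r₁, r₂, h12, e2, e1, e0, e⟩ := exists_factors h3 hb (by
    nlinarith [sq_nonneg (3 * p₃ * b + p₂), mul_nonneg h3.le (neg_nonneg.2 h1)])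
  rw [← e] at h1
  have h4 : (b - r₁) * (b - r₂) ≤ 0 := by
    by_contra! hcon
    linarith [mul_pos h3 hcon]
  have hr1 : r₁ ≤ b := by
    by_contra! hcon
    nlinarith
  have hr2 : b ≤ r₂ := by
    by_contra! hcon
    nlinarith
  rw [realRoot_of_factors h3.ne' hr1 hr2 2 (by linarith) (by linarith) (by linarith)]
  rfl

lemma realRoot_three_cubic {p₃ p₂ p₁ p₀ b : ℝ} (h3 : 0 < p₃)
    (hb : p₃ * b ^ 3 + p₂ * b ^ 2 + p₁ * b + p₀ = 0)
    (hd : 0 ≤ (p₃ * b + p₂) ^ 2 - 4 * p₃ * (p₃ * b ^ 2 + p₂ * b + p₁))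
    (h1 : 0 ≤ 3 * p₃ * b ^ 2 + 2 * p₂ * b + p₁) (h2 : 0 < 3 * p₃ * b + p₂) :
    realRoot 3 (cubic p₃ p₂ p₁ p₀) = b := by
  obtain ⟨r₁, r₂, h12, e2, e1, e0, e⟩ := exists_factors h3 hb hd
  rw [← e] at h1
  have h4 : 0 ≤ (b - r₁) * (b - r₂) := by
    by_contra! hcon
    linarith [mul_neg_of_pos_of_neg h3 hcon]
  have h5 : 0 < p₃ * ((b - r₁) + (b - r₂)) := by linarith
  have h6 : 0 < (b - r₁) + (b - r₂) := (mul_pos_iff_of_pos_left h3).1 h5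
  have hr2 : r₂ ≤ b := by
    by_contra! hcon
    nlinarith
  rw [realRoot_of_factors h3.ne' h12 hr2 3 (by linarith) (by linarith) (by linarith)]
  rfl

/-- A cubic that vanishes at `b` and is positive to the right of `b` has nonnegative derivative
there. -/
lemma deriv_nonneg_of_pos_right {κ p₃ p₂ p₁ p₀ b b₁ : ℝ} (hb₁ : b < b₁)
    (hb : κ * (p₃ * b ^ 3 + p₂ * b ^ 2 + p₁ * b + p₀) = 0)
    (h : ∀ t, b < t → t < b₁ → 0 < κ * (p₃ * t ^ 3 + p₂ * t ^ 2 + p₁ * t + p₀)) :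
    0 ≤ κ * (3 * p₃ * b ^ 2 + 2 * p₂ * b + p₁) := by
  set g : ℝ → ℝ := fun t => κ * (p₃ * (t ^ 2 + t * b + b ^ 2) + p₂ * (t + b) + p₁) with hg
  have hc : Continuous g := by fun_prop
  have h1 : Tendsto g (𝓝[>] b) (𝓝 (g b)) := (hc.tendsto b).mono_left nhdsWithin_le_nhds
  have h2 : g b = κ * (3 * p₃ * b ^ 2 + 2 * p₂ * b + p₁) := by simp only [hg]; ring
  rw [← h2]
  refine ge_of_tendsto h1 ?_
  filter_upwards [Ioo_mem_nhdsGT hb₁] with t ht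
  have h3 := h t ht.1 ht.2
  have h4 : κ * (p₃ * t ^ 3 + p₂ * t ^ 2 + p₁ * t + p₀) = (t - b) * g t := by
    simp only [hg]; linear_combination hb
  rw [h4] at h3
  exact ((mul_pos_iff_of_pos_left (by linarith [ht.1])).1 h3).le

/-! ### Two-valued boundary spectra: the end points `ζ₃, …, ζ₈` -/

/-- A form with nonpositive off-diagonal entries and a positive kernel vector is positive
semidefinite. -/
lemma q1_nonneg_of_kernel {x : Fin 9 → ℝ} {s : Fin 3 → ℝ} (hs : ∀ i, 0 < s i)
    (h : L1 x *ᵥ s = 0) (h70 : x 7 ≤ x 0) (h51 : x 5 ≤ x 1) (h42 : x 4 ≤ x 2) (z : Fin 3 → ℝ) :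
    0 ≤ q1 x z := by
  rw [L1_mulVec_eq_zero_iff] at h
  obtain ⟨r0, r1, r2⟩ := h
  have p0 := hs 0
  have p1 := hs 1
  have p2 := hs 2
  -- Writing `z i = s i * w i` with `s` in the kernel turns the form into a weighted graph Laplacian
  -- in `w`; denominators are cleared.
  have key : 2 * (s 0 * s 1 * s 2) * q1 x z =
      (x 0 - x 7) * s 2 * (s 1 * z 0 - s 0 * z 1) ^ 2 +
      (x 1 - x 5) * s 1 * (s 2 * z 0 - s 0 * z 2) ^ 2 +
      (x 2 - x 4) * s 0 * (s 2 * z 1 - s 1 * z 2) ^ 2 := by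
    simp only [q1]
    linear_combination s 1 * s 2 * z 0 ^ 2 * r0 + s 0 * s 2 * z 1 ^ 2 * r1 +
      s 0 * s 1 * z 2 ^ 2 * r2
  have h1 := mul_nonneg (mul_nonneg (sub_nonneg.2 h70) p2.le) (sq_nonneg (s 1 * z 0 - s 0 * z 1))
  have h2 := mul_nonneg (mul_nonneg (sub_nonneg.2 h51) p1.le) (sq_nonneg (s 2 * z 0 - s 0 * z 2))
  have h3 := mul_nonneg (mul_nonneg (sub_nonneg.2 h42) p0.le) (sq_nonneg (s 2 * z 1 - s 1 * z 2))
  have h4 : 0 ≤ 2 * (s 0 * s 1 * s 2) * q1 x z := by rw [key]; linarith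
  exact nonneg_of_mul_nonneg_right h4 (by positivity)

/-- A linear inequality `α a + β b + γ c ≥ 0` with equality at the two-valued spectrum
`a = b`, `c = lo` bounds `c` and `a - b`. -/
lemma bounds_of_functional {μ k : ℕ} (hμ : 3 ≤ μ) (hs : μ + k ≤ 8) {α β γ lo a b c : ℝ}
    (hab : b < a) (ht : ∑ i, nuVec μ k a b c i = 1) (h : 0 ≤ α * a + β * b + γ * c)
    (h1 : α * k < β * μ) (h2 : (α + β) * (9 - μ - k) < γ * (μ + k))
    (h3 : (α + β) * (1 - (9 - μ - k) * lo) + γ * lo * (μ + k) = 0) :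
    lo < c ∧ a - b ≤ (γ * (μ + k) - (α + β) * (9 - μ - k)) / (β * μ - α * k) * (c - lo) := by
  rw [sum_nuVec (by omega)] at ht
  have hp := bMax_pos_den (k := k) hμ
  have h4 : (a - b) * (β * μ - α * k) ≤
      (γ * (μ + k) - (α + β) * (9 - μ - k)) * (c - lo) := by
    have h5 : 0 ≤ (μ + k) * (α * a + β * b + γ * c) := by positivity
    have e : (μ + k) * (α * a + β * b + γ * c) =
      (γ * (μ + k) - (α + β) * (9 - μ - k)) * (c - lo) - (a - b) * (β * μ - α * k) := by
      linear_combination (α + β) * ht + h3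
    linarith
  have h5 : 0 < (a - b) * (β * μ - α * k) := mul_pos (by linarith) (by linarith)
  have h6 : 0 < γ * (μ + k) - (α + β) * (9 - μ - k) := by linarith
  refine ⟨?_, ?_⟩
  · have := (mul_pos_iff_of_pos_left h6).1 (h5.trans_le h4)
    linarith
  · rw [div_mul_eq_mul_div, le_div_iff₀ (by linarith)]
    exact h4

lemma tendsto_mul_sub_nhdsGT (K lo : ℝ) : Tendsto (fun c => K * (c - lo)) (𝓝[>] lo) (𝓝 0) := by
  have : Continuous fun c => K * (c - lo) := by fun_prop
  have h := this.tendsto lo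
  simp only [sub_self, mul_zero] at h
  exact h.mono_left nhdsWithin_le_nhds

/-- The trace one spectrum with two values, the larger one of multiplicity `p`. -/
noncomputable def twoLevel (p : ℕ) (c : ℝ) : Fin 9 → ℝ := nuVec p 0 ((1 - (9 - p) * c) / p) 0 c

lemma nuVec_left_eq (μ k : ℕ) (a c : ℝ) : nuVec μ k a a c = nuVec (μ + k) 0 a 0 c := by
  ext i
  simp only [nuVec]
  split_ifs <;> first | rfl | omega

lemma nuVec_right_eq (μ k : ℕ) (a c : ℝ) : nuVec μ k a c c = nuVec μ 0 a 0 c := by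
  ext i
  simp only [nuVec]
  split_ifs <;> first | rfl | omega

lemma slice_self (μ k : ℕ) (c : ℝ) : slice μ k c c = twoLevel μ c := by
  rw [slice, nuVec_right_eq, twoLevel]
  congr 2; ring

lemma slice_bMax {μ k : ℕ} (hμ : 0 < μ) (c : ℝ) :
    slice μ k (bMax μ k c) c = twoLevel (μ + k) c := by
  have h : (0 : ℝ) < μ := by exact_mod_cast hμ
  have h' : (0 : ℝ) < μ + k := by positivity
  rw [slice, twoLevel, ← nuVec_left_eq]
  have e : (1 - (9 - ((μ + k : ℕ) : ℝ)) * c) / ((μ + k : ℕ) : ℝ) = bMax μ k c := by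
    rw [bMax]; push_cast; ring
  rw [e]
  congr 1
  rw [bMax]; field_simp; ring

lemma nu_bMax (μ k : ℕ) (c : ℝ) :
    nu μ k (bMax μ k c) (bMax μ k c) c = diag9 (twoLevel (μ + k) c) := by
  rw [nu, nuVec_left_eq, twoLevel]
  congr 2
  rw [bMax]; push_cast; ring

lemma nu_self (μ k : ℕ) (c : ℝ) :
    nu μ k ((1 - (9 - μ) * c) / μ) c c = diag9 (twoLevel μ c) := by
  rw [nu, nuVec_right_eq, twoLevel]

lemma q2_eq_q1 {x : Fin 9 → ℝ} (h : x 5 = x 6) (s : Fin 3 → ℝ) : q2 x s = q1 x s := by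
  simp only [q1, q2, h]

lemma l2_eq_l1 {x : Fin 9 → ℝ} (h : x 5 = x 6) : l2 x = l1 x := by
  simp only [l1, l2, L1, L2, h]

/-- A region point with a known positive kernel vector. -/
lemma sing_of_kernel {x : Fin 9 → ℝ} (h56 : x 5 = x 6) {s : Fin 3 → ℝ} (hs : ∀ i, 0 < s i)
    (h : L1 x *ᵥ s = 0) (h70 : x 7 ≤ x 0) (h51 : x 5 ≤ x 1) (h42 : x 4 ≤ x 2) : Sing x := by
  have h1 := q1_nonneg_of_kernel hs h h70 h51 h42
  refine ⟨fun z => ⟨h1 z, by rw [q2_eq_q1 h56]; exact h1 z⟩, Or.inl ?_⟩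
  refine (l1_eq_zero_iff h1).2 ⟨s, fun h0 => (hs 0).ne' (congrFun h0 0), ?_⟩
  have := dotProduct_L1 x s
  rw [h, dotProduct_zero] at this
  linarith

lemma sing_twoLevel_three : Sing (twoLevel 3 (1 / 12)) := by
  refine sing_of_kernel (s := ![1, 1, 1]) ?_ ?_ ?_ ?_ ?_ ?_
  · simp [twoLevel, nuVec]
  · intro i; fin_cases i <;> simp
  · rw [L1_mulVec_eq_zero_iff]
    simp [twoLevel, nuVec]; norm_num
  all_goals simp [twoLevel, nuVec]; norm_num

lemma sqrt17_sq : (√17 : ℝ) ^ 2 = 17 := Real.sq_sqrt (by norm_num)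
lemma sqrt2_sq : (√2 : ℝ) ^ 2 = 2 := Real.sq_sqrt (by norm_num)

lemma sqrt17_bounds : 4.12 < √(17 : ℝ) ∧ √(17 : ℝ) < 4.13 :=
  ⟨Real.lt_sqrt_of_sq_lt (by norm_num), (Real.sqrt_lt' (by norm_num)).2 (by norm_num)⟩

lemma sqrt2_bounds : 1.414 < √(2 : ℝ) ∧ √(2 : ℝ) < 1.415 :=
  ⟨Real.lt_sqrt_of_sq_lt (by norm_num), (Real.sqrt_lt' (by norm_num)).2 (by norm_num)⟩

lemma sing_twoLevel_four : Sing (twoLevel 4 c₄) := by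
  have hw := sqrt17_sq
  obtain ⟨w1, w2⟩ := sqrt17_bounds
  -- `L₁` is symmetric in the first two coordinates here, so two entries agree; the third comes from
  -- the first row.
  refine sing_of_kernel (s := ![2, 2, √17 - 3]) ?_ ?_ ?_ ?_ ?_ ?_
  · simp [twoLevel, nuVec]
  · intro i; fin_cases i <;> simp; linarith
  · rw [L1_mulVec_eq_zero_iff]
    simp [twoLevel, nuVec, c₄]
    refine ⟨?_, ?_, ?_⟩ <;> linarith
  all_goals simp [twoLevel, nuVec, c₄]; linarith

lemma y₀_spec : 481 * y₀ ^ 3 + -37 * y₀ ^ 2 + -17 * y₀ + 1 = 0 ∧ 0.056991 < y₀ ∧ y₀ < 0.056992 := by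
  obtain ⟨y, hy, h0⟩ : (0 : ℝ) ∈ (fun y : ℝ => 481 * y ^ 3 + -37 * y ^ 2 + -17 * y + 1) ''
      Ioo 0.056991 0.056992 := by
    refine intermediate_value_Ioo' (by norm_num) (by fun_prop) ?_
    constructor <;> norm_num
  -- The derivative is negative on the whole interval, which identifies the second root.
  have : y₀ = y := realRoot_two_cubic (by norm_num) h0 (by nlinarith [hy.1, hy.2])
  rw [this]
  exact ⟨h0, hy⟩

lemma sing_twoLevel_five : Sing (twoLevel 5 y₀) := by
  obtain ⟨h0, h1, h2⟩ := y₀_spec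
  generalize y₀ = y at h0 h1 h2
  -- With `a = (1 - 4y)/5`, the vector `(2ya, a(a-y), y(a-y))` solves rows 1 and 2 identically; row
  -- 0 is the cubic of `y₀`.
  refine sing_of_kernel (s := ![2 * y * ((1 - 4 * y) / 5),
    (1 - 4 * y) / 5 * ((1 - 4 * y) / 5 - y), y * ((1 - 4 * y) / 5 - y)]) ?_ ?_ ?_ ?_ ?_ ?_
  · simp [twoLevel, nuVec]
  · have a1 : 0 < y := by linarith
    have a2 : 0 < (1 - 4 * y) / 5 := by linarith
    have a3 : 0 < (1 - 4 * y) / 5 - y := by linarith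
    intro i; fin_cases i
    exacts [mul_pos (mul_pos two_pos a1) a2, mul_pos a2 a3, mul_pos a1 a3]
  · rw [L1_mulVec_eq_zero_iff]
    simp [twoLevel, nuVec]
    refine ⟨?_, ?_, ?_⟩
    · linear_combination (-1 / 125) * h0
    · ring
    · ring
  · simp [twoLevel, nuVec]; linarith
  · simp [twoLevel, nuVec]; linarith
  · simp [twoLevel, nuVec]

lemma sing_twoLevel_six : Sing (twoLevel 6 (1 / 21)) := by
  refine ⟨fun s => ⟨?_, ?_⟩, Or.inl ?_⟩
  · simp [twoLevel, nuVec, q1]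
    nlinarith [sq_nonneg (s 0 - s 1), sq_nonneg (s 2)]
  · simp [twoLevel, nuVec, q2]
    nlinarith [sq_nonneg (s 0 - 2 * s 1), sq_nonneg (s 0 - 2 * s 2), sq_nonneg (s 1),
      sq_nonneg (s 2)]
  · simp [twoLevel, nuVec, l1, L1, det_fin_three]; norm_num

lemma sing_twoLevel_seven : Sing (twoLevel 7 c₇) := by
  have hw := sqrt2_sq
  obtain ⟨w1, w2⟩ := sqrt2_bounds
  have h1 : ∀ s, 0 ≤ q1 (twoLevel 7 c₇) s := by
    intro s
    -- The ratio `3 + 2√2 = (1 + √2)²` makes the upper 2×2 block a perfect square.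
    have e : q1 (twoLevel 7 c₇) s =
        c₇ * (s 0 - (1 + √2) * s 1) ^ 2 + (1 - 2 * c₇) / 7 * s 2 ^ 2 := by
      simp [twoLevel, nuVec, q1, c₇]
      linear_combination (-(23 - 14 * √2) / 137 * s 1 ^ 2 + 28 / 137 * (s 1 ^ 2 - s 0 * s 1)) * hw
    have : 0 < c₇ := by rw [c₇]; linarith
    have : 0 < (1 - 2 * c₇) / 7 := by rw [c₇]; linarith
    rw [e]; positivity
  have h56 : twoLevel 7 c₇ 5 = twoLevel 7 c₇ 6 := by simp [twoLevel, nuVec]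
  refine ⟨fun s => ⟨h1 s, by rw [q2_eq_q1 h56]; exact h1 s⟩, Or.inl ?_⟩
  refine (l1_eq_zero_iff h1).2 ⟨![1 + √2, 1, 0], fun h => by simpa using congrFun h 1, ?_⟩
  simp [twoLevel, nuVec, q1, c₇]
  ring_nf
  nlinarith

lemma psd_twoLevel_eight : PSD (twoLevel 8 0) := by
  intro s
  constructor <;> simp [twoLevel, nuVec, q1, q2] <;> positivity

lemma ζ₃_eq : ζ₃ = diag9 (twoLevel 3 (1 / 12)) := by
  rw [ζ₃]; congr 1; ext i
  fin_cases i <;> simp [twoLevel, nuVec] <;> norm_num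

lemma ζ₄_eq : ζ₄ = diag9 (twoLevel 4 c₄) := by
  have hw := sqrt17_sq
  have w0 := Real.sqrt_nonneg 17
  rw [ζ₄]; congr 1; ext i
  have h : (10 + √17 : ℝ) ≠ 0 := by positivity
  fin_cases i <;> simp [twoLevel, nuVec, c₄] <;> field_simp <;> nlinarith

/-- The trace condition `y (5x + 4) = 1` transforms one defining cubic into the other; the estimate
`2.5 < x` then singles out the largest root. -/
lemma x₀_eq : x₀ = (1 / y₀ - 4) / 5 := by
  obtain ⟨h0, h1, h2⟩ := y₀_spec
  have hy : 0 < y₀ := by linarith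
  set x := (1 / y₀ - 4) / 5 with hx
  have hyx : y₀ * (5 * x + 4) = 1 := by rw [hx]; field_simp; ring
  have b1 : 2.5 < x := by nlinarith
  have b2 : x < 2.9 := by nlinarith
  have hroot : 1 * x ^ 3 + -1 * x ^ 2 + -5 * x + 1 = 0 := by
    rw [hx]; field_simp; linear_combination h0
  exact realRoot_three_cubic one_pos hroot (by nlinarith) (by nlinarith) (by linarith)

lemma ζ₅_eq : ζ₅ = diag9 (twoLevel 5 y₀) := by
  have hy : 0 < y₀ := by linarith [y₀_spec.2.1]
  have h : 1 / (5 * x₀ + 4) = y₀ := by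
    rw [x₀_eq]; field_simp; ring
  have h' : y₀ * x₀ = (1 - 4 * y₀) / 5 := by
    rw [x₀_eq]; field_simp
  rw [ζ₅, h]; congr 1; ext i
  fin_cases i <;> simp [twoLevel, nuVec] <;> linarith

lemma ζ₆_eq : ζ₆ = diag9 (twoLevel 6 (1 / 21)) := by
  rw [ζ₆]; congr 1; ext i
  fin_cases i <;> simp [twoLevel, nuVec] <;> norm_num

lemma ζ₇_eq : ζ₇ = diag9 (twoLevel 7 c₇) := by
  have hw := sqrt2_sq
  rw [ζ₇]; congr 1; ext i
  have h : (23 + 14 * √2 : ℝ) ≠ 0 := by positivity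
  fin_cases i <;> simp [twoLevel, nuVec, c₇] <;> field_simp <;> nlinarith

lemma ζ₈_eq : ζ₈ = diag9 (twoLevel 8 0) := by
  rw [ζ₈]; congr 1; ext i
  fin_cases i <;> simp [twoLevel, nuVec]

/-! ### From an end point to a table row -/

lemma q1_nuVec (μ k : ℕ) (a b c : ℝ) (s : Fin 3 → ℝ) : q1 (nuVec μ k a b c) s =
    q1 (nuVec μ k 1 0 0) s * a + q1 (nuVec μ k 0 1 0) s * b + q1 (nuVec μ k 0 0 1) s * c := by
  have h : nuVec μ k a b c = a • nuVec μ k 1 0 0 + (1 : ℝ) • (b • nuVec μ k 0 1 0 +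
      c • nuVec μ k 0 0 1) := by
    ext i
    simp only [nuVec, Pi.add_apply, Pi.smul_apply, smul_eq_mul]
    split_ifs <;> ring
  rw [h, q1_lin, q1_lin]; ring

/-- A row of the table whose lower end point is a singular two-valued spectrum with kernel
vector `s`. -/
theorem tableRow_of_kernel {μ k : ℕ} {lo hi : ℝ} {A B : ℝ → ℝ} (hμ : 3 ≤ μ) (hk : 1 ≤ k)
    (hs : μ + k ≤ 8) (hlo : 0 ≤ lo) (hlh : lo < hi) (hhi : hi < 1 / 9)
    (hloS : Sing (twoLevel (μ + k) lo)) (hhiS : Sing (twoLevel μ hi)) (s : Fin 3 → ℝ)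
    (h0 : q1 (twoLevel (μ + k) lo) s = 0)
    (h1 : q1 (nuVec μ k 1 0 0) s * k < q1 (nuVec μ k 0 1 0) s * μ)
    (h2 : (q1 (nuVec μ k 1 0 0) s + q1 (nuVec μ k 0 1 0) s) * (9 - μ - k) <
      q1 (nuVec μ k 0 0 1) s * (μ + k))
    (hsol : ∀ a b c, b < a → c < b → 0 < c → ∑ i, nuVec μ k a b c i = 1 →
      Sing (nuVec μ k a b c) → (∃ b₁ > b, ∀ t, b < t → t < b₁ → 0 < l1 (slice μ k t c)) →
      a = A c ∧ b = B c) :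
    TableRow μ k lo hi A B (diag9 (twoLevel (μ + k) lo)) (diag9 (twoLevel μ hi)) := by
  have hp := bMax_pos_den (k := k) hμ
  rw [← slice_bMax (by omega)] at h0
  have h3 : (q1 (nuVec μ k 1 0 0) s + q1 (nuVec μ k 0 1 0) s) * (1 - (9 - μ - k) * lo) +
      q1 (nuVec μ k 0 0 1) s * lo * (μ + k) = 0 := by
    have e : (1 - k * bMax μ k lo - (9 - μ - k) * lo) / μ = bMax μ k lo := by
      have : (0 : ℝ) < μ := by exact_mod_cast (by omega : 0 < μ)
      rw [bMax]; field_simp; ring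
    rw [slice, e, q1_nuVec] at h0
    have e' : bMax μ k lo * (μ + k) = 1 - (9 - μ - k) * lo := by rw [bMax]; field_simp
    linear_combination (μ + k) * h0 -
      (q1 (nuVec μ k 1 0 0) s + q1 (nuVec μ k 0 1 0) s) * e'
  refine tableRow_of hμ hk hs hlo hlh hhi (by rw [slice_bMax (by omega)]; exact hloS.1)
    (by rw [slice_self]; exact hhiS) ?_ (tendsto_mul_sub_nhdsGT
      ((q1 (nuVec μ k 0 0 1) s * (μ + k) - (q1 (nuVec μ k 1 0 0) s +
    q1 (nuVec μ k 0 1 0) s) * (9 - μ - k)) / (q1 (nuVec μ k 0 1 0) s * μ -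
    q1 (nuVec μ k 1 0 0) s * k)) lo) hsol (nu_bMax μ k lo).symm
    (nu_self μ k hi).symm
  intro a b c hab _ _ ht hP
  -- The supporting functional at the lower end point is `x ↦ q1 x s`: nonnegative on the region and
  -- zero at that point.
  refine bounds_of_functional hμ hs hab ht ?_ h1 h2 h3
  rw [← q1_nuVec]
  exact (hP s).1

/-- A row of the table with simple smallest eigenvalue. -/
theorem tableRow_of_zero {μ k : ℕ} {hi : ℝ} {A B : ℝ → ℝ} (hμ : 3 ≤ μ) (hk : 1 ≤ k)
    (hs : μ + k = 8) (hlh : 0 < hi) (hhi : hi < 1 / 9) (hhiS : Sing (twoLevel μ hi))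
    (hsol : ∀ a b c, b < a → c < b → 0 < c → ∑ i, nuVec μ k a b c i = 1 →
      Sing (nuVec μ k a b c) → (∃ b₁ > b, ∀ t, b < t → t < b₁ → 0 < l1 (slice μ k t c)) →
      a = A c ∧ b = B c) :
    TableRow μ k 0 hi A B ζ₈ (diag9 (twoLevel μ hi)) := by
  -- Instead of a linear functional, the estimate `a - b ≤ 2√c` is used at `c = 0`.
  have hh : Tendsto (fun c : ℝ => 2 * √c) (𝓝[>] 0) (𝓝 0) := by
    have : Continuous fun c : ℝ => 2 * √c := by fun_prop
    have h := this.tendsto 0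
    simp only [Real.sqrt_zero, mul_zero] at h
    exact h.mono_left nhdsWithin_le_nhds
  refine tableRow_of hμ hk hs.le le_rfl hlh hhi
    (by rw [slice_bMax (by omega), hs]; exact psd_twoLevel_eight)
    (by rw [slice_self]; exact hhiS) ?_ hh hsol (by rw [nu_bMax, hs, ζ₈_eq])
    (nu_self μ k hi).symm
  intro a b c hab hbc hc ht hP
  refine ⟨hc, ?_⟩
  have hr : 0 < √c := Real.sqrt_pos.2 hc
  have hrc : √c ^ 2 = c := Real.sq_sqrt hc.le
  have hle1 : a ≤ 1 := by
    have h1 : nuVec μ k a b c 0 ≤ ∑ i, nuVec μ k a b c i :=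
      Finset.single_le_sum (f := nuVec μ k a b c)
        (fun i _ => nuVec_nonneg μ k (by linarith) (by linarith) hc.le i) (Finset.mem_univ 0)
    rw [ht, nuVec_of_lt (by simp; omega)] at h1
    exact h1
  have h6 : nuVec μ k a b c 6 ≤ 1 := by
    simp only [nuVec]; split_ifs <;> linarith
  -- This test vector gives `c + x₇ c ≥ (a - b) √c` in the 1-based notation, and `x₇ ≤ 1`.
  have h1 := (hP ![1, √c, 0]).1
  have e8 : nuVec μ k a b c 8 = c := nuVec_of_ge (by simp; omega)
  have e7 : nuVec μ k a b c 7 = b := nuVec_of_mid (by simp; omega) (by simp; omega)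
  have e0 : nuVec μ k a b c 0 = a := nuVec_of_lt (by simp; omega)
  simp [q1, e8, e7, e0] at h1
  rw [hrc] at h1
  have h2 : 0 ≤ √c * (2 * √c - (a - b)) := by nlinarith
  linarith [nonneg_of_mul_nonneg_right h2 hr]

lemma Sing.l1_eq_zero {x : Fin 9 → ℝ} (h : Sing x) (h56 : x 5 = x 6) : l1 x = 0 := by
  rcases h.2 with h1 | h1
  · exact h1
  · rwa [← l2_eq_l1 h56]

/-- Positivity of the determinant to the right gives a nonnegative derivative; the last hypothesis,
that `b` is not beyond the inflection point, excludes the third root. -/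
lemma realRoot_one_of_slice {μ k : ℕ} {κ p₃ p₂ p₁ p₀ b c : ℝ} (hκ : 0 < κ) (h3 : 0 < p₃)
    (hdet : ∀ t, l1 (slice μ k t c) = κ * (p₃ * t ^ 3 + p₂ * t ^ 2 + p₁ * t + p₀))
    (h0 : l1 (slice μ k b c) = 0)
    (hpos : ∃ b₁ > b, ∀ t, b < t → t < b₁ → 0 < l1 (slice μ k t c))
    (h2 : 3 * p₃ * b + p₂ ≤ 0) : b = realRoot 1 (cubic p₃ p₂ p₁ p₀) := by
  obtain ⟨b₁, hb₁, hpos⟩ := hpos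
  simp only [hdet] at h0 hpos
  have h1 := deriv_nonneg_of_pos_right hb₁ h0 hpos
  exact (realRoot_one_cubic h3 ((mul_eq_zero.1 h0).resolve_left hκ.ne')
    (nonneg_of_mul_nonneg_right h1 hκ) h2).symm

/-- A negative factor `κ` reverses the sign of the derivative, and this alone identifies the middle
root. -/
lemma realRoot_two_of_slice {μ k : ℕ} {κ p₃ p₂ p₁ p₀ b c : ℝ} (hκ : κ < 0) (h3 : 0 < p₃)
    (hdet : ∀ t, l1 (slice μ k t c) = κ * (p₃ * t ^ 3 + p₂ * t ^ 2 + p₁ * t + p₀))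
    (h0 : l1 (slice μ k b c) = 0)
    (hpos : ∃ b₁ > b, ∀ t, b < t → t < b₁ → 0 < l1 (slice μ k t c)) :
    b = realRoot 2 (cubic p₃ p₂ p₁ p₀) := by
  obtain ⟨b₁, hb₁, hpos⟩ := hpos
  simp only [hdet] at h0 hpos
  have h1 := deriv_nonneg_of_pos_right hb₁ h0 hpos
  exact (realRoot_two_cubic h3 ((mul_eq_zero.1 h0).resolve_left hκ.ne)
    (by by_contra! hcon; linarith [mul_neg_of_neg_of_pos hκ hcon])).symm

/-- In a row with `L₁ = L₂`, or in which `l₂ > 0`, the second branch does not occur. -/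
theorem onlyFirstBranch_of {μ k : ℕ} {lo hi : ℝ} {A B : ℝ → ℝ} {ζlo ζhi : BipartiteMatrix 3 3}
    (hμ : 3 ≤ μ) (hk : 1 ≤ k) (hs : μ + k ≤ 8) (h : TableRow μ k lo hi A B ζlo ζhi)
    (h2 : ∀ a b c, b < a → c < b → 0 < c → (∀ s, 0 ≤ q1 (nuVec μ k a b c) s) →
      0 < l2 (nuVec μ k a b c))
    (h1 : ∀ a b c, b < a → c < b → 0 < c → l1 (nuVec μ k a b c) = 0 →
      ∀ s, 0 ≤ q1 (nuVec μ k a b c) s) : OnlyFirstBranch μ k lo hi A B := by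
  intro a b c hab hbc hc ht
  rw [← h.2.1 a b c hab hbc hc, nu_mem_extremeAP_iff hμ hk hs hab hbc hc]
  refine ⟨⟨fun hf => ⟨ht, fun s => ⟨h1 a b c hab hbc hc hf.1 s,
    (L2_posSemidef_iff _).1 hf.2 s⟩, Or.inl hf.1⟩, fun hS => ⟨?_, ?_⟩⟩, fun hsec => ?_⟩
  · exact hS.2.2.resolve_right (h2 a b c hab hbc hc fun s => (hS.2.1 s).1).ne'
  · exact (L2_posSemidef_iff _).2 fun s => (hS.2.1 s).2
  · exact (h2 a b c hab hbc hc ((L1_posSemidef_iff _).1 hsec.2)).ne' hsec.1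

lemma kernel_twoLevel_four : q1 (twoLevel 4 c₄) ![2, 2, √17 - 3] = 0 := by
  have hw := sqrt17_sq
  simp [twoLevel, nuVec, q1, c₄]
  linear_combination (83 / 332 + (√17 - 9) * 5 / 332 - 71 / 332) * hw

lemma kernel_twoLevel_five : q1 (twoLevel 5 y₀) ![2 * y₀ * ((1 - 4 * y₀) / 5),
    (1 - 4 * y₀) / 5 * ((1 - 4 * y₀) / 5 - y₀), y₀ * ((1 - 4 * y₀) / 5 - y₀)] = 0 := by
  have h0 := y₀_spec.1
  simp [twoLevel, nuVec, q1]
  linear_combination (-1 / 125) * (y₀ * ((1 - 4 * y₀) / 5)) * h0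

/-- Only the signs and the order of the kernel entries matter for the slope conditions of the rows
starting at `ζ₅`. -/
lemma exists_kernel_twoLevel_five :
    ∃ s : Fin 3 → ℝ, q1 (twoLevel 5 y₀) s = 0 ∧ 0 < s 0 ∧ 0 < s 2 ∧ s 2 < s 1 := by
  obtain ⟨h0, h1, h2⟩ := y₀_spec
  have a1 : 0 < y₀ := by linarith
  have a2 : 0 < (1 - 4 * y₀) / 5 := by linarith
  have a3 : 0 < (1 - 4 * y₀) / 5 - y₀ := by linarith
  exact ⟨_, kernel_twoLevel_five, mul_pos (mul_pos two_pos a1) a2, mul_pos a1 a3,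
    mul_lt_mul_of_pos_right (by linarith) a3⟩

lemma kernel_twoLevel_six : q1 (twoLevel 6 (1 / 21)) ![1, 1, 0] = 0 := by
  simp [twoLevel, nuVec, q1]; norm_num

lemma kernel_twoLevel_seven : q1 (twoLevel 7 c₇) ![1 + √2, 1, 0] = 0 := by
  simp [twoLevel, nuVec, q1, c₇]
  linear_combination (-(23 + 14 * √2) / 137) * sqrt2_sq

lemma c₄_bounds : 0.0707 < c₄ ∧ c₄ < 0.0709 := by
  obtain ⟨h1, h2⟩ := sqrt17_bounds
  rw [c₄]; constructor <;> linarith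

lemma c₇_bounds : 0.0232 < c₇ ∧ c₇ < 0.0235 := by
  obtain ⟨h1, h2⟩ := sqrt2_bounds
  rw [c₇]; constructor <;> linarith

/-- Unless a block ends after six entries, indices 5 and 6 lie in the same block and `L₁ = L₂`. -/
lemma l1_nuVec_eq_zero {μ k : ℕ} (hμ : μ ≠ 6) (hk : μ + k ≠ 6) {a b c : ℝ}
    (hS : Sing (nuVec μ k a b c)) : l1 (nuVec μ k a b c) = 0 := by
  refine hS.l1_eq_zero ?_
  simp only [nuVec]
  have h1 : ((5 : Fin 9) : ℕ) < μ ↔ ((6 : Fin 9) : ℕ) < μ := by simp; omega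
  have h2 : ((5 : Fin 9) : ℕ) < μ + k ↔ ((6 : Fin 9) : ℕ) < μ + k := by simp; omega
  simp only [h1, h2]

lemma l1_slice_eq_zero {μ k : ℕ} (hμ : 0 < μ) (hs : μ + k ≤ 9) {a b c : ℝ}
    (ht : ∑ i, nuVec μ k a b c i = 1) (h : l1 (nuVec μ k a b c) = 0) :
    l1 (slice μ k b c) = 0 := by
  rw [slice, ← slice_eq_of_sum hμ hs ht]; exact h

lemma eq_aOf {μ k : ℕ} (hμ : 0 < μ) (hs : μ + k ≤ 9) {a b c : ℝ} {B : ℝ → ℝ}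
    (ht : ∑ i, nuVec μ k a b c i = 1) (hB : b = B c) : a = aOf μ k B c ∧ b = B c := by
  refine ⟨?_, hB⟩
  rw [aOf, ← hB]
  exact slice_eq_of_sum hμ hs ht

lemma sqrt_eq_of {x y : ℝ} (hy : 0 ≤ y) (h : x = y ^ 2) : √x = y := by
  rw [h, Real.sqrt_sq hy]

/-! ### Rows in which `L₁ = L₂` -/

lemma l1_nuVec_3_1 (a b c : ℝ) : l1 (nuVec 3 1 a b c) =
    2 * (a + c) * (b * (3 * c - a) - (a - c) ^ 2) := by
  simp [l1, L1, det_fin_three, nuVec]; ring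

theorem tableRow_3_1 : TableRow 3 1 c₄ (1 / 12)
    (fun c => (1 + 2 * c - √(1 - 20 * c + 132 * c ^ 2)) / 4)
    (fun c => (1 - 26 * c + 3 * √(1 - 20 * c + 132 * c ^ 2)) / 4) ζ₄ ζ₃ := by
  rw [ζ₄_eq, ζ₃_eq]
  obtain ⟨h1, h2⟩ := c₄_bounds
  obtain ⟨w1, w2⟩ := sqrt17_bounds
  refine tableRow_of_kernel (μ := 3) (k := 1) (by norm_num) (by norm_num) (by norm_num)
    (by linarith) (by linarith)
    (by norm_num) sing_twoLevel_four sing_twoLevel_three _ kernel_twoLevel_four ?_ ?_ ?_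
  · simp [q1, nuVec]; nlinarith
  · simp [q1, nuVec]; nlinarith
  · intro a b c hab hbc hc ht hS _
    have h0 := l1_nuVec_eq_zero (by norm_num) (by norm_num) hS
    rw [l1_nuVec_3_1] at h0
    have h3 : b * (3 * c - a) - (a - c) ^ 2 = 0 :=
      (mul_eq_zero.1 h0).resolve_left (by nlinarith)
    rw [sum_nuVec (by norm_num)] at ht
    norm_num at ht
    -- This fixes the sign of the square root: by the trace, `1 + 2c - 4a = b + 7c - a > 0`.
    have h4 : 0 < 3 * c - a := by
      by_contra! hcon
      nlinarith [sq_pos_of_pos (by linarith : 0 < a - c)]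
    have h5 : √(1 - 20 * c + 132 * c ^ 2) = 1 + 2 * c - 4 * a := by
      refine sqrt_eq_of (by linarith) ?_
      obtain rfl : b = 1 - 3 * a - 5 * c := by linarith
      linear_combination (-8) * h3
    simp only [h5]
    constructor <;> linarith

theorem tableRow_3_2 : TableRow 3 2 y₀ (1 / 12) (aOf 3 2 B324) B324 ζ₅ ζ₃ := by
  rw [ζ₅_eq, ζ₃_eq]
  obtain ⟨-, h1, h2⟩ := y₀_spec
  obtain ⟨s, hs, p0, p2, p1⟩ := exists_kernel_twoLevel_five
  have p1' := p2.trans p1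
  have p01 := mul_pos p0 p1'
  have p02 := mul_pos p0 p2
  have p12 := mul_pos p1' p2
  refine tableRow_of_kernel (μ := 3) (k := 2) (by norm_num) (by norm_num) (by norm_num)
    (by linarith)
    (by linarith) (by norm_num) sing_twoLevel_five sing_twoLevel_three s hs ?_ ?_ ?_
  · simp [q1, nuVec]; nlinarith
  · simp [q1, nuVec]; nlinarith
  · intro a b c hab hbc hc ht hS hpos
    have h0 := l1_slice_eq_zero (by norm_num) (by norm_num) ht
      (l1_nuVec_eq_zero (by norm_num) (by norm_num) hS)
    refine eq_aOf (by norm_num) (by norm_num) ht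
      -- The factor collects what remains of `1/μ³`, produced by eliminating `a`, once the cubic is
      -- normalised; likewise in the other rows.
      (realRoot_one_of_slice (κ := 2 / 27) (by norm_num) (by norm_num) ?_ h0 hpos ?_)
    · intro t
      simp [l1, L1, det_fin_three, slice, nuVec]; ring
    · rw [sum_nuVec (by norm_num)] at ht
      norm_num at ht
      linarith

theorem tableRow_3_4 : TableRow 3 4 c₇ (1 / 12) (aOf 3 4 B342) B342 ζ₇ ζ₃ := by
  rw [ζ₇_eq, ζ₃_eq]
  obtain ⟨h1, h2⟩ := c₇_bounds
  obtain ⟨w1, w2⟩ := sqrt2_bounds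
  refine tableRow_of_kernel (μ := 3) (k := 4) (by norm_num) (by norm_num) (by norm_num)
    (by linarith)
    (by linarith) (by norm_num) sing_twoLevel_seven sing_twoLevel_three _ kernel_twoLevel_seven
      ?_ ?_ ?_
  · simp [q1, nuVec]; nlinarith
  · simp [q1, nuVec]; nlinarith
  · intro a b c hab hbc hc ht hS hpos
    have h0 := l1_slice_eq_zero (by norm_num) (by norm_num) ht
      (l1_nuVec_eq_zero (by norm_num) (by norm_num) hS)
    refine eq_aOf (by norm_num) (by norm_num) ht
      (realRoot_one_of_slice (κ := 2 / 27) (by norm_num) (by norm_num) ?_ h0 hpos ?_)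
    · intro t
      simp [l1, L1, det_fin_three, slice, nuVec]; ring
    · rw [sum_nuVec (by norm_num)] at ht
      norm_num at ht
      linarith

theorem tableRow_4_1 : TableRow 4 1 y₀ c₄ (aOf 4 1 B414) B414 ζ₅ ζ₄ := by
  rw [ζ₅_eq, ζ₄_eq]
  obtain ⟨-, h1, h2⟩ := y₀_spec
  obtain ⟨h1', h2'⟩ := c₄_bounds
  obtain ⟨s, hs, p0, p2, p1⟩ := exists_kernel_twoLevel_five
  have p1' := p2.trans p1
  have p01 := mul_pos p0 p1'
  have p02 := mul_pos p0 p2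
  have p12 := mul_pos p1' p2
  refine tableRow_of_kernel (μ := 4) (k := 1) (by norm_num) (by norm_num) (by norm_num)
    (by linarith)
    (by linarith) (by linarith) sing_twoLevel_five sing_twoLevel_four s hs ?_ ?_ ?_
  · simp [q1, nuVec]; nlinarith
  · simp [q1, nuVec]; nlinarith
  · intro a b c hab hbc hc ht hS hpos
    have h0 := l1_slice_eq_zero (by norm_num) (by norm_num) ht
      (l1_nuVec_eq_zero (by norm_num) (by norm_num) hS)
    refine eq_aOf (by norm_num) (by norm_num) ht
      (realRoot_one_of_slice (κ := 1 / 16) (by norm_num) (by norm_num) ?_ h0 hpos ?_)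
    · intro t
      simp [l1, L1, det_fin_three, slice, nuVec]; ring
    · rw [sum_nuVec (by norm_num)] at ht
      norm_num at ht
      linarith

theorem tableRow_4_3 : TableRow 4 3 c₇ c₄ (aOf 4 3 B432) B432 ζ₇ ζ₄ := by
  rw [ζ₇_eq, ζ₄_eq]
  obtain ⟨h1, h2⟩ := c₇_bounds
  obtain ⟨h1', h2'⟩ := c₄_bounds
  obtain ⟨w1, w2⟩ := sqrt2_bounds
  refine tableRow_of_kernel (μ := 4) (k := 3) (by norm_num) (by norm_num) (by norm_num)
    (by linarith)
    (by linarith) (by linarith) sing_twoLevel_seven sing_twoLevel_four _ kernel_twoLevel_seven ?_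
      ?_ ?_
  · simp [q1, nuVec]; nlinarith
  · simp [q1, nuVec]; nlinarith
  · intro a b c hab hbc hc ht hS hpos
    have h0 := l1_slice_eq_zero (by norm_num) (by norm_num) ht
      (l1_nuVec_eq_zero (by norm_num) (by norm_num) hS)
    refine eq_aOf (by norm_num) (by norm_num) ht
      (realRoot_two_of_slice (κ := -1 / 16) (by norm_num) (by norm_num) ?_ h0 hpos)
    intro t
    simp [l1, L1, det_fin_three, slice, nuVec]; ring

theorem tableRow_5_2 : TableRow 5 2 c₇ y₀ (aOf 5 2 B522) B522 ζ₇ ζ₅ := by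
  rw [ζ₇_eq, ζ₅_eq]
  obtain ⟨h1, h2⟩ := c₇_bounds
  obtain ⟨-, h1', h2'⟩ := y₀_spec
  obtain ⟨w1, w2⟩ := sqrt2_bounds
  refine tableRow_of_kernel (μ := 5) (k := 2) (by norm_num) (by norm_num) (by norm_num)
    (by linarith)
    (by linarith) (by linarith) sing_twoLevel_seven sing_twoLevel_five _ kernel_twoLevel_seven ?_
      ?_ ?_
  · simp [q1, nuVec]; nlinarith
  · simp [q1, nuVec]; nlinarith
  · intro a b c hab hbc hc ht hS hpos
    have h0 := l1_slice_eq_zero (by norm_num) (by norm_num) ht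
      (l1_nuVec_eq_zero (by norm_num) (by norm_num) hS)
    refine eq_aOf (by norm_num) (by norm_num) ht
      (realRoot_two_of_slice (κ := -2 / 125) (by norm_num) (by norm_num) ?_ h0 hpos)
    intro t
    simp [l1, L1, det_fin_three, slice, nuVec]; ring

theorem tableRow_4_4 : TableRow 4 4 0 c₄ (aOf 4 4 B441) B441 ζ₈ ζ₄ := by
  rw [ζ₄_eq]
  obtain ⟨h1', h2'⟩ := c₄_bounds
  refine tableRow_of_zero (by norm_num) (by norm_num) (by norm_num) (by linarith)
    (by linarith) sing_twoLevel_four ?_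
  intro a b c hab hbc hc ht hS hpos
  have h0 := l1_slice_eq_zero (by norm_num) (by norm_num) ht
    (l1_nuVec_eq_zero (by norm_num) (by norm_num) hS)
  refine eq_aOf (by norm_num) (by norm_num) ht
    (realRoot_one_of_slice (κ := 1 / 16) (by norm_num) (by norm_num) ?_ h0 hpos ?_)
  · intro t
    simp [l1, L1, det_fin_three, slice, nuVec]; ring
  · rw [sum_nuVec (by norm_num)] at ht
    norm_num at ht
    linarith

theorem tableRow_5_3 : TableRow 5 3 0 y₀ (aOf 5 3 B531) B531 ζ₈ ζ₅ := by
  rw [ζ₅_eq]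
  obtain ⟨-, h1', h2'⟩ := y₀_spec
  refine tableRow_of_zero (by norm_num) (by norm_num) (by norm_num) (by linarith)
    (by linarith) sing_twoLevel_five ?_
  intro a b c hab hbc hc ht hS hpos
  have h0 := l1_slice_eq_zero (by norm_num) (by norm_num) ht
    (l1_nuVec_eq_zero (by norm_num) (by norm_num) hS)
  refine eq_aOf (by norm_num) (by norm_num) ht
    (realRoot_two_of_slice (κ := -2 / 125) (by norm_num) (by norm_num) ?_ h0 hpos)
  intro t
  simp [l1, L1, det_fin_three, slice, nuVec]; ring

lemma l1_nuVec_3_5 (a b c : ℝ) : l1 (nuVec 3 5 a b c) =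
    2 * (a + b) * (c * (3 * b - a) - (a - b) ^ 2) := by
  simp [l1, L1, det_fin_three, nuVec]; ring

theorem tableRow_3_5 : TableRow 3 5 0 (1 / 12)
    (fun c => (8 - 43 * c + 5 * √(16 * c + 33 * c ^ 2)) / 64)
    (fun c => (8 + 13 * c - 3 * √(16 * c + 33 * c ^ 2)) / 64) ζ₈ ζ₃ := by
  rw [ζ₃_eq]
  refine tableRow_of_zero (by norm_num) (by norm_num) (by norm_num) (by norm_num)
    (by norm_num) sing_twoLevel_three ?_
  intro a b c hab hbc hc ht hS _
  have h0 := l1_nuVec_eq_zero (by norm_num) (by norm_num) hS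
  rw [l1_nuVec_3_5] at h0
  have h3 : c * (3 * b - a) - (a - b) ^ 2 = 0 := (mul_eq_zero.1 h0).resolve_left (by nlinarith)
  rw [sum_nuVec (by norm_num)] at ht
  norm_num at ht
  have h5 : √(16 * c + 33 * c ^ 2) = 8 * a - 8 * b + 7 * c := by
    refine sqrt_eq_of (by linarith) ?_
    obtain rfl : c = 1 - 3 * a - 5 * b := by linarith
    linear_combination 64 * h3
  simp only [h5]
  constructor <;> linarith

lemma l1_nuVec_7_1 (a b c : ℝ) : l1 (nuVec 7 1 a b c) = 2 * a * (4 * a * c - (a - b) ^ 2) := by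
  simp [l1, L1, det_fin_three, nuVec]; ring

theorem tableRow_7_1 : TableRow 7 1 0 c₇
    (fun c => (4 - 3 * c + √(8 * c - 7 * c ^ 2)) / 32)
    (fun c => (4 - 11 * c - 7 * √(8 * c - 7 * c ^ 2)) / 32) ζ₈ ζ₇ := by
  rw [ζ₇_eq]
  obtain ⟨h1', h2'⟩ := c₇_bounds
  refine tableRow_of_zero (by norm_num) (by norm_num) (by norm_num) (by linarith)
    (by linarith) sing_twoLevel_seven ?_
  intro a b c hab hbc hc ht hS _
  have h0 := l1_nuVec_eq_zero (by norm_num) (by norm_num) hS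
  rw [l1_nuVec_7_1] at h0
  have h3 : 4 * a * c - (a - b) ^ 2 = 0 := (mul_eq_zero.1 h0).resolve_left (by nlinarith)
  rw [sum_nuVec (by norm_num)] at ht
  norm_num at ht
  have h5 : √(8 * c - 7 * c ^ 2) = 4 * a - 4 * b - c := by
    refine sqrt_eq_of ?_ ?_
    · nlinarith
    · obtain rfl : b = 1 - 7 * a - c := by linarith
      linear_combination 16 * h3
  simp only [h5]
  constructor <;> linarith

/-! ### Rows with `L₁ ≠ L₂` but a single branch -/

lemma l1_nonneg {x : Fin 9 → ℝ} (h : ∀ s, 0 ≤ q1 x s) : 0 ≤ l1 x :=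
  ((L1_posSemidef_iff _).2 h).det_nonneg

lemma l1_nuVec_3_3 (a b c : ℝ) : l1 (nuVec 3 3 a b c) =
    2 * (a + c) * (b * (3 * c - a) - (a - b) ^ 2) := by
  simp [l1, L1, det_fin_three, nuVec]; ring

lemma l2_nuVec_3_3 (a b c : ℝ) : l2 (nuVec 3 3 a b c) =
    2 * (a + b) * (c * (3 * b - a) - (a - c) ^ 2) := by
  simp [l2, L2, det_fin_three, nuVec]; ring

/-- The brackets in `l2` and `l1` differ by `(b - c)(b + c - a)`. If `a ≥ b + c`, the bracket in
`l1` is at most `-(a - 2b)²`, which is incompatible with `l1 ≥ 0`. -/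
lemma l2_pos_3_3 (a b c : ℝ) (hab : b < a) (hbc : c < b) (hc : 0 < c)
    (h : ∀ s, 0 ≤ q1 (nuVec 3 3 a b c) s) : 0 < l2 (nuVec 3 3 a b c) := by
  have h1 := l1_nonneg h
  rw [l1_nuVec_3_3] at h1
  have h2 : 0 ≤ b * (3 * c - a) - (a - b) ^ 2 := nonneg_of_mul_nonneg_right h1 (by linarith)
  have h3 : a < b + c := by
    by_contra! hcon
    have h4 : 0 ≤ b * (a - b - c) := mul_nonneg (by linarith) (by linarith)
    have h5 : a - 2 * b = 0 := by
      rw [← sq_eq_zero_iff]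
      nlinarith [sq_nonneg (a - 2 * b)]
    nlinarith [mul_pos (by linarith : 0 < b) (by linarith : 0 < a - b - c)]
  rw [l2_nuVec_3_3]
  refine mul_pos (by linarith) ?_
  nlinarith [mul_pos (by linarith : 0 < b - c) (by linarith : 0 < b + c - a)]

/-- The first branch does not include `L₁ ≥ O`, so it is recovered from `l1 = 0` by completing
squares; the analogues below serve the same purpose. -/
lemma q1_nonneg_3_3 (a b c : ℝ) (hab : b < a) (hbc : c < b) (hc : 0 < c)
    (h : l1 (nuVec 3 3 a b c) = 0) (s : Fin 3 → ℝ) : 0 ≤ q1 (nuVec 3 3 a b c) s := by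
  rw [l1_nuVec_3_3] at h
  have h2 : b * (3 * c - a) - (a - b) ^ 2 = 0 :=
    (mul_eq_zero.1 h).resolve_left (by linarith)
  have hb : 0 < b := hc.trans hbc
  refine nonneg_of_mul_nonneg_right (a := b) ?_ hb
  have e : b * q1 (nuVec 3 3 a b c) s =
      (b * s 2 - (a - b) * (s 0 + s 1) / 2) ^ 2 + b * (a + c) * ((s 0 - s 1) ^ 2 / 4) := by
    simp [q1, nuVec]
    linear_combination (s 0 + s 1) ^ 2 / 4 * h2
  rw [e]
  have : 0 < a + c := by linarith
  positivity

theorem tableRow_3_3 : TableRow 3 3 (1 / 21) (1 / 12) A333 B333 ζ₆ ζ₃ := by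
  rw [ζ₆_eq, ζ₃_eq]
  refine tableRow_of_kernel (μ := 3) (k := 3) (by norm_num) (by norm_num) (by norm_num)
    (by norm_num) (by norm_num) (by norm_num) sing_twoLevel_six sing_twoLevel_three _
    kernel_twoLevel_six ?_ ?_ ?_
  · simp [q1, nuVec]
  · simp [q1, nuVec]; norm_num
  · intro a b c hab hbc hc ht hS _
    have h0 := hS.2.resolve_right (l2_pos_3_3 a b c hab hbc hc fun s => (hS.1 s).1).ne'
    rw [l1_nuVec_3_3] at h0
    have h3 : b * (3 * c - a) - (a - b) ^ 2 = 0 :=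
      (mul_eq_zero.1 h0).resolve_left (by linarith)
    rw [sum_nuVec (by norm_num)] at ht
    norm_num at ht
    have h5 : √(3 * (-1 + 24 * c - 36 * c ^ 2)) = 9 * a - 9 * b + 9 * c := by
      refine sqrt_eq_of (by linarith) ?_
      obtain rfl : c = 1 / 3 - a - b := by linarith
      linear_combination 108 * h3
    rw [A333, B333, h5]
    constructor <;> linarith

theorem onlyFirstBranch_3_3 : OnlyFirstBranch 3 3 (1 / 21) (1 / 12) A333 B333 :=
  onlyFirstBranch_of (by norm_num) (by norm_num) (by norm_num) tableRow_3_3 l2_pos_3_3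
    q1_nonneg_3_3

lemma l1_nuVec_4_2 (a b c : ℝ) : l1 (nuVec 4 2 a b c) =
    2 * (a + c) * (a * (3 * c - a) - (a - b) ^ 2) := by
  simp [l1, L1, det_fin_three, nuVec]; ring

lemma l2_nuVec_4_2 (a b c : ℝ) : l2 (nuVec 4 2 a b c) =
    2 * (a + c) * (a * (3 * c - a) - (a - b) ^ 2) +
      2 * a * ((b - c) * (b + 5 * c - 2 * a)) := by
  simp [l2, L2, det_fin_three, nuVec]; ring

lemma l2_pos_4_2 (a b c : ℝ) (hab : b < a) (hbc : c < b) (hc : 0 < c)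
    (h : ∀ s, 0 ≤ q1 (nuVec 4 2 a b c) s) : 0 < l2 (nuVec 4 2 a b c) := by
  have h1 := l1_nonneg h
  rw [l1_nuVec_4_2] at h1
  have h2 : 0 ≤ a * (3 * c - a) - (a - b) ^ 2 := nonneg_of_mul_nonneg_right h1 (by linarith)
  -- Five times the bracket inequality bounds `3a(b + 5c - 2a)` below by the positive definite form
  -- `4a² - 7ab + 5b²`.
  have h3 : 0 < b + 5 * c - 2 * a := by
    refine pos_of_mul_pos_right (a := 3 * a) ?_ (by linarith)
    nlinarith [sq_nonneg (a - (a - b)), sq_nonneg (a - b), mul_pos (hc.trans hbc) hc]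
  rw [l2_nuVec_4_2]
  have := mul_pos (mul_pos two_pos (by linarith : 0 < a))
    (mul_pos (by linarith : 0 < b - c) h3)
  linarith

lemma q1_nonneg_4_2 (a b c : ℝ) (hab : b < a) (hbc : c < b) (hc : 0 < c)
    (h : l1 (nuVec 4 2 a b c) = 0) (s : Fin 3 → ℝ) : 0 ≤ q1 (nuVec 4 2 a b c) s := by
  rw [l1_nuVec_4_2] at h
  have h2 : a * (3 * c - a) - (a - b) ^ 2 = 0 :=
    (mul_eq_zero.1 h).resolve_left (by linarith)
  have ha : 0 < a := by linarith
  refine nonneg_of_mul_nonneg_right (a := a) ?_ ha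
  have e : a * q1 (nuVec 4 2 a b c) s =
      (a * s 2 - (a - b) * (s 0 + s 1) / 2) ^ 2 + a * (a + c) * ((s 0 - s 1) ^ 2 / 4) := by
    simp [q1, nuVec]
    linear_combination (s 0 + s 1) ^ 2 / 4 * h2
  rw [e]
  positivity

theorem tableRow_4_2 : TableRow 4 2 (1 / 21) c₄ A423 B423 ζ₆ ζ₄ := by
  rw [ζ₆_eq, ζ₄_eq]
  obtain ⟨h1', h2'⟩ := c₄_bounds
  refine tableRow_of_kernel (μ := 4) (k := 2) (by norm_num) (by norm_num) (by norm_num)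
    (by norm_num) (by linarith) (by linarith) sing_twoLevel_six sing_twoLevel_four _
    kernel_twoLevel_six ?_ ?_ ?_
  · simp [q1, nuVec]
  · simp [q1, nuVec]; norm_num
  · intro a b c hab hbc hc ht hS _
    have h0 := hS.2.resolve_right (l2_pos_4_2 a b c hab hbc hc fun s => (hS.1 s).1).ne'
    rw [l1_nuVec_4_2] at h0
    have h3 : a * (3 * c - a) - (a - b) ^ 2 = 0 :=
      (mul_eq_zero.1 h0).resolve_left (by linarith)
    rw [sum_nuVec (by norm_num)] at ht
    norm_num at ht
    have h5 : √(-1 + 24 * c - 54 * c ^ 2) = 8 * a - 6 * b - 3 * c := by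
      refine sqrt_eq_of (nonneg_of_mul_nonneg_right (a := a) ?_ (by linarith)) ?_
      · nlinarith [mul_pos (by linarith : 0 < a - b) (by linarith : 0 < b)]
      obtain rfl : b = (1 - 4 * a - 3 * c) / 2 := by linarith
      linear_combination 40 * h3
    rw [A423, B423, h5]
    constructor <;> linarith

theorem onlyFirstBranch_4_2 : OnlyFirstBranch 4 2 (1 / 21) c₄ A423 B423 :=
  onlyFirstBranch_of (by norm_num) (by norm_num) (by norm_num) tableRow_4_2 l2_pos_4_2
    q1_nonneg_4_2

lemma l1_nuVec_5_1 (a b c : ℝ) : l1 (nuVec 5 1 a b c) =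
    8 * a * c ^ 2 - 2 * c * (a - b) ^ 2 - 2 * a * (a - c) ^ 2 := by
  simp [l1, L1, det_fin_three, nuVec]; ring

lemma l2_nuVec_5_1 (a b c : ℝ) : l2 (nuVec 5 1 a b c) =
    8 * a * c ^ 2 - 2 * c * (a - b) ^ 2 - 2 * a * (a - c) ^ 2 +
      2 * ((b - c) * (4 * a * c + b * c - a ^ 2)) := by
  simp [l2, L2, det_fin_three, nuVec]; ring

lemma l2_pos_5_1 (a b c : ℝ) (hab : b < a) (hbc : c < b) (hc : 0 < c)
    (h : ∀ s, 0 ≤ q1 (nuVec 5 1 a b c) s) : 0 < l2 (nuVec 5 1 a b c) := by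
  have h1 := l1_nonneg h
  rw [l1_nuVec_5_1] at h1
  have ha : 0 < a := by linarith
  -- Dropping the middle term of `l1 ≥ 0` gives `a < 3c`, enough for the correction term in `l2` to
  -- be positive.
  have h2 : (a - c) ^ 2 < (2 * c) ^ 2 := by
    refine lt_of_mul_lt_mul_left (a := 2 * a) ?_ (by linarith)
    nlinarith [mul_pos hc (sq_pos_of_pos (by linarith : 0 < a - b))]
  have h3 : a - c < 2 * c := lt_of_pow_lt_pow_left₀ 2 (by linarith) h2
  rw [l2_nuVec_5_1]
  have : 0 < (b - c) * (4 * a * c + b * c - a ^ 2) :=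
    mul_pos (by linarith) (by nlinarith [mul_pos (hc.trans hbc) hc])
  linarith

lemma q1_nonneg_5_1 (a b c : ℝ) (hab : b < a) (hbc : c < b) (hc : 0 < c)
    (h : l1 (nuVec 5 1 a b c) = 0) (s : Fin 3 → ℝ) : 0 ≤ q1 (nuVec 5 1 a b c) s := by
  rw [l1_nuVec_5_1] at h
  have ha : 0 < a := by linarith
  refine nonneg_of_mul_nonneg_right (a := 4 * a * c) ?_ (by positivity)
  have e : 4 * a * c * q1 (nuVec 5 1 a b c) s =
      a * (2 * c * s 1 - (a - c) * s 0) ^ 2 + c * (2 * a * s 2 - (a - b) * s 0) ^ 2 := by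
    simp [q1, nuVec]
    linear_combination s 0 ^ 2 / 2 * h
  rw [e]
  positivity

theorem tableRow_5_1 : TableRow 5 1 (1 / 21) y₀ (aOf 5 1 B513) B513 ζ₆ ζ₅ := by
  rw [ζ₆_eq, ζ₅_eq]
  obtain ⟨-, h1', h2'⟩ := y₀_spec
  refine tableRow_of_kernel (μ := 5) (k := 1) (by norm_num) (by norm_num) (by norm_num)
    (by norm_num) (by linarith) (by linarith) sing_twoLevel_six sing_twoLevel_five _
    kernel_twoLevel_six ?_ ?_ ?_
  · simp [q1, nuVec]
  · simp [q1, nuVec]; norm_num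
  · intro a b c hab hbc hc ht hS hpos
    have h0 := l1_slice_eq_zero (by norm_num) (by norm_num) ht
      (hS.2.resolve_right (l2_pos_5_1 a b c hab hbc hc fun s => (hS.1 s).1).ne')
    refine eq_aOf (by norm_num) (by norm_num) ht
      (realRoot_one_of_slice (κ := 2 / 125) (by norm_num) (by norm_num) ?_ h0 hpos ?_)
    · intro t
      simp [l1, L1, det_fin_three, slice, nuVec]; ring
    · rw [sum_nuVec (by norm_num)] at ht
      norm_num at ht
      linarith

theorem onlyFirstBranch_5_1 : OnlyFirstBranch 5 1 (1 / 21) y₀ (aOf 5 1 B513) B513 :=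
  onlyFirstBranch_of (by norm_num) (by norm_num) (by norm_num) tableRow_5_1 l2_pos_5_1
    q1_nonneg_5_1

lemma l1_nuVec_6_1 (a b c : ℝ) : l1 (nuVec 6 1 a b c) =
    2 * a * (4 * b * c - (a - c) ^ 2) := by
  simp [l1, L1, det_fin_three, nuVec]; ring

lemma l2_nuVec_6_1 (a b c : ℝ) : l2 (nuVec 6 1 a b c) =
    2 * a * (4 * a * c - (a - c) ^ 2 - (a - b) ^ 2) := by
  simp [l2, L2, det_fin_three, nuVec]; ring

/-- The brackets differ by `(a - b)(4c - (a - b))`, and `a - b ≥ 4c` would contradict `(a - c)² ≤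
4bc`. -/
lemma l2_pos_6_1 (a b c : ℝ) (hab : b < a) (hbc : c < b) (hc : 0 < c)
    (h : ∀ s, 0 ≤ q1 (nuVec 6 1 a b c) s) : 0 < l2 (nuVec 6 1 a b c) := by
  have h1 := l1_nonneg h
  rw [l1_nuVec_6_1] at h1
  have h2 : 0 ≤ 4 * b * c - (a - c) ^ 2 := nonneg_of_mul_nonneg_right h1 (by linarith)
  have h3 : a - b < 4 * c := by
    by_contra! hcon
    have h4 : 0 < (a - c) * (a - c - 4 * c) := mul_pos (by linarith) (by linarith)
    nlinarith [mul_pos hc (by linarith : 0 < a - c - b)]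
  rw [l2_nuVec_6_1]
  refine mul_pos (by linarith) ?_
  nlinarith [mul_pos (by linarith : 0 < a - b) (by linarith : 0 < 4 * c - (a - b))]

lemma q1_nonneg_6_1 (a b c : ℝ) (hab : b < a) (hbc : c < b) (hc : 0 < c)
    (h : l1 (nuVec 6 1 a b c) = 0) (s : Fin 3 → ℝ) : 0 ≤ q1 (nuVec 6 1 a b c) s := by
  rw [l1_nuVec_6_1] at h
  have ha : 0 < a := by linarith
  have h2 : 4 * b * c - (a - c) ^ 2 = 0 := (mul_eq_zero.1 h).resolve_left (by linarith)
  refine nonneg_of_mul_nonneg_right (a := 4 * c) ?_ (by positivity)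
  have e : 4 * c * q1 (nuVec 6 1 a b c) s =
      (2 * c * s 0 - (a - c) * s 1) ^ 2 + 4 * a * c * s 2 ^ 2 := by
    simp [q1, nuVec]
    linear_combination s 1 ^ 2 * h2
  rw [e]
  positivity

theorem tableRow_6_1 : TableRow 6 1 c₇ (1 / 21) A612 B612 ζ₇ ζ₆ := by
  rw [ζ₇_eq, ζ₆_eq]
  obtain ⟨h1', h2'⟩ := c₇_bounds
  obtain ⟨w1, w2⟩ := sqrt2_bounds
  refine tableRow_of_kernel (μ := 6) (k := 1) (by norm_num) (by norm_num) (by norm_num)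
    (by linarith) (by linarith) (by norm_num) sing_twoLevel_seven sing_twoLevel_six _
    kernel_twoLevel_seven ?_ ?_ ?_
  · simp [q1, nuVec]; nlinarith
  · simp [q1, nuVec]; nlinarith
  · intro a b c hab hbc hc ht hS _
    have h0 := hS.2.resolve_right (l2_pos_6_1 a b c hab hbc hc fun s => (hS.1 s).1).ne'
    rw [l1_nuVec_6_1] at h0
    have h3 : 4 * b * c - (a - c) ^ 2 = 0 := (mul_eq_zero.1 h0).resolve_left (by linarith)
    rw [sum_nuVec (by norm_num)] at ht
    norm_num at ht
    have h5 : √(c + 28 * c ^ 2) = (a + 11 * c) / 2 := by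
      refine sqrt_eq_of (by linarith) ?_
      obtain rfl : b = 1 - 6 * a - 2 * c := by linarith
      linear_combination (1 / 4) * h3
    rw [A612, B612, h5]
    constructor <;> linarith

theorem onlyFirstBranch_6_1 : OnlyFirstBranch 6 1 c₇ (1 / 21) A612 B612 :=
  onlyFirstBranch_of (by norm_num) (by norm_num) (by norm_num) tableRow_6_1 l2_pos_6_1
    q1_nonneg_6_1

/-! ### The shape `(6, 2, 1)` with its two branches -/

lemma l1_nuVec_6_2 (a b c : ℝ) : l1 (nuVec 6 2 a b c) =
    2 * a * (4 * b * c - (a - b) ^ 2) := by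
  simp [l1, L1, det_fin_three, nuVec]; ring

lemma l2_nuVec_6_2 (a b c : ℝ) : l2 (nuVec 6 2 a b c) =
    4 * a * (2 * a * c - (a - b) ^ 2) := by
  simp [l2, L2, det_fin_three, nuVec]; ring

lemma sum_nuVec_6_2 (a b c : ℝ) : ∑ i, nuVec 6 2 a b c i = 6 * a + 2 * b + c := by
  rw [sum_nuVec (by norm_num)]; norm_num

section Branches

variable {a b c : ℝ} (hab : b < a) (hbc : c < b) (hc : 0 < c)

include hab hbc hc

lemma l1_6_2_eq_zero_iff : l1 (nuVec 6 2 a b c) = 0 ↔ (a - b) ^ 2 = 4 * b * c := by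
  have ha : a ≠ 0 := by linarith
  rw [l1_nuVec_6_2, mul_eq_zero, or_iff_right (by simpa using ha), sub_eq_zero, eq_comm]

lemma l2_6_2_eq_zero_iff : l2 (nuVec 6 2 a b c) = 0 ↔ (a - b) ^ 2 = 2 * a * c := by
  have ha : a ≠ 0 := by linarith
  rw [l2_nuVec_6_2, mul_eq_zero, or_iff_right (by simpa using ha), sub_eq_zero, eq_comm]

lemma q1_6_2_nonneg_iff :
    (∀ s, 0 ≤ q1 (nuVec 6 2 a b c) s) ↔ (a - b) ^ 2 ≤ 4 * b * c := by
  have ha : 0 < a := by linarith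
  constructor
  · intro h
    have h1 := l1_nonneg h
    rw [l1_nuVec_6_2] at h1
    exact sub_nonneg.1 (nonneg_of_mul_nonneg_right h1 (by linarith))
  · intro h s
    refine nonneg_of_mul_nonneg_right (a := 4 * c) ?_ (by positivity)
    have e : 4 * c * q1 (nuVec 6 2 a b c) s = (2 * c * s 0 - (a - b) * s 1) ^ 2 +
        (4 * b * c - (a - b) ^ 2) * s 1 ^ 2 + 4 * a * c * s 2 ^ 2 := by
      simp [q1, nuVec]; ring
    rw [e]
    have := sub_nonneg.2 h
    positivity

lemma q2_6_2_nonneg_iff :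
    (∀ s, 0 ≤ q2 (nuVec 6 2 a b c) s) ↔ (a - b) ^ 2 ≤ 2 * a * c := by
  have ha : 0 < a := by linarith
  constructor
  · intro h
    have h1 : 0 ≤ l2 (nuVec 6 2 a b c) := ((L2_posSemidef_iff _).2 h).det_nonneg
    rw [l2_nuVec_6_2] at h1
    exact sub_nonneg.1 (nonneg_of_mul_nonneg_right h1 (by linarith))
  · intro h s
    refine nonneg_of_mul_nonneg_right (a := 4 * a) ?_ (by positivity)
    have e : 4 * a * q2 (nuVec 6 2 a b c) s = (2 * a * s 1 - (a - b) * s 0) ^ 2 +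
        (2 * a * s 2 - (a - b) * s 0) ^ 2 + 2 * (2 * a * c - (a - b) ^ 2) * s 0 ^ 2 := by
      simp [q2, nuVec]; ring
    rw [e]
    have := sub_nonneg.2 h
    positivity

/-- On `(a - b)² = 4bc` the other inequality `(a - b)² ≤ 2ac` reads `2b ≤ a` after cancelling `2c`;
on the second branch the roles are exchanged. -/
lemma firstBranch_6_2_iff :
    FirstBranch 6 2 a b c ↔ (a - b) ^ 2 = 4 * b * c ∧ 2 * b ≤ a := by
  rw [FirstBranch, L2_posSemidef_iff, l1_6_2_eq_zero_iff hab hbc hc,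
    q2_6_2_nonneg_iff hab hbc hc]
  refine and_congr_right fun h => ?_
  rw [h]
  constructor <;> intro h' <;> nlinarith

lemma secondBranch_6_2_iff :
    SecondBranch 6 2 a b c ↔ (a - b) ^ 2 = 2 * a * c ∧ a ≤ 2 * b := by
  rw [SecondBranch, L1_posSemidef_iff, l2_6_2_eq_zero_iff hab hbc hc,
    q1_6_2_nonneg_iff hab hbc hc]
  refine and_congr_right fun h => ?_
  rw [h]
  constructor <;> intro h' <;> nlinarith

lemma sing_6_2_iff :
    Sing (nuVec 6 2 a b c) ↔ FirstBranch 6 2 a b c ∨ SecondBranch 6 2 a b c := by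
  rw [Sing, PSD, forall_and, q1_6_2_nonneg_iff hab hbc hc, q2_6_2_nonneg_iff hab hbc hc,
    FirstBranch, SecondBranch, L1_posSemidef_iff, L2_posSemidef_iff,
    l1_6_2_eq_zero_iff hab hbc hc, l2_6_2_eq_zero_iff hab hbc hc,
    q1_6_2_nonneg_iff hab hbc hc, q2_6_2_nonneg_iff hab hbc hc]
  constructor
  · rintro ⟨⟨h1, h2⟩, h | h⟩
    · exact Or.inl ⟨h, h2⟩
    · exact Or.inr ⟨h, h1⟩
  · rintro (⟨h1, h2⟩ | ⟨h1, h2⟩)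
    · exact ⟨⟨h1.le, h2⟩, Or.inl h1⟩
    · exact ⟨⟨h2, h1.le⟩, Or.inr h1⟩

end Branches

lemma sq_sqrt_first {c : ℝ} (hc : 0 < c) : √(2 * c + 7 * c ^ 2) ^ 2 = 2 * c + 7 * c ^ 2 :=
  Real.sq_sqrt (by positivity)

lemma sq_sqrt_second {c : ℝ} (hc : 0 < c) (h : c ≤ 1) :
    √(4 * c - 3 * c ^ 2) ^ 2 = 4 * c - 3 * c ^ 2 :=
  Real.sq_sqrt (by nlinarith)

theorem firstBranch_6_2_iff_onCurve {a b c : ℝ} (hab : b < a) (hbc : c < b) (hc : 0 < c)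
    (ht : ∑ i, nuVec 6 2 a b c i = 1) : FirstBranch 6 2 a b c ↔
      OnCurve (Ico (1 / 57) (1 / 21)) A621₁ B621₁ a b c := by
  rw [firstBranch_6_2_iff hab hbc hc]
  rw [sum_nuVec_6_2] at ht
  have hb : 0 < b := hc.trans hbc
  constructor
  · rintro ⟨h1, h2⟩
    have h5 : √(2 * c + 7 * c ^ 2) = 2 * a - 2 * b + 3 * c := by
      refine sqrt_eq_of (by linarith) ?_
      linear_combination (-2 * c) * ht - 4 * h1
    refine ⟨⟨?_, ?_⟩, ?_, ?_⟩
    -- By the trace the claim is `56c ≥ 6a + 2b`. Multiplied by `b` and with `4bc = d²`, `d = a -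
    -- b`, the difference factors as `(14d + 8b)(d - b)`.
    · have : 0 ≤ b * (56 * c - (6 * a + 2 * b)) := by
        nlinarith [mul_nonneg (by linarith : 0 ≤ 14 * (a - b) + 8 * b)
          (by linarith : 0 ≤ a - b - b)]
      linarith [nonneg_of_mul_nonneg_right this hb]
    · have h3 : (a - b) ^ 2 < (2 * b) ^ 2 := by nlinarith
      have h4 : a - b < 2 * b := lt_of_pow_lt_pow_left₀ 2 (by linarith) h3
      have : 0 < b * (6 * a + 2 * b - 20 * c) := by
        nlinarith [mul_pos (by linarith : 0 < 5 * (a - b) + 4 * b)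
          (by linarith : 0 < 2 * b - (a - b))]
      linarith [pos_of_mul_pos_right this hb.le]
    · rw [A621₁, h5]; linarith
    · rw [B621₁, h5]; linarith
  · rintro ⟨⟨h1, h2⟩, rfl, rfl⟩
    have hr := sq_sqrt_first hc
    constructor
    · rw [A621₁, B621₁]
      linear_combination (1 / 4) * hr
    -- After squaring this is `(57c - 1)(c - 1) ≤ 0`, so `1/57` is the threshold.
    · have : 1 + 20 * c ≤ 7 * √(2 * c + 7 * c ^ 2) := by
        refine (pow_le_pow_iff_left₀ (by positivity) (by positivity) two_ne_zero).1 ?_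
        nlinarith
      rw [A621₁, B621₁]; linarith

theorem secondBranch_6_2_iff_onCurve {a b c : ℝ} (hab : b < a) (hbc : c < b) (hc : 0 < c)
    (ht : ∑ i, nuVec 6 2 a b c i = 1) : SecondBranch 6 2 a b c ↔
      OnCurve (Ioc 0 (1 / 57)) A621₂ B621₂ a b c := by
  rw [secondBranch_6_2_iff hab hbc hc]
  rw [sum_nuVec_6_2] at ht
  have hb : 0 < b := hc.trans hbc
  constructor
  · rintro ⟨h1, h2⟩
    have h5 : √(4 * c - 3 * c ^ 2) = 4 * a - 4 * b - c := by
      refine sqrt_eq_of ?_ ?_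
      · refine nonneg_of_mul_nonneg_right (a := a) ?_ (by linarith)
        nlinarith
      · linear_combination (-4 * c) * ht - 16 * h1
    refine ⟨⟨hc, ?_⟩, ?_, ?_⟩
    · have : 0 ≤ a * (6 * a + 2 * b - 56 * c) := by
        nlinarith [mul_nonneg (by linarith : 0 ≤ 14 * (a - b) + 8 * a)
          (by linarith : 0 ≤ a - 2 * (a - b))]
      linarith [nonneg_of_mul_nonneg_right this (hb.trans hab)]
    · rw [A621₂, h5]; linarith
    · rw [B621₂, h5]; linarith
  · rintro ⟨⟨h1, h2⟩, rfl, rfl⟩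
    have hr := sq_sqrt_second hc (by linarith)
    constructor
    · rw [A621₂, B621₂]
      linear_combination (1 / 16) * hr
    -- After squaring this is `4(57c - 1)(c - 1) ≥ 0`, the same threshold from the other side.
    · have : 7 * √(4 * c - 3 * c ^ 2) ≤ 2 - 9 * c := by
        refine (pow_le_pow_iff_left₀ (by positivity) (by linarith) two_ne_zero).1 ?_
        nlinarith
      rw [A621₂, B621₂]; linarith

theorem l1_l2_6_2_eq_zero_iff {a b c : ℝ} (hab : b < a) (hbc : c < b) (hc : 0 < c)
    (ht : ∑ i, nuVec 6 2 a b c i = 1) :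
    l1 (nuVec 6 2 a b c) = 0 ∧ l2 (nuVec 6 2 a b c) = 0 ↔
      a = 8 / 57 ∧ b = 4 / 57 ∧ c = 1 / 57 := by
  rw [l1_6_2_eq_zero_iff hab hbc hc, l2_6_2_eq_zero_iff hab hbc hc]
  rw [sum_nuVec_6_2] at ht
  constructor
  · rintro ⟨h1, h2⟩
    obtain rfl : a = 2 * b := by
      have : c * (a - 2 * b) = 0 := by linarith
      linarith [(mul_eq_zero.1 this).resolve_left hc.ne']
    obtain rfl : b = 4 * c := by
      have : b * (b - 4 * c) = 0 := by linarith
      linarith [(mul_eq_zero.1 this).resolve_left (by linarith)]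
    refine ⟨?_, ?_, ?_⟩ <;> linarith
  · rintro ⟨rfl, rfl, rfl⟩
    norm_num

theorem admissible_6_2_first : Admissible (Ico (1 / 57) (1 / 21)) A621₁ B621₁ := by
  rintro c ⟨h1, h2⟩
  have hc : 0 < c := by linarith
  have h3 : 3 * c < √(2 * c + 7 * c ^ 2) := Real.lt_sqrt_of_sq_lt (by nlinarith)
  have h4 : √(2 * c + 7 * c ^ 2) < 1 / 3 := (Real.sqrt_lt' (by norm_num)).2 (by nlinarith)
  rw [A621₁, B621₁]
  refine ⟨?_, ?_, hc⟩ <;> linarith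

theorem admissible_6_2_second : Admissible (Ioc 0 (1 / 57)) A621₂ B621₂ := by
  rintro c ⟨hc, h2⟩
  have h3 := Real.sqrt_nonneg (4 * c - 3 * c ^ 2)
  have h4 : √(4 * c - 3 * c ^ 2) < (2 - 21 * c) / 3 :=
    (Real.sqrt_lt' (by linarith)).2 (by nlinarith)
  rw [A621₂, B621₂]
  refine ⟨?_, ?_, hc⟩ <;> linarith

lemma sum_nuVec_first (c : ℝ) : ∑ i, nuVec 6 2 (A621₁ c) (B621₁ c) c i = 1 := by
  rw [sum_nuVec_6_2, A621₁, B621₁]; ring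

lemma sum_nuVec_second (c : ℝ) : ∑ i, nuVec 6 2 (A621₂ c) (B621₂ c) c i = 1 := by
  rw [sum_nuVec_6_2, A621₂, B621₂]; ring

theorem nu_6_2_mem_extremeAP_iff {a b c : ℝ} (hab : b < a) (hbc : c < b) (hc : 0 < c) :
    nu 6 2 a b c ∈ extremeAP ↔ OnCurve (Ico (1 / 57) (1 / 21)) A621₁ B621₁ a b c ∨
      OnCurve (Ioc 0 (1 / 57)) A621₂ B621₂ a b c := by
  rw [nu_mem_extremeAP_iff (by norm_num) (by norm_num) (by norm_num) hab hbc hc,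
    sing_6_2_iff hab hbc hc]
  constructor
  · rintro ⟨ht, h⟩
    rwa [firstBranch_6_2_iff_onCurve hab hbc hc ht,
      secondBranch_6_2_iff_onCurve hab hbc hc ht] at h
  · intro h
    have ht : ∑ i, nuVec 6 2 a b c i = 1 := by
      rcases h with ⟨-, rfl, rfl⟩ | ⟨-, rfl, rfl⟩
      · exact sum_nuVec_first c
      · exact sum_nuVec_second c
    rw [firstBranch_6_2_iff_onCurve hab hbc hc ht,
      secondBranch_6_2_iff_onCurve hab hbc hc ht]
    exact ⟨ht, h⟩

theorem tendsto_6_2_first :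
    Tendsto (fun c => nu 6 2 (A621₁ c) (B621₁ c) c) (𝓝[<] (1 / 21)) (𝓝 ζ₆) := by
  have hA : Continuous A621₁ := by unfold A621₁; fun_prop
  have hB : Continuous B621₁ := by unfold B621₁; fun_prop
  have hr : √(2 * (1 / 21) + 7 * (1 / 21) ^ 2 : ℝ) = 1 / 3 :=
    sqrt_eq_of (by norm_num) (by norm_num)
  have h := tendsto_nu (μ := 6) (k := 2) (hA.continuousAt.mono_left nhdsWithin_le_nhds)
    (hB.continuousAt.mono_left nhdsWithin_le_nhds)
    (nhdsWithin_le_nhds : 𝓝[<] (1 / 21 : ℝ) ≤ 𝓝 (1 / 21))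
  convert h using 2
  rw [A621₁, B621₁, hr, ζ₆_eq, nu, twoLevel, ← nuVec_right_eq 6 2]
  norm_num

theorem tendsto_6_2_second :
    Tendsto (fun c => nu 6 2 (A621₂ c) (B621₂ c) c) (𝓝[>] 0) (𝓝 ζ₈) := by
  have hA : Continuous A621₂ := by unfold A621₂; fun_prop
  have hB : Continuous B621₂ := by unfold B621₂; fun_prop
  have h := tendsto_nu (μ := 6) (k := 2) (hA.continuousAt.mono_left nhdsWithin_le_nhds)
    (hB.continuousAt.mono_left nhdsWithin_le_nhds)
    (nhdsWithin_le_nhds : 𝓝[>] (0 : ℝ) ≤ 𝓝 0)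
  convert h using 2
  rw [A621₂, B621₂, ζ₈_eq, nu, twoLevel, ← nuVec_left_eq 6 2]
  norm_num

lemma nu_6_2_corner : nu 6 2 (8 / 57) (4 / 57) (1 / 57) =
    diag9 ((1 / 57 : ℝ) • ![8, 8, 8, 8, 8, 8, 4, 4, 1]) := by
  rw [nu]
  congr 1
  ext i
  fin_cases i <;> simp [nuVec] <;> norm_num

lemma curve_6_2_first_corner :
    A621₁ (1 / 57) = 8 / 57 ∧ B621₁ (1 / 57) = 4 / 57 := by
  have hr : √(2 * (1 / 57) + 7 * (1 / 57) ^ 2 : ℝ) = 11 / 57 :=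
    sqrt_eq_of (by norm_num) (by norm_num)
  rw [A621₁, B621₁, hr]; norm_num

lemma curve_6_2_second_corner :
    A621₂ (1 / 57) = 8 / 57 ∧ B621₂ (1 / 57) = 4 / 57 := by
  have hr : √(4 * (1 / 57) - 3 * (1 / 57) ^ 2 : ℝ) = 15 / 57 :=
    sqrt_eq_of (by norm_num) (by norm_num)
  rw [A621₂, B621₂, hr]; norm_num

theorem corner_mem_extremeAP :
    diag9 ((1 / 57 : ℝ) • ![8, 8, 8, 8, 8, 8, 4, 4, 1]) ∈ extremeAP := by
  rw [← nu_6_2_corner, nu_6_2_mem_extremeAP_iff (by norm_num) (by norm_num) (by norm_num)]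
  exact Or.inl ⟨by norm_num, curve_6_2_first_corner.1.symm, curve_6_2_first_corner.2.symm⟩

end AbsPPT

theorem mainTheorem7 :
    -- the constant that bounds several of the intervals
    ((0.056991 : ℝ) < y₀ ∧ y₀ < 0.056992) ∧
    -- largest eigenvalue of multiplicity three
    TableRow 3 1 c₄ (1 / 12)
      (fun c => (1 + 2 * c - √(1 - 20 * c + 132 * c ^ 2)) / 4)
      (fun c => (1 - 26 * c + 3 * √(1 - 20 * c + 132 * c ^ 2)) / 4) ζ₄ ζ₃ ∧
    TableRow 3 2 y₀ (1 / 12) (aOf 3 2 B324) B324 ζ₅ ζ₃ ∧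
    TableRow 3 3 (1 / 21) (1 / 12) A333 B333 ζ₆ ζ₃ ∧
    OnlyFirstBranch 3 3 (1 / 21) (1 / 12) A333 B333 ∧
    TableRow 3 4 c₇ (1 / 12) (aOf 3 4 B342) B342 ζ₇ ζ₃ ∧
    TableRow 3 5 0 (1 / 12)
      (fun c => (8 - 43 * c + 5 * √(16 * c + 33 * c ^ 2)) / 64)
      (fun c => (8 + 13 * c - 3 * √(16 * c + 33 * c ^ 2)) / 64) ζ₈ ζ₃ ∧
    -- largest eigenvalue of multiplicity four
    TableRow 4 1 y₀ c₄ (aOf 4 1 B414) B414 ζ₅ ζ₄ ∧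
    TableRow 4 2 (1 / 21) c₄ A423 B423 ζ₆ ζ₄ ∧
    OnlyFirstBranch 4 2 (1 / 21) c₄ A423 B423 ∧
    TableRow 4 3 c₇ c₄ (aOf 4 3 B432) B432 ζ₇ ζ₄ ∧
    TableRow 4 4 0 c₄ (aOf 4 4 B441) B441 ζ₈ ζ₄ ∧
    -- largest eigenvalue of multiplicity five
    TableRow 5 1 (1 / 21) y₀ (aOf 5 1 B513) B513 ζ₆ ζ₅ ∧
    OnlyFirstBranch 5 1 (1 / 21) y₀ (aOf 5 1 B513) B513 ∧
    TableRow 5 2 c₇ y₀ (aOf 5 2 B522) B522 ζ₇ ζ₅ ∧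
    TableRow 5 3 0 y₀ (aOf 5 3 B531) B531 ζ₈ ζ₅ ∧
    -- largest eigenvalue of multiplicity six
    TableRow 6 1 c₇ (1 / 21) A612 B612 ζ₇ ζ₆ ∧
    OnlyFirstBranch 6 1 c₇ (1 / 21) A612 B612 ∧
    Admissible (Ico (1 / 57) (1 / 21)) A621₁ B621₁ ∧
    Admissible (Ioc 0 (1 / 57)) A621₂ B621₂ ∧
    (∀ a b c : ℝ, b < a → c < b → 0 < c →
      (nu 6 2 a b c ∈ extremeAP ↔
        OnCurve (Ico (1 / 57) (1 / 21)) A621₁ B621₁ a b c ∨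
        OnCurve (Ioc 0 (1 / 57)) A621₂ B621₂ a b c)) ∧
    (∀ a b c : ℝ, b < a → c < b → 0 < c → ∑ i, nuVec 6 2 a b c i = 1 →
      (FirstBranch 6 2 a b c ↔ OnCurve (Ico (1 / 57) (1 / 21)) A621₁ B621₁ a b c) ∧
      (SecondBranch 6 2 a b c ↔ OnCurve (Ioc 0 (1 / 57)) A621₂ B621₂ a b c) ∧
      (l1 (nuVec 6 2 a b c) = 0 ∧ l2 (nuVec 6 2 a b c) = 0 ↔
        a = 8 / 57 ∧ b = 4 / 57 ∧ c = 1 / 57)) ∧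
    Tendsto (fun c => nu 6 2 (A621₁ c) (B621₁ c) c) (𝓝[<] (1 / 21)) (𝓝 ζ₆) ∧
    Tendsto (fun c => nu 6 2 (A621₂ c) (B621₂ c) c) (𝓝[>] 0) (𝓝 ζ₈) ∧
    nu 6 2 (A621₁ (1 / 57)) (B621₁ (1 / 57)) (1 / 57) =
      diag9 ((1 / 57 : ℝ) • ![8, 8, 8, 8, 8, 8, 4, 4, 1]) ∧
    nu 6 2 (A621₂ (1 / 57)) (B621₂ (1 / 57)) (1 / 57) =
      diag9 ((1 / 57 : ℝ) • ![8, 8, 8, 8, 8, 8, 4, 4, 1]) ∧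
    diag9 ((1 / 57 : ℝ) • ![8, 8, 8, 8, 8, 8, 4, 4, 1]) ∈ extremeAP ∧
    -- largest eigenvalue of multiplicity seven
    TableRow 7 1 0 c₇
      (fun c => (4 - 3 * c + √(8 * c - 7 * c ^ 2)) / 32)
      (fun c => (4 - 11 * c - 7 * √(8 * c - 7 * c ^ 2)) / 32) ζ₈ ζ₇ := by
  exact ⟨y₀_spec.2, tableRow_3_1, tableRow_3_2, tableRow_3_3, onlyFirstBranch_3_3, tableRow_3_4,
    tableRow_3_5, tableRow_4_1, tableRow_4_2, onlyFirstBranch_4_2, tableRow_4_3, tableRow_4_4,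
    tableRow_5_1, onlyFirstBranch_5_1, tableRow_5_2, tableRow_5_3, tableRow_6_1,
    onlyFirstBranch_6_1, admissible_6_2_first, admissible_6_2_second,
    fun a b c hab hbc hc => nu_6_2_mem_extremeAP_iff hab hbc hc,
    fun a b c hab hbc hc ht => ⟨firstBranch_6_2_iff_onCurve hab hbc hc ht,
      secondBranch_6_2_iff_onCurve hab hbc hc ht, l1_l2_6_2_eq_zero_iff hab hbc hc ht⟩,
    tendsto_6_2_first, tendsto_6_2_second,
    by rw [curve_6_2_first_corner.1, curve_6_2_first_corner.2, nu_6_2_corner],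
    by rw [curve_6_2_second_corner.1, curve_6_2_second_corner.2, nu_6_2_corner],
    corner_mem_extremeAP, tableRow_7_1⟩
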